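/- Let $0<\alpha<(\sqrt5-1)/2$. Then there exist a strictly decreasing sequence $(a_m)_{m\in\mathbb Z}$ in $[0,1]$ with $a_m\to0$ as $m\to+\infty$ and $a_m\to1$ as $m\to-\infty$, points $b_k,u_k,v_k,c_k$ ($k\ge1$) with $$a_{2^k+1}<b_k<u_k<v_k<c_k<a_{2^k},$$ and homeomorphisms $f,g$ of $[0,1]$ such that the following hold. 1. (Hector-type construction with $n_k=2^k$.) $f(a_{m+1})=a_m$ for all $m\in\mathbb Z$; $g$ is the identity on $[a_{m+1},a_m]$ for every $m\in\mathbb Z\setminus\{2^k:k\ge1\}$; and for every $k\ge1$, $g$ is the identity on $[a_{2^k+1},b_k]\cup[c_k,a_{2^k}]$, $g(u_k)=v_k$, $g$ has no fixed point in $(b_k,c_k)$, and $f^{2^k}(u_{k+1})=b_k$, $f^{2^k}(v_{k+1})=c_k$. 2. $f$ and $g$ are $C^{1+\alpha}$ diffeomorphisms of $[0,1]$: they and their inverses are differentiable with $\alpha$-Hölder derivative on $[0,1]$. 3. Let $X$ be any connected (Hausdorff, second countable, finite-dimensional) smooth manifold without boundary, on which a group $\Gamma$ acts smoothly, freely and properly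 discontinuously, and let $\rho:\Gamma\to\mathrm{Homeo}([0,1])$ be a homomorphism with image $\langle f,g\rangle$. Let $M=(X\times[0,1])/\Gamma$ be the suspension of $\rho$, the quotient by the diagonal action $\gamma(x,t)=(\gamma x,\rho(\gamma)t)$. Then the charts $[x,t]\mapsto(\varphi(x),t)$, where $\varphi$ is a chart of $X$ and $x$ ranges over an open subset of its domain disjoint from its nontrivial translates, form a foliated atlas on the (Hausdorff, second countable) space $M$. It defines a codimension-one foliation of class $C^1$, transversely of class $C^{1+\alpha}$: changes of charts are $C^1$ and locally of the form $(y,t)\mapsto(h_1(y,t),h(t))$ with $h$ of class $C^{1+\alpha}$. This foliation does not have the LMS property. 4. There are $X,\Gamma,\rho$ as in 3 for which $M$ is compact. Consequently, for transversely $C^{1+\alpha}$ codimension-one foliations of class $C^1$ on compact manifolds, the LMS property can fail. Here a foliation has the *LMS property* if for every open saturated set $W$ and every leaf $L\subset W$, the relative closure $\overline L\cap W$ contains a minimal set of the foliation restricted to $W$, that is, a nonempty saturated subset of $W$, closed in $W$, that has no proper subset with these properties. (A set is saturated if it is a union of leaves.) -/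

import Mathlib

open Set Filter Topology unitInterval
open scoped Manifold ContDiff

noncomputable section

/-! ### Maps of class `C^{1+α}` -/

/-- `h` is of class `C^{1+α}` on `s ⊆ ℝ`: it is differentiable on `s` (one-sidedly at end points)
and its derivative is `α`-Hölder on `s`. -/
def C1HolderOn (α : ℝ) (h : ℝ → ℝ) (s : Set ℝ) : Prop :=
  ∃ h' : ℝ → ℝ, (∀ x ∈ s, HasDerivWithinAt h (h' x) s x) ∧
    ∃ C : ℝ, ∀ x ∈ s, ∀ y ∈ s, |h' x - h' y| ≤ C * |x - y| ^ α

/-- A self-map of `[0,1]`, read as a real function (extended constantly outside `[0,1]`). -/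
def toRealMap (f : I → I) : ℝ → ℝ := fun x => f (projIcc 0 1 zero_le_one x)

/-- A `C^{1+α}` diffeomorphism of `[0,1]`: a homeomorphism which is of class `C^{1+α}` together
with its inverse. -/
def IsC1HolderDiffeo (α : ℝ) (f : I ≃ₜ I) : Prop :=
  C1HolderOn α (toRealMap f) (Icc 0 1) ∧ C1HolderOn α (toRealMap f.symm) (Icc 0 1)

/-! ### The Hector-type construction -/

/-- The homeomorphisms `f`, `g` of `[0,1]` are obtained by the Hector-type construction from the
sequences `(a_m)_{m ∈ ℤ}`, `(n_k)_{k ≥ 1}` and `(b_k)`, `(u_k)`, `(v_k)`, `(c_k)`, `k ≥ 1`.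
Values of the latter sequences at `k = 0` are irrelevant. -/
structure IsHectorConstruction (n : ℕ → ℕ) (a : ℤ → I) (b u v c : ℕ → I) (f g : I ≃ₜ I) :
    Prop where
  a_lt : ∀ m : ℤ, a (m + 1) < a m
  a_tendsto_zero : Tendsto a atTop (𝓝 0)
  a_tendsto_one : Tendsto a atBot (𝓝 1)
  n_pos : ∀ k, 1 ≤ k → 0 < n k
  n_lt : ∀ k, 1 ≤ k → n k < n (k + 1)
  f_shift : ∀ m : ℤ, f (a (m + 1)) = a m
  a_lt_b : ∀ k, 1 ≤ k → a ((n k : ℤ) + 1) < b k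
  b_lt_u : ∀ k, 1 ≤ k → b k < u k
  u_lt_v : ∀ k, 1 ≤ k → u k < v k
  v_lt_c : ∀ k, 1 ≤ k → v k < c k
  c_lt_a : ∀ k, 1 ≤ k → c k < a (n k : ℤ)
  g_eq_of_ne : ∀ m : ℤ, (∀ k, 1 ≤ k → m ≠ (n k : ℤ)) → ∀ x ∈ Icc (a (m + 1)) (a m), g x = x
  g_eq_left : ∀ k, 1 ≤ k → ∀ x ∈ Icc (a ((n k : ℤ) + 1)) (b k), g x = x
  g_eq_right : ∀ k, 1 ≤ k → ∀ x ∈ Icc (c k) (a (n k : ℤ)), g x = x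
  g_u : ∀ k, 1 ≤ k → g (u k) = v k
  g_ne : ∀ k, 1 ≤ k → ∀ x ∈ Ioo (b k) (c k), g x ≠ x
  iterate_u : ∀ k, 1 ≤ k → (⇑f)^[n (k + 1) - n k] (u (k + 1)) = b k
  iterate_v : ∀ k, 1 ≤ k → (⇑f)^[n (k + 1) - n k] (v (k + 1)) = c k

/-! ### Codimension-one foliations

Foliated charts take values in `E × [0,1]`, the last coordinate being the transverse one; the
boundary of the manifold (if any) is thus a union of leaves. -/

section Foliation

variable {E : Type*} [NormedAddCommGroup E] [NormedSpace ℝ E]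
variable {M : Type*} [TopologicalSpace M]

/-- A change of foliated charts of class `C^1`, transversely of class `C^{1+α}`: it is `C^1`
(up to the boundary) and it is locally of the form `(y, t) ↦ (h₁ (y, t), h t)` with `h` of class
`C^{1+α}`. -/
def IsFoliatedTransition (α : ℝ) (φ : OpenPartialHomeomorph (E × I) (E × I)) : Prop :=
  ContDiffOn ℝ 1
    (fun p : E × ℝ => ((φ (p.1, projIcc 0 1 zero_le_one p.2)).1,
      ((φ (p.1, projIcc 0 1 zero_le_one p.2)).2 : ℝ)))
    {p : E × ℝ | p.2 ∈ Icc (0 : ℝ) 1 ∧ (p.1, projIcc 0 1 zero_le_one p.2) ∈ φ.source} ∧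
  ∀ p ∈ φ.source, ∃ δ > 0, ∃ h : ℝ → ℝ,
    C1HolderOn α h (Icc 0 1 ∩ Ioo ((p.2 : ℝ) - δ) ((p.2 : ℝ) + δ)) ∧
    ∀ᶠ q in 𝓝 p, ((φ q).2 : ℝ) = h (q.2 : ℝ)

/-- The set `A` of charts is a foliated atlas on the manifold `M`, defining a codimension-one
foliation of class `C^1` which is transversely of class `C^{1+α}`. -/
structure IsC1HolderFoliation (α : ℝ) (A : Set (OpenPartialHomeomorph M (E × I))) : Prop where
  t2 : T2Space M
  secondCountable : SecondCountableTopology M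
  covers : ∀ x : M, ∃ e ∈ A, x ∈ e.source
  compatible : ∀ e ∈ A, ∀ e' ∈ A, IsFoliatedTransition α (e.symm.trans e')

/-- `x` and `y` lie in a common plaque of some chart of `A`. -/
def SamePlaque (A : Set (OpenPartialHomeomorph M (E × I))) (x y : M) : Prop :=
  ∃ e ∈ A, ∃ (S : Set E) (t : I), IsPreconnected S ∧ S ×ˢ {t} ⊆ e.target ∧
    x ∈ e.symm '' (S ×ˢ {t}) ∧ y ∈ e.symm '' (S ×ˢ {t})

/-- The leaf through `x`: all points that are joined to `x` by a finite chain of plaques. -/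
def leaf (A : Set (OpenPartialHomeomorph M (E × I))) (x : M) : Set M :=
  {y | Relation.EqvGen (SamePlaque A) x y}

/-- A saturated set: a union of leaves. -/
def IsSaturated (A : Set (OpenPartialHomeomorph M (E × I))) (W : Set M) : Prop :=
  ∀ x ∈ W, leaf A x ⊆ W

/-- A non-empty saturated subset of `W` that is closed relatively to `W`. -/
structure IsRelClosedSaturated (A : Set (OpenPartialHomeomorph M (E × I))) (W K : Set M) :
    Prop where
  subset : K ⊆ W
  nonempty : K.Nonempty
  saturated : IsSaturated A K
  closed : closure K ∩ W ⊆ K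

/-- `K` is a minimal set of the restriction of the foliation to the open saturated set `W` (whose
leaves are the leaves of the foliation that are contained in `W`). -/
def IsMinimalSetIn (A : Set (OpenPartialHomeomorph M (E × I))) (W K : Set M) : Prop :=
  IsRelClosedSaturated A W K ∧ ∀ K' ⊆ K, IsRelClosedSaturated A W K' → K' = K

/-- The LMS (local minimal set) property: for every open saturated set `W` and every leaf
`L ⊆ W`, the relative closure of `L` in `W` contains a minimal set of the restriction to `W`. -/
def HasLMS (A : Set (OpenPartialHomeomorph M (E × I))) : Prop :=
  ∀ W : Set M, IsOpen W → IsSaturated A W → ∀ x : M, leaf A x ⊆ W →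
    ∃ K, IsMinimalSetIn A W K ∧ K ⊆ closure (leaf A x) ∩ W

end Foliation

/-! ### Suspensions -/

/-- `X` is a connected smooth `d`-manifold (without boundary) on which the group `Γ` acts smoothly,
freely and properly discontinuously; in other words, `X` is a connected regular covering, with deck
transformation group `Γ`, of the manifold `X / Γ`. -/
structure IsDeckAction (d : ℕ) (X : Type*) [TopologicalSpace X]
    [ChartedSpace (EuclideanSpace ℝ (Fin d)) X] (Γ : Type*) [Group Γ] [MulAction Γ X] :
    Prop where
  isManifold : IsManifold 𝓘(ℝ, EuclideanSpace ℝ (Fin d)) ∞ X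
  t2 : T2Space X
  secondCountable : SecondCountableTopology X
  connected : ConnectedSpace X
  smooth : ∀ γ : Γ, ContMDiff 𝓘(ℝ, EuclideanSpace ℝ (Fin d)) 𝓘(ℝ, EuclideanSpace ℝ (Fin d)) ∞
    (fun x : X => γ • x)
  free : ∀ (γ : Γ) (x : X), γ • x = x → γ = 1
  properlyDiscontinuous : ProperlyDiscontinuousSMul Γ X

section Suspension

variable {X : Type*} {Γ : Type*} [Group Γ] [MulAction Γ X]

/-- The orbit relation of the diagonal action `γ (x, t) = (γ x, ρ(γ) t)` on `X × [0,1]`. -/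
def suspensionSetoid (X : Type*) {Γ : Type*} [Group Γ] [MulAction Γ X] (ρ : Γ →* (I ≃ₜ I)) :
    Setoid (X × I) where
  r p q := ∃ γ : Γ, q = (γ • p.1, ρ γ p.2)
  iseqv :=
    { refl := fun p => ⟨1, by simp⟩
      symm := by
        rintro p q ⟨γ, rfl⟩
        refine ⟨γ⁻¹, ?_⟩
        have h : ρ γ⁻¹ (ρ γ p.2) = p.2 := by
          rw [← Homeomorph.mul_apply, ← map_mul]
          simp
        simp only [inv_smul_smul, h]
      trans := by
        rintro p q r ⟨γ, rfl⟩ ⟨δ, rfl⟩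
        exact ⟨δ * γ, by simp [mul_smul]⟩ }

/-- The total space `(X × [0,1]) / Γ` of the suspension of `ρ`. -/
abbrev Suspension (X : Type*) {Γ : Type*} [Group Γ] [MulAction Γ X] (ρ : Γ →* (I ≃ₜ I)) : Type _ :=
  Quotient (suspensionSetoid X ρ)

/-- The canonical foliated charts of the suspension: if `U` is an open set in the domain of a chart
`φ` of `X` that is disjoint from its translates, the image of `U × [0,1]` in the
suspension carries the chart `[x, t] ↦ (φ x, t)`. -/
def suspensionAtlas (E : Type*) [TopologicalSpace E] [TopologicalSpace X] [ChartedSpace E X]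
    (ρ : Γ →* (I ≃ₜ I)) : Set (OpenPartialHomeomorph (Suspension X ρ) (E × I)) :=
  {e | ∃ φ ∈ atlas E X, ∃ U : Set X, IsOpen U ∧ U ⊆ φ.source ∧
    (∀ γ : Γ, γ ≠ 1 → Disjoint ((fun x => γ • x) '' U) U) ∧
    e.source = Quotient.mk (suspensionSetoid X ρ) '' (U ×ˢ univ) ∧
    ∀ x ∈ U, ∀ t : I, e (Quotient.mk (suspensionSetoid X ρ) (x, t)) = (φ x, t)}

end Suspension

end

/-!
The bound on `α` enters only through `(√5 - 1) / 2 < 5 / 8`: a pair `f`, `g` of class `C^{1+5/8}`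
serves for all `α` at once (`exists_hectorConstruction`).

*Construction.* The intervals `[a_{m+1}, a_m]` have lengths `ℓ_m` of order `m ^ (-6/5)`, which is
summable, and the map `f` has derivative `1 + ψ`, where `ψ` is a bump of size
`ε_m ~ m ^ (-3/4) ~ ℓ_m ^ (5/8)` on the interval of index `m`; this is the size that the Hölder
condition allows, and it exceeds the relative change of length, which is of order `1 / m`. The bump
adjusts the length and expands the middle of the interval, so that `f⁻¹` contracts there by
`1 + ε_m / 2` at each step. From level `2 ^ k` to level `2 ^ (k + 1)`, the total contraction is of
the order of `exp (-2 ^ (k / 4))` up to constants in the exponent, which is much smaller than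
`ε_{2 ^ (k + 1)}` (`exists_contr_le`). Hence `[u_{k+1}, v_{k+1}]`, the preimage of `[b_k, c_k]`
under `f ^ (2 ^ k)`, is so short that `g` can move `u_{k+1}` to `v_{k+1}` by a perturbation of the
identity of class `C^{1+5/8}` (`exists_diffeo_of_displacement`). For the finitely many levels
where the contraction does not suffice yet, the supports of `g` are taken in geometric progression.

*Dynamics.* Conjugating by powers of `f`, the restriction of `g` to the interval of index `n_k`
becomes a homeomorphism `h_k` of `[a_1, a_0]` with support `(β_k, γ_k)`. The closure of this
support is contained in the support of `h_{k+1}`, and `h_{k+1}` maps `β_k` to `γ_k`, so that the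
translates of `(β_k, γ_k)` by the powers of `h_{k+1}` are disjoint. Let `W` be the open invariant
set generated by the supports of all levels. If a relatively closed invariant subset of `W` meets
`(β_k, γ_k)`, its least point in `[β_k, γ_k]` is fixed by `h_k`, hence it is `β_k`; therefore
a nonempty such set contains `β_k` for all large `k`. On the other hand, the orbit of the open
interval `(β_{k+1}, γ_{k+1})` contains `β_k` but not `β_{k+1}`. Removing this orbit from the set
yields a smaller one, and `W` contains no minimal set
(`IsHectorConstruction.exists_open_without_minimal`).

*Suspension.* As `X` is connected, the leaves are the images of the slices `X × {t}`, and saturated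
sets correspond to invariant subsets of `[0,1]`, open ones to open ones; so the LMS property fails
in every suspension (`IsDeckAction.not_hasLMS`). In the canonical charts, the changes of charts
are locally products of a smooth map and of an element of the group
(`IsDeckAction.isC1HolderFoliation`).

*Compactness.* A compact example needs a connected covering of a compact manifold with a deck group
that maps onto `⟨f, g⟩`. The covering is the domain of discontinuity of a Schottky group of rank
two, acting on the plane, whose standard fundamental domain is an annulus minus two discs
(`isSchottkySystem_plane`); the quotient is a closed surface of Euler characteristic `-2`. The
ping-pong argument gives freeness and proper discontinuity.
-/

noncomputable section

/-! ### Maps of class `C^{1+α}` of the interval -/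

theorem toRealMap_apply (f : I → I) {x : ℝ} (hx : x ∈ Icc (0 : ℝ) 1) :
    toRealMap f x = f ⟨x, hx⟩ := by
  simp [toRealMap, projIcc_of_mem zero_le_one hx]

theorem toRealMap_coe (f : I → I) (x : I) : toRealMap f x = f x := by
  simp [toRealMap]

theorem toRealMap_mem (f : I → I) (x : ℝ) : toRealMap f x ∈ Icc (0 : ℝ) 1 :=
  (f _).2

theorem toRealMap_comp (f g : I → I) (x : ℝ) :
    toRealMap (f ∘ g) x = toRealMap f (toRealMap g x) := by
  simp [toRealMap]

/-- On a subset of `[0,1]`, the class `C^{1+β}` is contained in `C^{1+α}` for `0 < α ≤ β`. -/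
theorem C1HolderOn.of_exponent_le {α β : ℝ} (h0 : 0 < α) (h : α ≤ β) {f : ℝ → ℝ} {s : Set ℝ}
    (hs : s ⊆ Icc 0 1) (hf : C1HolderOn β f s) : C1HolderOn α f s := by
  obtain ⟨f', hd, C, hC⟩ := hf
  refine ⟨f', hd, |C|, fun x hx y hy => (hC x hx y hy).trans ?_⟩
  have hx' := hs hx
  have hy' := hs hy
  have h1 : |x - y| ≤ 1 := by
    rw [abs_le]; constructor <;> linarith [hx'.1, hx'.2, hy'.1, hy'.2]
  have h2 : |x - y| ^ β ≤ |x - y| ^ α :=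
    Real.rpow_le_rpow_of_exponent_ge' (abs_nonneg _) h1 h0.le h
  have h3 : 0 ≤ |x - y| ^ β := Real.rpow_nonneg (abs_nonneg _) _
  calc C * |x - y| ^ β ≤ |C| * |x - y| ^ β := by gcongr; exact le_abs_self C
    _ ≤ _ := by gcongr

theorem C1HolderOn.subset {α : ℝ} {f : ℝ → ℝ} {s t : Set ℝ} (hf : C1HolderOn α f s) (h : t ⊆ s) :
    C1HolderOn α f t := by
  obtain ⟨f', hd, C, hC⟩ := hf
  exact ⟨f', fun x hx => (hd x (h hx)).mono h, C, fun x hx y hy => hC x (h hx) y (h hy)⟩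

theorem C1HolderOn.congr {α : ℝ} {f g : ℝ → ℝ} {s : Set ℝ} (hf : C1HolderOn α f s)
    (h : EqOn g f s) : C1HolderOn α g s := by
  obtain ⟨f', hd, C, hC⟩ := hf
  exact ⟨f', fun x hx => (hd x hx).congr h (h hx), C, hC⟩

/-- A derivative that is Hölder on `[0,1]` is bounded there. -/
theorem exists_bound_of_holder {α C : ℝ} (h0 : 0 < α) {φ : ℝ → ℝ}
    (h : ∀ x ∈ Icc (0 : ℝ) 1, ∀ y ∈ Icc (0 : ℝ) 1, |φ x - φ y| ≤ C * |x - y| ^ α) :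
    ∃ B, 0 ≤ B ∧ ∀ x ∈ Icc (0 : ℝ) 1, |φ x| ≤ B := by
  refine ⟨|φ 0| + |C|, by positivity, fun x hx => ?_⟩
  have h1 := h x hx 0 (by simp)
  have h2 : |x - 0| ^ α ≤ 1 :=
    Real.rpow_le_one (abs_nonneg _) (by rw [sub_zero, abs_of_nonneg hx.1]; exact hx.2) h0.le
  have h3 : 0 ≤ |x - 0| ^ α := Real.rpow_nonneg (abs_nonneg _) _
  have h4 : C * |x - 0| ^ α ≤ |C| := by
    calc C * |x - 0| ^ α ≤ |C| * |x - 0| ^ α := by gcongr; exact le_abs_self C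
      _ ≤ |C| * 1 := by gcongr
      _ = |C| := mul_one _
  have h5 := abs_sub_abs_le_abs_sub (φ x) (φ 0)
  linarith

/-- The class `C^{1+α}` on `[0,1]` is stable under composition. -/
theorem C1HolderOn.comp {α : ℝ} (h0 : 0 < α) {f g : ℝ → ℝ}
    (hf : C1HolderOn α f (Icc 0 1)) (hg : C1HolderOn α g (Icc 0 1))
    (hm : MapsTo g (Icc 0 1) (Icc 0 1)) : C1HolderOn α (f ∘ g) (Icc 0 1) := by
  obtain ⟨f', hfd, C, hC⟩ := hf
  obtain ⟨g', hgd, D, hD⟩ := hg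
  obtain ⟨B, hB0, hB⟩ := exists_bound_of_holder h0 hC
  obtain ⟨A, hA0, hA⟩ := exists_bound_of_holder h0 hD
  have hL : ∀ x ∈ Icc (0 : ℝ) 1, ∀ y ∈ Icc (0 : ℝ) 1, |g x - g y| ≤ A * |x - y| := by
    intro x hx y hy
    have := (convex_Icc (0 : ℝ) 1).norm_image_sub_le_of_norm_hasDerivWithin_le
      (f := g) (f' := g') (C := A) hgd (fun z hz => by simpa using hA z hz) hy hx
    simpa [Real.norm_eq_abs] using this
  refine ⟨fun x => f' (g x) * g' x, fun x hx => (hfd _ (hm hx)).comp x (hgd x hx) hm,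
    |C| * A ^ α * A + B * |D|, fun x hx y hy => ?_⟩
  have hp : 0 ≤ |x - y| ^ α := Real.rpow_nonneg (abs_nonneg _) _
  have h1 : |f' (g x) - f' (g y)| ≤ |C| * A ^ α * |x - y| ^ α := by
    refine (hC _ (hm hx) _ (hm hy)).trans ?_
    have : |g x - g y| ^ α ≤ A ^ α * |x - y| ^ α := by
      rw [← Real.mul_rpow hA0 (abs_nonneg _)]
      exact Real.rpow_le_rpow (abs_nonneg _) (hL x hx y hy) h0.le
    have h3 : 0 ≤ |g x - g y| ^ α := Real.rpow_nonneg (abs_nonneg _) _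
    calc C * |g x - g y| ^ α ≤ |C| * |g x - g y| ^ α := by gcongr; exact le_abs_self C
      _ ≤ |C| * (A ^ α * |x - y| ^ α) := by gcongr
      _ = _ := by ring
  have h2 : |g' x - g' y| ≤ |D| * |x - y| ^ α :=
    (hD x hx y hy).trans (by gcongr; exact le_abs_self D)
  calc |f' (g x) * g' x - f' (g y) * g' y|
      = |(f' (g x) - f' (g y)) * g' x + f' (g y) * (g' x - g' y)| := by ring_nf
    _ ≤ |f' (g x) - f' (g y)| * |g' x| + |f' (g y)| * |g' x - g' y| := by
        rw [← abs_mul, ← abs_mul]; exact abs_add_le _ _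
    _ ≤ (|C| * A ^ α * |x - y| ^ α) * A + B * (|D| * |x - y| ^ α) := by
        gcongr
        · exact hA x hx
        · exact hB _ (hm hy)
    _ = _ := by ring

theorem IsC1HolderDiffeo.of_exponent_le {α β : ℝ} (h0 : 0 < α) (h : α ≤ β) {f : I ≃ₜ I}
    (hf : IsC1HolderDiffeo β f) : IsC1HolderDiffeo α f :=
  ⟨hf.1.of_exponent_le h0 h subset_rfl, hf.2.of_exponent_le h0 h subset_rfl⟩

theorem IsC1HolderDiffeo.one (α : ℝ) : IsC1HolderDiffeo α 1 := by
  have h : C1HolderOn α (fun x => x) (Icc 0 1) :=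
    ⟨fun _ => 1, fun x _ => hasDerivWithinAt_id x _, 0, fun x _ y _ => by simp⟩
  have h' : C1HolderOn α (toRealMap (fun x => x)) (Icc 0 1) :=
    h.congr fun x hx => by simp [toRealMap_apply _ hx]
  exact ⟨h', h'⟩

theorem IsC1HolderDiffeo.inv {α : ℝ} {f : I ≃ₜ I} (hf : IsC1HolderDiffeo α f) :
    IsC1HolderDiffeo α f⁻¹ := ⟨hf.2, hf.1⟩

theorem IsC1HolderDiffeo.mul {α : ℝ} (h0 : 0 < α) {f g : I ≃ₜ I} (hf : IsC1HolderDiffeo α f)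
    (hg : IsC1HolderDiffeo α g) : IsC1HolderDiffeo α (f * g) := by
  have key : ∀ {p q : I → I}, C1HolderOn α (toRealMap p) (Icc 0 1) →
      C1HolderOn α (toRealMap q) (Icc 0 1) → C1HolderOn α (toRealMap (p ∘ q)) (Icc 0 1) :=
    fun hp hq => (hp.comp h0 hq fun x _ => toRealMap_mem _ x).congr
      fun x _ => toRealMap_comp _ _ x
  exact ⟨key (p := f) (q := g) hf.1 hg.1, key (p := g.symm) (q := f.symm) hg.2 hf.2⟩

theorem IsC1HolderDiffeo.of_mem_closure {α : ℝ} (h0 : 0 < α) {f g : I ≃ₜ I}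
    (hf : IsC1HolderDiffeo α f) (hg : IsC1HolderDiffeo α g) {h : I ≃ₜ I}
    (hh : h ∈ Subgroup.closure {f, g}) : IsC1HolderDiffeo α h := by
  induction hh using Subgroup.closure_induction with
  | mem x hx =>
    rcases hx with rfl | rfl
    exacts [hf, hg]
  | one => exact IsC1HolderDiffeo.one α
  | mul x y _ _ hx hy => exact hx.mul h0 hy
  | inv x _ hx => exact hx.inv

/-- A map of class `C^{1+α}` with `α > 0` is `C^1`. -/
theorem C1HolderOn.contDiffOn {α : ℝ} (h0 : 0 < α) {f : ℝ → ℝ}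
    (hf : C1HolderOn α f (Icc 0 1)) : ContDiffOn ℝ 1 f (Icc 0 1) := by
  obtain ⟨f', hd, C, hC⟩ := hf
  have hu : UniqueDiffOn ℝ (Icc (0 : ℝ) 1) := uniqueDiffOn_Icc zero_lt_one
  have hd' : EqOn (derivWithin f (Icc 0 1)) f' (Icc 0 1) :=
    fun x hx => (hd x hx).derivWithin (hu x hx)
  have hc : ContinuousOn f' (Icc 0 1) := by
    intro x hx
    rw [ContinuousWithinAt, tendsto_iff_dist_tendsto_zero]
    have h1 : Tendsto (fun y : ℝ => C * |y - x| ^ α) (𝓝[Icc 0 1] x) (𝓝 0) := by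
      have : Continuous fun y : ℝ => C * |y - x| ^ α :=
        continuous_const.mul ((continuous_abs.comp (continuous_id.sub continuous_const)).rpow_const
          fun _ => Or.inr h0.le)
      have h2 := (this.tendsto x).mono_left (nhdsWithin_le_nhds (s := Icc 0 1))
      simpa [Real.zero_rpow h0.ne'] using h2
    refine squeeze_zero' (Eventually.of_forall fun _ => dist_nonneg) ?_ h1
    filter_upwards [self_mem_nhdsWithin] with y hy
    simpa [Real.dist_eq] using hC y hy x hx
  rw [show (1 : WithTop ℕ∞) = 0 + 1 by simp, contDiffOn_succ_iff_derivWithin hu]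
  refine ⟨fun x hx => (hd x hx).differentiableWithinAt, by simp, ?_⟩
  rw [contDiffOn_zero]
  exact hc.congr hd'

/-! ### Diffeomorphisms with a prescribed derivative -/

/-- The map `x ↦ x + ∫_0^x ψ` with derivative `1 + ψ`. -/
def primitiveMap (ψ : ℝ → ℝ) (x : ℝ) : ℝ := x + ∫ y in (0 : ℝ)..x, ψ y

theorem continuous_of_holder {α K : ℝ} (h0 : 0 < α) {ψ : ℝ → ℝ}
    (h : ∀ x y, |ψ x - ψ y| ≤ K * |x - y| ^ α) : Continuous ψ := by
  rw [continuous_iff_continuousAt]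
  intro x
  rw [ContinuousAt, tendsto_iff_dist_tendsto_zero]
  have h1 : Tendsto (fun y : ℝ => K * |y - x| ^ α) (𝓝 x) (𝓝 0) := by
    have : Continuous fun y : ℝ => K * |y - x| ^ α :=
      continuous_const.mul ((continuous_abs.comp (continuous_id.sub continuous_const)).rpow_const
        fun _ => Or.inr h0.le)
    have h2 := this.tendsto x
    simpa [Real.zero_rpow h0.ne'] using h2
  refine squeeze_zero' (Eventually.of_forall fun _ => dist_nonneg) ?_ h1
  filter_upwards with y
  simpa [Real.dist_eq] using h y x

theorem hasDerivAt_primitiveMap {ψ : ℝ → ℝ} (hψ : Continuous ψ) (x : ℝ) :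
    HasDerivAt (primitiveMap ψ) (1 + ψ x) x :=
  (hasDerivAt_id x).add (intervalIntegral.integral_hasDerivAt_right
    (hψ.intervalIntegrable _ _) (hψ.stronglyMeasurableAtFilter _ _) hψ.continuousAt)

/-- Where `ψ ≥ e - 1` between `x` and `y`, the map with derivative `1 + ψ` expands at least by
the factor `e`. -/
theorem le_primitiveMap_sub {ψ : ℝ → ℝ} (hψ : Continuous ψ) {e x y : ℝ} (hxy : x ≤ y)
    (h : ∀ z ∈ Icc x y, e ≤ 1 + ψ z) :
    e * (y - x) ≤ primitiveMap ψ y - primitiveMap ψ x := by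
  refine (convex_Icc x y).mul_sub_le_image_sub_of_le_deriv
    (fun z _ => (hasDerivAt_primitiveMap hψ z).continuousAt.continuousWithinAt)
    (fun z _ => (hasDerivAt_primitiveMap hψ z).differentiableAt.differentiableWithinAt)
    (fun z hz => ?_) x (left_mem_Icc.2 hxy) y (right_mem_Icc.2 hxy) hxy
  rw [(hasDerivAt_primitiveMap hψ z).deriv]
  exact h z (interior_subset hz)

/-- A Hölder function `ψ`, bounded below by a constant greater than `-1` and such that
`x ↦ x + ∫_0^x ψ` fixes `1`, defines a diffeomorphism of `[0,1]` of class `C^{1+α}` with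
derivative `1 + ψ`. -/
theorem exists_diffeo_of_holder {α K η : ℝ} (h0 : 0 < α) (hη : 0 < η) {ψ : ℝ → ℝ}
    (h : ∀ x y, |ψ x - ψ y| ≤ K * |x - y| ^ α) (hlow : ∀ x, η ≤ 1 + ψ x)
    (h1 : primitiveMap ψ 1 = 1) :
    ∃ f : I ≃ₜ I, StrictMono f ∧ IsC1HolderDiffeo α f ∧
      ∀ x : I, (f x : ℝ) = primitiveMap ψ x := by
  have hψ := continuous_of_holder h0 h
  set F := primitiveMap ψ with hF
  have hd := hasDerivAt_primitiveMap hψ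
  have hexp : ∀ x y, x ≤ y → η * (y - x) ≤ F y - F x :=
    fun x y hxy => le_primitiveMap_sub hψ hxy fun z _ => hlow z
  have hF0 : F 0 = 0 := by simp [hF, primitiveMap]
  have hmono : StrictMono F := fun x y hxy => by
    have := hexp x y hxy.le
    have := mul_pos hη (sub_pos.2 hxy)
    linarith
  have hc : Continuous F := continuous_iff_continuousAt.2 fun x => (hd x).continuousAt
  have hmem : ∀ x : I, F x ∈ Icc (0 : ℝ) 1 := fun x =>
    ⟨by rw [← hF0]; exact hmono.monotone x.2.1, by rw [← h1]; exact hmono.monotone x.2.2⟩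
  let φ : I → I := fun x => ⟨F x, hmem x⟩
  have hφm : StrictMono φ := fun x y hxy => hmono (show (x : ℝ) < y from hxy)
  have hφs : Function.Surjective φ := by
    intro y
    obtain ⟨x, hx, hxy⟩ := intermediate_value_Icc zero_le_one hc.continuousOn
      (show (y : ℝ) ∈ Icc (F 0) (F 1) by rw [hF0, h1]; exact y.2)
    exact ⟨⟨x, hx⟩, Subtype.ext hxy⟩
  let f : I ≃ₜ I := (hφm.orderIsoOfSurjective φ hφs).toHomeomorph
  have hf : ∀ x : I, (f x : ℝ) = F x := fun x => rfl
  refine ⟨f, hφm, ⟨?_, ?_⟩, hf⟩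
  · refine ⟨fun x => 1 + ψ x, fun x hx => ?_, K, fun x _ y _ => ?_⟩
    · refine (hd x).hasDerivWithinAt.congr (fun y hy => ?_) ?_
      · rw [toRealMap_apply _ hy, hf]
      · rw [toRealMap_apply _ hx, hf]
    · rw [add_sub_add_left_eq_sub]; exact h x y
  · set G := toRealMap f.symm with hG
    have hGF : ∀ y ∈ Icc (0 : ℝ) 1, F (G y) = y := by
      intro y hy
      rw [hG, toRealMap_apply _ hy, ← hf, f.apply_symm_apply]
    have hexp' : ∀ x ∈ Icc (0 : ℝ) 1, ∀ y ∈ Icc (0 : ℝ) 1, |G x - G y| ≤ η⁻¹ * |x - y| := by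
      intro x hx y hy
      rw [inv_mul_eq_div, le_div_iff₀ hη]
      rcases le_total (G x) (G y) with hxy | hxy
      · have := hexp _ _ hxy
        rw [hGF x hx, hGF y hy] at this
        have h2 := neg_le_abs (x - y)
        rw [abs_sub_comm (G x), abs_of_nonneg (sub_nonneg.2 hxy)]
        linarith
      · have := hexp _ _ hxy
        rw [hGF x hx, hGF y hy] at this
        have h2 := le_abs_self (x - y)
        rw [abs_of_nonneg (sub_nonneg.2 hxy)]
        linarith
    have hGc : ContinuousOn G (Icc 0 1) := by
      have : Continuous G := continuous_subtype_val.comp (f.symm.continuous.comp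
        continuous_projIcc)
      exact this.continuousOn
    have hpos : ∀ x, 0 < 1 + ψ x := fun x => hη.trans_le (hlow x)
    refine ⟨fun y => (1 + ψ (G y))⁻¹, fun y hy => ?_, (η⁻¹) ^ 2 * |K| * η⁻¹ ^ α,
      fun x hx y hy => ?_⟩
    · have hne : (1 + ψ (G y)) ≠ 0 := (hpos _).ne'
      have hdf := ((hd (G y)).hasFDerivAt_equiv hne).hasFDerivWithinAt (s := univ)
      have htend : Tendsto G (𝓝[Icc 0 1] y) (𝓝[univ] (G y)) := by
        rw [nhdsWithin_univ]; exact hGc y hy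
      exact hdf.of_local_left_inverse htend hy
        (by filter_upwards [self_mem_nhdsWithin] with z hz using hGF z hz)
    · have hx1 := hpos (G x)
      have hy1 := hpos (G y)
      have e1 : (1 + ψ (G x))⁻¹ - (1 + ψ (G y))⁻¹ =
          (1 + ψ (G x))⁻¹ * (1 + ψ (G y))⁻¹ * (ψ (G y) - ψ (G x)) := by
        field_simp
        ring
      have i1 : (1 + ψ (G x))⁻¹ ≤ η⁻¹ := inv_anti₀ hη (hlow _)
      have i2 : (1 + ψ (G y))⁻¹ ≤ η⁻¹ := inv_anti₀ hη (hlow _)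
      have hp : 0 ≤ |G y - G x| ^ α := Real.rpow_nonneg (abs_nonneg _) _
      have i3 : |ψ (G y) - ψ (G x)| ≤ |K| * (η⁻¹ ^ α * |x - y| ^ α) := by
        refine (h _ _).trans ?_
        calc K * |G y - G x| ^ α ≤ |K| * |G y - G x| ^ α := by gcongr; exact le_abs_self K
          _ ≤ _ := by
            rw [← Real.mul_rpow (inv_nonneg.2 hη.le) (abs_nonneg _), abs_sub_comm (G y)]
            gcongr
            exact hexp' x hx y hy
      calc |(1 + ψ (G x))⁻¹ - (1 + ψ (G y))⁻¹|
          = (1 + ψ (G x))⁻¹ * (1 + ψ (G y))⁻¹ * |ψ (G y) - ψ (G x)| := by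
            rw [e1, abs_mul, abs_mul, abs_of_pos (inv_pos.2 hx1), abs_of_pos (inv_pos.2 hy1)]
        _ ≤ η⁻¹ * η⁻¹ * (|K| * (η⁻¹ ^ α * |x - y| ^ α)) := by
            gcongr
        _ = _ := by ring

/-! ### Functions glued from bumps on disjoint intervals -/

section Bump

variable {ι : Type*} {p q : ι → ℝ} {P : ι → ℝ → ℝ}

open Classical in
/-- The function that is `x ↦ P i ((x - p i) / (q i - p i))` on the interval `(p i, q i)` for each
`i`, and zero elsewhere; meaningful when the intervals are pairwise disjoint. -/
def bumpSum (p q : ι → ℝ) (P : ι → ℝ → ℝ) (x : ℝ) : ℝ :=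
  if h : ∃ i, x ∈ Ioo (p i) (q i) then
    P h.choose ((x - p h.choose) / (q h.choose - p h.choose)) else 0

theorem bumpSum_of_forall_notMem {x : ℝ} (hx : ∀ i, x ∉ Ioo (p i) (q i)) :
    bumpSum p q P x = 0 := by
  rw [bumpSum, dif_neg (by simpa using hx)]

theorem bumpSum_of_mem_Ioo
    (hdisj : Pairwise fun i j => Disjoint (Ioo (p i) (q i)) (Ioo (p j) (q j)))
    {i : ι} {x : ℝ} (hx : x ∈ Ioo (p i) (q i)) :
    bumpSum p q P x = P i ((x - p i) / (q i - p i)) := by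
  have h : ∃ i, x ∈ Ioo (p i) (q i) := ⟨i, hx⟩
  have hi : h.choose = i := by
    by_contra hne
    exact (Set.disjoint_left.1 (hdisj hne)) h.choose_spec hx
  rw [bumpSum, dif_pos h, hi]

/-- An end point of one of the disjoint intervals is in none of them. -/
theorem notMem_Ioo_of_eq_endpoint (hpq : ∀ i, p i < q i)
    (hdisj : Pairwise fun i j => Disjoint (Ioo (p i) (q i)) (Ioo (p j) (q j)))
    {i : ι} {x : ℝ} (hx : x = p i ∨ x = q i) (j : ι) : x ∉ Ioo (p j) (q j) := by
  intro hj
  have hij : j ≠ i := by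
    rintro rfl
    rcases hx with rfl | rfl
    · exact lt_irrefl _ hj.1
    · exact lt_irrefl _ hj.2
  have h := Set.disjoint_left.1 (hdisj hij)
  have hi := hpq i
  rcases hx with rfl | rfl
  · obtain ⟨z, hz1, hz2⟩ := exists_between (lt_min hj.2 hi)
    exact h (a := z) ⟨hj.1.trans hz1, hz2.trans_le (min_le_left _ _)⟩
      ⟨hz1, hz2.trans_le (min_le_right _ _)⟩
  · obtain ⟨z, hz1, hz2⟩ := exists_between (max_lt hj.1 hi)
    exact h (a := z) ⟨(le_max_left _ _).trans_lt hz1, hz2.trans hj.2⟩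
      ⟨(le_max_right _ _).trans_lt hz1, hz2⟩

theorem bumpSum_of_mem_Icc (hpq : ∀ i, p i < q i)
    (hdisj : Pairwise fun i j => Disjoint (Ioo (p i) (q i)) (Ioo (p j) (q j)))
    (h0 : ∀ i, P i 0 = 0) (h1 : ∀ i, P i 1 = 0)
    {i : ι} {x : ℝ} (hx : x ∈ Icc (p i) (q i)) :
    bumpSum p q P x = P i ((x - p i) / (q i - p i)) := by
  have hne : q i - p i ≠ 0 := (sub_pos.2 (hpq i)).ne'
  rcases hx.1.eq_or_lt with h | h
  · rw [bumpSum_of_forall_notMem (notMem_Ioo_of_eq_endpoint hpq hdisj (Or.inl h.symm)), ← h]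
    simp [h0]
  rcases hx.2.eq_or_lt with h' | h'
  · rw [bumpSum_of_forall_notMem (notMem_Ioo_of_eq_endpoint hpq hdisj (Or.inr h')), h',
      div_self hne, h1]
  exact bumpSum_of_mem_Ioo hdisj ⟨h, h'⟩

/-- If each bump vanishes at the end points of its interval, of length `ℓ`, and is Lipschitz with
constant `K ℓ ^ α` after rescaling to unit length, the glued function is `α`-Hölder. -/
theorem bumpSum_holder {α K : ℝ} (hα0 : 0 < α) (hα1 : α ≤ 1) (hK : 0 ≤ K) (hpq : ∀ i, p i < q i)
    (hdisj : Pairwise fun i j => Disjoint (Ioo (p i) (q i)) (Ioo (p j) (q j)))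
    (h0 : ∀ i, P i 0 = 0) (h1 : ∀ i, P i 1 = 0)
    (hP : ∀ i, ∀ s t, |P i s - P i t| ≤ K * (q i - p i) ^ α * |s - t|) (x y : ℝ) :
    |bumpSum p q P x - bumpSum p q P y| ≤ 2 * K * |x - y| ^ α := by
  have hin : ∀ i, ∀ x ∈ Icc (p i) (q i), ∀ y ∈ Icc (p i) (q i),
      |bumpSum p q P x - bumpSum p q P y| ≤ K * |x - y| ^ α := by
    intro i x hx y hy
    have hl : 0 < q i - p i := sub_pos.2 (hpq i)
    rw [bumpSum_of_mem_Icc hpq hdisj h0 h1 hx, bumpSum_of_mem_Icc hpq hdisj h0 h1 hy]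
    refine (hP i _ _).trans ?_
    have e1 : (x - p i) / (q i - p i) - (y - p i) / (q i - p i) = (x - y) / (q i - p i) := by
      field_simp; ring
    rw [e1, abs_div, abs_of_pos hl]
    have hle : |x - y| / (q i - p i) ≤ 1 := by
      rw [div_le_one hl, abs_le]
      constructor <;> linarith [hx.1, hx.2, hy.1, hy.2]
    have h2 : |x - y| / (q i - p i) ≤ (|x - y| / (q i - p i)) ^ α := by
      have := Real.rpow_le_rpow_of_exponent_ge' (div_nonneg (abs_nonneg (x - y)) hl.le) hle
        hα0.le hα1
      simpa using this
    have h3 : 0 ≤ (q i - p i) ^ α := Real.rpow_nonneg hl.le _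
    calc K * (q i - p i) ^ α * (|x - y| / (q i - p i))
        ≤ K * (q i - p i) ^ α * (|x - y| / (q i - p i)) ^ α := by gcongr
      _ = K * ((q i - p i) ^ α * (|x - y| / (q i - p i)) ^ α) := by ring
      _ = K * |x - y| ^ α := by
        rw [← Real.mul_rpow hl.le (div_nonneg (abs_nonneg _) hl.le), mul_div_cancel₀ _ hl.ne']
  have hzero : ∀ i, bumpSum p q P (p i) = 0 ∧ bumpSum p q P (q i) = 0 := fun i =>
    ⟨bumpSum_of_forall_notMem (notMem_Ioo_of_eq_endpoint hpq hdisj (Or.inl rfl)),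
      bumpSum_of_forall_notMem (notMem_Ioo_of_eq_endpoint hpq hdisj (Or.inr rfl))⟩
  wlog hxy : x ≤ y generalizing x y
  · rw [abs_sub_comm, abs_sub_comm x y]
    exact this y x (le_of_not_ge hxy)
  by_cases hsame : ∃ i, x ∈ Ioo (p i) (q i) ∧ y ∈ Ioo (p i) (q i)
  · obtain ⟨i, hx, hy⟩ := hsame
    have h3 : 0 ≤ |x - y| ^ α := Real.rpow_nonneg (abs_nonneg _) _
    have := hin i x (Ioo_subset_Icc_self hx) y (Ioo_subset_Icc_self hy)
    nlinarith [mul_nonneg hK h3]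
  · push Not at hsame
    have hp : 0 ≤ K * |x - y| ^ α := mul_nonneg hK (Real.rpow_nonneg (abs_nonneg _) _)
    -- `x` and `y` are separated by an end point, where the function vanishes.
    have hx : |bumpSum p q P x| ≤ K * |x - y| ^ α := by
      by_cases hx : ∃ i, x ∈ Ioo (p i) (q i)
      · obtain ⟨i, hi⟩ := hx
        have hy : q i ≤ y := by
          by_contra hlt
          exact hsame i hi ⟨hi.1.trans_le hxy, not_le.1 hlt⟩
        have := hin i x (Ioo_subset_Icc_self hi) (q i) (right_mem_Icc.2 (hpq i).le)
        rw [(hzero i).2, sub_zero] at this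
        refine this.trans ?_
        gcongr 2
        rw [abs_sub_comm, abs_sub_comm x, abs_of_nonneg, abs_of_nonneg] <;> linarith [hi.2]
      · rw [bumpSum_of_forall_notMem (by simpa using hx), abs_zero]; exact hp
    have hy : |bumpSum p q P y| ≤ K * |x - y| ^ α := by
      by_cases hy : ∃ i, y ∈ Ioo (p i) (q i)
      · obtain ⟨i, hi⟩ := hy
        have hx : x ≤ p i := by
          by_contra hlt
          exact hsame i ⟨not_le.1 hlt, hxy.trans_lt hi.2⟩ hi
        have := hin i y (Ioo_subset_Icc_self hi) (p i) (left_mem_Icc.2 (hpq i).le)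
        rw [(hzero i).1, sub_zero] at this
        refine this.trans ?_
        gcongr 2
        rw [abs_sub_comm x, abs_of_nonneg, abs_of_nonneg] <;> linarith [hi.1]
      · rw [bumpSum_of_forall_notMem (by simpa using hy), abs_zero]; exact hp
    calc _ ≤ |bumpSum p q P x| + |bumpSum p q P y| := abs_sub _ _
      _ ≤ _ := by linarith

/-- The increment of the map with derivative `1 + bumpSum p q P` on one of the intervals, in terms
of a primitive `Q` of the bump. -/
theorem primitiveMap_bumpSum_sub (hpq : ∀ i, p i < q i)
    (hdisj : Pairwise fun i j => Disjoint (Ioo (p i) (q i)) (Ioo (p j) (q j)))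
    (h0 : ∀ i, P i 0 = 0) (h1 : ∀ i, P i 1 = 0) (hc : Continuous (bumpSum p q P))
    {i : ι} {Q : ℝ → ℝ} (hQ : ∀ s, HasDerivAt Q (P i s) s) {x : ℝ} (hx : x ∈ Icc (p i) (q i)) :
    primitiveMap (bumpSum p q P) x - primitiveMap (bumpSum p q P) (p i) =
      (x - p i) + (q i - p i) * (Q ((x - p i) / (q i - p i)) - Q 0) := by
  have hl : 0 < q i - p i := sub_pos.2 (hpq i)
  have e1 : (∫ y in (0 : ℝ)..x, bumpSum p q P y) - ∫ y in (0 : ℝ)..(p i), bumpSum p q P y =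
      ∫ y in (p i)..x, bumpSum p q P y :=
    intervalIntegral.integral_interval_sub_left (hc.intervalIntegrable _ _)
      (hc.intervalIntegrable _ _)
  have e2 : ∫ y in (p i)..x, bumpSum p q P y =
      (q i - p i) * Q ((x - p i) / (q i - p i)) - (q i - p i) * Q ((p i - p i) / (q i - p i)) := by
    refine intervalIntegral.integral_eq_sub_of_hasDerivAt
      (f := fun y => (q i - p i) * Q ((y - p i) / (q i - p i))) (fun y hy => ?_)
      (hc.intervalIntegrable _ _)
    rw [uIcc_of_le hx.1] at hy
    rw [bumpSum_of_mem_Icc hpq hdisj h0 h1 ⟨hy.1, hy.2.trans hx.2⟩]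
    have hin : HasDerivAt (fun y => (y - p i) / (q i - p i)) (1 / (q i - p i)) y :=
      ((hasDerivAt_id y).sub_const _).div_const _
    have := ((hQ ((y - p i) / (q i - p i))).comp y hin).const_mul (q i - p i)
    exact this.congr_deriv (by rw [mul_left_comm, mul_one_div_cancel hl.ne', mul_one])
  simp only [primitiveMap]
  rw [sub_self, zero_div] at e2
  linarith

theorem primitiveMap_bumpSum_of_disjoint (hc : Continuous (bumpSum p q P)) {x y : ℝ} (hxy : x ≤ y)
    (h : ∀ z ∈ Icc x y, ∀ i, z ∉ Ioo (p i) (q i)) :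
    primitiveMap (bumpSum p q P) y - primitiveMap (bumpSum p q P) x = y - x := by
  have e1 : (∫ z in (0 : ℝ)..y, bumpSum p q P z) - ∫ z in (0 : ℝ)..x, bumpSum p q P z =
      ∫ z in x..y, bumpSum p q P z :=
    intervalIntegral.integral_interval_sub_left (hc.intervalIntegrable _ _)
      (hc.intervalIntegrable _ _)
  have e2 : ∫ z in x..y, bumpSum p q P z = ∫ z in x..y, (0 : ℝ) :=
    intervalIntegral.integral_congr fun z hz =>
      bumpSum_of_forall_notMem (h z (by rwa [uIcc_of_le hxy] at hz))
  simp only [intervalIntegral.integral_zero] at e2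
  simp only [primitiveMap]
  linarith

end Bump

/-! ### The sequence of lengths -/

/-- The base `1 + n / 64`; all sequences of the construction are powers of it. -/
def lenBase (n : ℕ) : ℝ := 1 + n / 64

/-- The lengths of the fundamental intervals, before normalisation. The exponent `6/5` makes them
summable, while their powers of exponent `5/8` decay slower than `1 / n`. -/
def preLen (n : ℕ) : ℝ := lenBase n ^ (-(6 / 5) : ℝ)

/-- The lengths of the fundamental intervals, normalised to have sum `1 / 2`. -/
def len (n : ℕ) : ℝ := preLen n / (2 * ∑' j, preLen j)

/-- The size of the perturbation of the derivative on an interval of length `len n`; it is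
proportional to `len n ^ (5 / 8)`, the largest order allowed by the Hölder condition. -/
def amp (n : ℕ) : ℝ := lenBase n ^ (-(3 / 4) : ℝ) / 8

theorem one_le_lenBase (n : ℕ) : 1 ≤ lenBase n := by
  have : (0 : ℝ) ≤ n / 64 := by positivity
  unfold lenBase; linarith

theorem lenBase_pos (n : ℕ) : 0 < lenBase n := zero_lt_one.trans_le (one_le_lenBase n)

theorem lenBase_mono : Monotone lenBase := fun m n h => by
  have : (m : ℝ) ≤ n := by exact_mod_cast h
  unfold lenBase; linarith

theorem preLen_pos (n : ℕ) : 0 < preLen n := Real.rpow_pos_of_pos (lenBase_pos n) _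

theorem summable_preLen : Summable preLen := by
  have h : Summable fun n : ℕ => (64 : ℝ) ^ (6 / 5 : ℝ) * ((n + 64 : ℕ) : ℝ) ^ (-(6 / 5) : ℝ) :=
    ((summable_nat_add_iff 64).2 (Real.summable_nat_rpow.2 (by norm_num))).mul_left _
  refine h.congr fun n => ?_
  have e : lenBase n = ((n + 64 : ℕ) : ℝ) / 64 := by
    unfold lenBase; push_cast; ring
  rw [preLen, e, Real.div_rpow (by positivity) (by norm_num), Real.rpow_neg (x := 64) (by norm_num),
    div_inv_eq_mul, mul_comm]

theorem tsum_preLen_pos : 0 < ∑' j, preLen j :=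
  summable_preLen.tsum_pos (fun n => (preLen_pos n).le) 0 (preLen_pos 0)

theorem len_pos (n : ℕ) : 0 < len n := div_pos (preLen_pos n) (by linarith [tsum_preLen_pos])

theorem len_antitone : Antitone len := fun m n h => by
  have := tsum_preLen_pos
  unfold len preLen
  have : lenBase n ^ (-(6 / 5) : ℝ) ≤ lenBase m ^ (-(6 / 5) : ℝ) :=
    Real.rpow_le_rpow_of_nonpos (lenBase_pos m) (lenBase_mono h) (by norm_num)
  gcongr

theorem hasSum_len : HasSum len (1 / 2) := by
  have h := summable_preLen.hasSum.div_const (2 * ∑' j, preLen j)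
  have e : (∑' j, preLen j) / (2 * ∑' j, preLen j) = 1 / 2 := by
    have := tsum_preLen_pos.ne'
    field_simp
  rwa [e] at h

theorem amp_pos (n : ℕ) : 0 < amp n := by
  have := Real.rpow_pos_of_pos (lenBase_pos n) (-(3 / 4) : ℝ)
  unfold amp; positivity

theorem amp_le (n : ℕ) : amp n ≤ 1 / 8 := by
  have := Real.rpow_le_one_of_one_le_of_nonpos (one_le_lenBase n) (by norm_num : (-(3 / 4) : ℝ) ≤ 0)
  unfold amp; linarith

theorem amp_antitone : Antitone amp := fun m n h => by
  have : lenBase n ^ (-(3 / 4) : ℝ) ≤ lenBase m ^ (-(3 / 4) : ℝ) :=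
    Real.rpow_le_rpow_of_nonpos (lenBase_pos m) (lenBase_mono h) (by norm_num)
  unfold amp; linarith

theorem exists_amp_eq : ∃ K : ℝ, 0 < K ∧ ∀ n, amp n = K * len n ^ (5 / 8 : ℝ) := by
  have hS : 0 < 2 * ∑' j, preLen j := by linarith [tsum_preLen_pos]
  refine ⟨(2 * ∑' j, preLen j) ^ (5 / 8 : ℝ) / 8, by positivity, fun n => ?_⟩
  have h0 := Real.rpow_pos_of_pos hS (5 / 8 : ℝ)
  rw [len, Real.div_rpow (preLen_pos n).le hS.le, amp, preLen, ← Real.rpow_mul (lenBase_pos n).le]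
  norm_num
  field_simp

theorem tendsto_amp : Tendsto amp atTop (𝓝 0) := by
  obtain ⟨K, hK, h⟩ := exists_amp_eq
  have h1 : Tendsto (fun n => K * len n ^ (5 / 8 : ℝ)) atTop (𝓝 (K * 0 ^ (5 / 8 : ℝ))) :=
    (hasSum_len.summable.tendsto_atTop_zero.rpow_const (Or.inr (by norm_num))).const_mul K
  rw [Real.zero_rpow (by norm_num), mul_zero] at h1
  exact h1.congr fun n => (h n).symm

theorem inv_lenBase_le (n : ℕ) : (lenBase n)⁻¹ / 8 ≤ amp n := by
  have h := Real.rpow_le_rpow_of_exponent_le (one_le_lenBase n)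
    (by norm_num : (-1 : ℝ) ≤ -(3 / 4))
  rw [Real.rpow_neg_one] at h
  unfold amp; linarith

/-- The relative change of length from one fundamental interval to the next is smaller than the
size of the perturbation of the derivative. -/
theorem len_sub_le (n : ℕ) : len n - len (n + 1) ≤ amp (n + 1) / 2 * len (n + 1) := by
  have hS : 0 < 2 * ∑' j, preLen j := by linarith [tsum_preLen_pos]
  suffices h : preLen n ≤ (1 + amp (n + 1) / 2) * preLen (n + 1) by
    have : len n ≤ (1 + amp (n + 1) / 2) * len (n + 1) := by
      unfold len
      rw [← mul_div_assoc]
      gcongr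
    linarith
  have hb := lenBase_pos n
  have hb' := lenBase_pos (n + 1)
  have h1 : preLen n = (lenBase (n + 1) / lenBase n) ^ (6 / 5 : ℝ) * preLen (n + 1) := by
    have := (Real.rpow_pos_of_pos hb' (6 / 5 : ℝ)).ne'
    rw [preLen, preLen, Real.div_rpow hb'.le hb.le, Real.rpow_neg hb.le, Real.rpow_neg hb'.le]
    field_simp
  have h2 : (lenBase (n + 1) / lenBase n) ^ (6 / 5 : ℝ) ≤ (lenBase (n + 1) / lenBase n) ^ (2 : ℝ) :=
    Real.rpow_le_rpow_of_exponent_le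
      ((one_le_div hb).2 (lenBase_mono n.le_succ)) (by norm_num)
  have h3 := inv_lenBase_le (n + 1)
  have h4 : (lenBase (n + 1) / lenBase n) ^ (2 : ℝ) ≤ 1 + (lenBase (n + 1))⁻¹ / 16 := by
    rw [Real.rpow_two]
    have e1 : lenBase (n + 1) = ((n : ℝ) + 65) / 64 := by unfold lenBase; push_cast; ring
    have e2 : lenBase n = ((n : ℝ) + 64) / 64 := by unfold lenBase; ring
    rw [e1, e2]
    have hn : (0 : ℝ) ≤ n := by positivity
    rw [← sub_nonneg]
    have : 1 + (((n : ℝ) + 65) / 64)⁻¹ / 16 - (((n : ℝ) + 65) / 64 / ((n + 64) / 64)) ^ 2 =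
        ((n + 69) * (n + 64) ^ 2 - (n + 65) ^ 3) / ((n + 65) * (n + 64) ^ 2) := by
      field_simp
      ring
    rw [this]
    apply div_nonneg _ (by positivity)
    nlinarith [mul_nonneg hn hn]
  rw [h1]
  have := (preLen_pos (n + 1)).le
  gcongr
  linarith

theorem len_le_four_mul (n : ℕ) : len n ≤ 4 * len (2 * n) := by
  have hS : 0 < 2 * ∑' j, preLen j := by linarith [tsum_preLen_pos]
  suffices h : preLen n ≤ 4 * preLen (2 * n) by
    unfold len
    rw [← mul_div_assoc]
    gcongr
  have hb := lenBase_pos n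
  have h1 : lenBase (2 * n) ≤ 2 * lenBase n := by unfold lenBase; push_cast; linarith
  have h2 : (2 * lenBase n) ^ (-(6 / 5) : ℝ) ≤ preLen (2 * n) :=
    Real.rpow_le_rpow_of_nonpos (lenBase_pos _) h1 (by norm_num)
  rw [Real.mul_rpow (by norm_num) hb.le] at h2
  have h3 : (2 : ℝ) ^ (-2 : ℝ) ≤ (2 : ℝ) ^ (-(6 / 5) : ℝ) :=
    Real.rpow_le_rpow_of_exponent_le (by norm_num) (by norm_num)
  have h4 : (2 : ℝ) ^ (-2 : ℝ) = 1 / 4 := by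
    rw [Real.rpow_neg (by norm_num)]; norm_num
  have h5 := preLen_pos n
  rw [h4] at h3
  have h6 : 1 / 4 * preLen n ≤ (2 : ℝ) ^ (-(6 / 5) : ℝ) * preLen n := by gcongr
  have h7 : lenBase n ^ (-(6 / 5) : ℝ) = preLen n := rfl
  rw [h7] at h2
  linarith

/-- The contraction accumulated between the levels `2 ^ k` and `2 ^ (k + 1)`. -/
def contr (k : ℕ) : ℝ := ((1 + amp (2 ^ (k + 1)) / 2) ^ (2 ^ k))⁻¹

/-- The accumulated contraction is of smaller order than the allowed perturbation of the
derivative: `2 ^ k` steps with amplitude of order `2 ^ (-3 k / 4)` contract more than any power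
of `2 ^ k`; four factors of Bernoulli's inequality are enough here. -/
theorem exists_contr_le : ∃ C : ℝ, 0 < C ∧ ∀ k, contr k ≤ C * amp (2 ^ (k + 1)) := by
  refine ⟨256 * 16 ^ 6, by norm_num, fun k => ?_⟩
  set x := amp (2 ^ (k + 1)) / 2 with hx
  have hx0 : 0 < x := half_pos (amp_pos _)
  have hb : lenBase (2 ^ (k + 1)) ≤ 2 * 2 ^ k := by
    have : (1 : ℝ) ≤ 2 ^ k := one_le_pow₀ (by norm_num)
    unfold lenBase; push_cast; rw [pow_succ]; linarith
  have hxb : ((2 : ℝ) ^ k)⁻¹ / 32 ≤ x := by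
    have h := inv_lenBase_le (2 ^ (k + 1))
    have h2 : (2 * 2 ^ k : ℝ)⁻¹ ≤ (lenBase (2 ^ (k + 1)))⁻¹ := inv_anti₀ (lenBase_pos _) hb
    rw [mul_inv] at h2
    rw [hx]; linarith
  have hsmall : 1 ≤ (1 + x) ^ (2 ^ k) := one_le_pow₀ (by linarith)
  have hA : amp (2 ^ (k + 1)) = 2 * x := by rw [hx]; ring
  rw [contr, ← hx, hA]
  rw [inv_le_iff_one_le_mul₀ (by positivity)]
  rcases lt_or_ge k 2 with hk | hk
  · have h2k : (2 : ℝ) ^ k ≤ 4 := by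
      calc (2 : ℝ) ^ k ≤ 2 ^ 2 := pow_le_pow_right₀ (by norm_num) hk.le
        _ = 4 := by norm_num
    have : (4 : ℝ)⁻¹ ≤ ((2 : ℝ) ^ k)⁻¹ := inv_anti₀ (by positivity) h2k
    nlinarith
  · obtain ⟨j, rfl⟩ := Nat.exists_eq_add_of_le hk
    have e1 : 2 ^ (2 + j) = 2 ^ j * 4 := by rw [pow_add]; ring
    have hB : 2 ^ j * x ≤ (1 + x) ^ (2 ^ j) := by
      have := one_add_mul_le_pow (by linarith : (-2 : ℝ) ≤ x) (2 ^ j)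
      push_cast at this
      linarith
    have hB4 : (2 ^ j * x) ^ 4 ≤ (1 + x) ^ (2 ^ (2 + j)) := by
      rw [e1, pow_mul]
      exact pow_le_pow_left₀ (by positivity) hB 4
    have hx4 : ((2 * 2 ^ (2 + j) : ℝ) ^ 3)⁻¹ / 16 ^ 4 ≤ x ^ 4 := by
      have e2 : x ^ 4 = (lenBase (2 ^ (2 + j + 1)) ^ 3)⁻¹ / 16 ^ 4 := by
        have h4 : (lenBase (2 ^ (2 + j + 1)) ^ (-(3 / 4) : ℝ)) ^ 4 =
            (lenBase (2 ^ (2 + j + 1)) ^ 3)⁻¹ := by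
          rw [← Real.rpow_natCast, ← Real.rpow_mul (lenBase_pos _).le, ← Real.rpow_natCast,
            ← Real.rpow_neg (lenBase_pos _).le]
          norm_num
        rw [hx, amp, ← h4]
        ring
      rw [e2]
      have := lenBase_pos (2 ^ (2 + j + 1))
      gcongr
    have hp : (0 : ℝ) < 2 ^ j := by positivity
    have e3 : (2 : ℝ) ^ (2 + j) = 4 * 2 ^ j := by rw [pow_add]; norm_num
    rw [e3] at hx4 hxb
    calc (1 : ℝ) ≤ 256 * 16 ^ 6 * (2 * ((4 * 2 ^ j : ℝ)⁻¹ / 32)) *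
          ((2 ^ j) ^ 4 * (((2 * (4 * 2 ^ j) : ℝ) ^ 3)⁻¹ / 16 ^ 4)) := by
          field_simp
          norm_num
      _ ≤ 256 * 16 ^ 6 * (2 * x) * ((2 ^ j) ^ 4 * x ^ 4) := by gcongr
      _ = 256 * 16 ^ 6 * (2 * x) * (2 ^ j * x) ^ 4 := by ring
      _ ≤ _ := by gcongr

theorem contr_pos (k : ℕ) : 0 < contr k := by
  have := amp_pos (2 ^ (k + 1))
  unfold contr; positivity

theorem tendsto_contr : Tendsto contr atTop (𝓝 0) := by
  obtain ⟨C, -, hC⟩ := exists_contr_le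
  have h1 : Tendsto (fun k : ℕ => 2 ^ (k + 1)) atTop (atTop : Filter ℕ) :=
    (tendsto_pow_atTop_atTop_of_one_lt one_lt_two).comp (tendsto_add_atTop_nat 1)
  have h2 := (tendsto_amp.comp h1).const_mul C
  rw [mul_zero] at h2
  exact squeeze_zero (fun k => (contr_pos k).le) hC h2

/-! ### The end points of the fundamental intervals -/

/-- The index of the length of the interval `[a_{m+1}, a_m]`; the lengths are symmetric about the
point `a_0 = 1 / 2`. -/
def lenIndex : ℤ → ℕ
  | .ofNat n => n
  | .negSucc n => n

/-- The end points `a_m`: `1 / 2` minus a partial sum of the lengths for `m ≥ 0`, extended by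
symmetry about `1 / 2`. -/
def endpt : ℤ → ℝ
  | .ofNat n => 1 / 2 - ∑ j ∈ Finset.range n, len j
  | .negSucc n => 1 / 2 + ∑ j ∈ Finset.range (n + 1), len j

theorem endpt_natCast (n : ℕ) : endpt n = 1 / 2 - ∑ j ∈ Finset.range n, len j := rfl

theorem endpt_neg_natCast (n : ℕ) : endpt (-n) = 1 / 2 + ∑ j ∈ Finset.range n, len j := by
  cases n with
  | zero => simpa using endpt_natCast 0
  | succ n => rfl

theorem lenIndex_natCast (n : ℕ) : lenIndex n = n := rfl

theorem lenIndex_neg (n : ℕ) : lenIndex (-(n + 1 : ℤ)) = n := rfl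

theorem int_cases (m : ℤ) : (∃ n : ℕ, m = n) ∨ ∃ n : ℕ, m = -(n + 1 : ℤ) := by
  cases m with
  | ofNat n => exact Or.inl ⟨n, rfl⟩
  | negSucc n => exact Or.inr ⟨n, rfl⟩

theorem endpt_sub (m : ℤ) : endpt m - endpt (m + 1) = len (lenIndex m) := by
  rcases int_cases m with ⟨n, rfl⟩ | ⟨n, rfl⟩
  · have : ((n : ℤ) + 1) = ((n + 1 : ℕ) : ℤ) := by push_cast; rfl
    rw [this, endpt_natCast, endpt_natCast, Finset.sum_range_succ, lenIndex_natCast]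
    ring
  · have h1 : (-(n + 1 : ℤ)) = -((n + 1 : ℕ) : ℤ) := by push_cast; rfl
    have h2 : (-(n + 1 : ℤ)) + 1 = -(n : ℤ) := by ring
    rw [h2, lenIndex_neg, h1, endpt_neg_natCast, endpt_neg_natCast, Finset.sum_range_succ]
    ring

theorem endpt_strictAnti : StrictAnti endpt :=
  strictAnti_int_of_succ_lt fun m => by
    have := endpt_sub m
    have := len_pos (lenIndex m)
    linarith

theorem tendsto_sum_len :
    Tendsto (fun n => ∑ j ∈ Finset.range n, len j) atTop (𝓝 (1 / 2)) :=
  hasSum_len.tendsto_sum_nat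

theorem tendsto_endpt_atTop : Tendsto endpt atTop (𝓝 0) := by
  rw [← Nat.map_cast_int_atTop, tendsto_map'_iff]
  have := tendsto_sum_len.const_sub (1 / 2)
  rw [sub_self] at this
  exact this

theorem tendsto_endpt_atBot : Tendsto endpt atBot (𝓝 1) := by
  have h : Tendsto (fun m : ℤ => endpt (-m)) atTop (𝓝 1) := by
    rw [← Nat.map_cast_int_atTop, tendsto_map'_iff]
    have := tendsto_sum_len.const_add (1 / 2)
    norm_num at this
    exact this.congr fun n => by simp [endpt_neg_natCast]
  have := h.comp tendsto_neg_atBot_atTop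
  exact this.congr fun m => by simp

theorem endpt_pos (m : ℤ) : 0 < endpt m :=
  (endpt_strictAnti.antitone.le_of_tendsto tendsto_endpt_atTop (m + 1)).trans_lt
    (endpt_strictAnti (lt_add_one m))

theorem endpt_lt_one (m : ℤ) : endpt m < 1 :=
  (endpt_strictAnti (sub_one_lt m)).trans_le
    (endpt_strictAnti.antitone.ge_of_tendsto tendsto_endpt_atBot (m - 1))

/-- The change of length under one step of the shift. -/
theorem abs_len_sub_le (m : ℤ) :
    |len (lenIndex (m - 1)) - len (lenIndex m)| ≤
      amp (lenIndex m) / 2 * len (lenIndex m) := by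
  have hpos : 0 ≤ amp (lenIndex m) / 2 * len (lenIndex m) := by
    have := (amp_pos (lenIndex m)).le
    have := (len_pos (lenIndex m)).le
    positivity
  rcases int_cases m with ⟨n, rfl⟩ | ⟨n, rfl⟩
  · cases n with
    | zero =>
      have h : lenIndex ((0 : ℕ) - 1) = lenIndex ((0 : ℕ) : ℤ) := rfl
      rw [h, sub_self, abs_zero]
      exact hpos
    | succ n =>
      have h : (((n + 1 : ℕ) : ℤ) - 1) = (n : ℤ) := by push_cast; ring
      rw [h, lenIndex_natCast, lenIndex_natCast,
        abs_of_nonneg (sub_nonneg.2 (len_antitone n.le_succ))]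
      exact len_sub_le n
  · have h : (-(n + 1 : ℤ)) - 1 = -((n + 1 : ℕ) + 1 : ℤ) := by push_cast; ring
    rw [h, lenIndex_neg, lenIndex_neg, abs_sub_comm,
      abs_of_nonneg (sub_nonneg.2 (len_antitone n.le_succ))]
    refine (len_sub_le n).trans ?_
    have := (amp_pos n).le
    have := (len_pos (n + 1)).le
    have := amp_antitone n.le_succ
    have := len_antitone n.le_succ
    gcongr

theorem len_le_len_sub_one {m : ℤ} (hm : 1 ≤ m) :
    len (lenIndex m) ≤ len (lenIndex (m - 1)) := by
  obtain ⟨n, rfl⟩ : ∃ n : ℕ, m = (n + 1 : ℕ) := ⟨(m - 1).toNat, by omega⟩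
  have h : (((n + 1 : ℕ) : ℤ) - 1) = (n : ℤ) := by push_cast; ring
  rw [h, lenIndex_natCast, lenIndex_natCast]
  exact len_antitone n.le_succ

/-- The intervals `(a_{m+1}, a_m)` are pairwise disjoint. -/
theorem disjoint_endpt :
    Pairwise fun i j : ℤ => Disjoint (Ioo (endpt (i + 1)) (endpt i))
      (Ioo (endpt (j + 1)) (endpt j)) := by
  have key : ∀ i j : ℤ, i < j → Disjoint (Ioo (endpt (i + 1)) (endpt i))
      (Ioo (endpt (j + 1)) (endpt j)) := fun i j hij => by
    rw [Set.disjoint_left]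
    intro x hx hx'
    have := endpt_strictAnti.antitone (Int.add_one_le_iff.2 hij)
    exact absurd (hx'.2.trans_le this) (not_lt.2 hx.1.le)
  intro i j hij
  rcases lt_or_gt_of_ne hij with h | h
  exacts [key i j h, (key j i h).symm]

/-! ### The map `f` -/

/-- The relative change `(ℓ_{m-1} - ℓ_m) / ℓ_m` of the lengths. -/
def relChange (m : ℤ) : ℝ :=
  (len (lenIndex (m - 1)) - len (lenIndex m)) / len (lenIndex m)

/-- The derivative of `f`, minus `1`, on the `m`-th fundamental interval rescaled to `[0,1]`. The
first term changes the total length as required; the second one, of mean zero, makes `f` expand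
the middle of the interval at the expense of the rest. -/
def shiftBump (m : ℤ) (s : ℝ) : ℝ :=
  relChange m * (1 - Real.cos (2 * Real.pi * s)) +
    amp (lenIndex m) * (Real.cos (4 * Real.pi * s) - Real.cos (2 * Real.pi * s))

/-- A primitive of `shiftBump m`. -/
def shiftPrim (m : ℤ) (s : ℝ) : ℝ :=
  relChange m * (s - Real.sin (2 * Real.pi * s) / (2 * Real.pi)) +
    amp (lenIndex m) * (Real.sin (4 * Real.pi * s) / (4 * Real.pi) -
      Real.sin (2 * Real.pi * s) / (2 * Real.pi))

/-- The derivative of `f`, minus `1`. -/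
def shiftDensity : ℝ → ℝ := bumpSum (fun m : ℤ => endpt (m + 1)) endpt shiftBump

theorem abs_relChange_le (m : ℤ) : |relChange m| ≤ amp (lenIndex m) / 2 := by
  rw [relChange, abs_div, abs_of_pos (len_pos _), div_le_iff₀ (len_pos _)]
  exact abs_len_sub_le m

theorem relChange_nonneg {m : ℤ} (hm : 1 ≤ m) : 0 ≤ relChange m :=
  div_nonneg (sub_nonneg.2 (len_le_len_sub_one hm)) (len_pos _).le

theorem hasDerivAt_sin_mul_div {c : ℝ} (hc : c ≠ 0) (s : ℝ) :
    HasDerivAt (fun s => Real.sin (c * s) / c) (Real.cos (c * s)) s := by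
  have h1 : HasDerivAt (fun s => c * s) c s := by
    simpa using (hasDerivAt_id s).const_mul c
  have := (h1.sin).div_const c
  exact this.congr_deriv (mul_div_cancel_right₀ _ hc)

theorem hasDerivAt_shiftPrim (m : ℤ) (s : ℝ) :
    HasDerivAt (shiftPrim m) (shiftBump m s) s := by
  have h2 := hasDerivAt_sin_mul_div (c := 2 * Real.pi) (by positivity) s
  have h4 := hasDerivAt_sin_mul_div (c := 4 * Real.pi) (by positivity) s
  exact (((hasDerivAt_id s).sub h2).const_mul _).add ((h4.sub h2).const_mul _)

theorem shiftBump_zero (m : ℤ) : shiftBump m 0 = 0 := by simp [shiftBump]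

theorem cos_four_pi : Real.cos (4 * Real.pi) = 1 := by
  rw [show 4 * Real.pi = 2 * Real.pi + 2 * Real.pi by ring, Real.cos_add_two_pi, Real.cos_two_pi]

theorem sin_four_pi : Real.sin (4 * Real.pi) = 0 := by
  rw [show 4 * Real.pi = 2 * Real.pi + 2 * Real.pi by ring, Real.sin_add_two_pi, Real.sin_two_pi]

theorem shiftBump_one (m : ℤ) : shiftBump m 1 = 0 := by
  simp [shiftBump, cos_four_pi]

theorem shiftPrim_zero (m : ℤ) : shiftPrim m 0 = 0 := by simp [shiftPrim]

theorem shiftPrim_one (m : ℤ) : shiftPrim m 1 = relChange m := by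
  simp [shiftPrim, sin_four_pi]

theorem shiftPrim_half (m : ℤ) : shiftPrim m (1 / 2) = relChange m / 2 := by
  have h1 : 2 * Real.pi * (1 / 2) = Real.pi := by ring
  have h2 : 4 * Real.pi * (1 / 2) = 2 * Real.pi := by ring
  simp only [shiftPrim, h1, h2, Real.sin_pi, Real.sin_two_pi]
  ring

theorem abs_cos_mul_sub_le {c : ℝ} (hc : 0 ≤ c) (s t : ℝ) :
    |Real.cos (c * s) - Real.cos (c * t)| ≤ c * |s - t| := by
  have := Real.abs_cos_sub_cos_le (c * s) (c * t)
  rwa [← mul_sub, abs_mul, abs_of_nonneg hc] at this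

theorem abs_shiftBump_sub_le (m : ℤ) (s t : ℝ) :
    |shiftBump m s - shiftBump m t| ≤ 7 * Real.pi * amp (lenIndex m) * |s - t| := by
  have h2 := abs_cos_mul_sub_le (c := 2 * Real.pi) (by positivity) s t
  have h4 := abs_cos_mul_sub_le (c := 4 * Real.pi) (by positivity) s t
  have hA := amp_pos (lenIndex m)
  have hR := abs_relChange_le m
  have e : shiftBump m s - shiftBump m t =
      -(relChange m * (Real.cos (2 * Real.pi * s) - Real.cos (2 * Real.pi * t))) +
      amp (lenIndex m) * (Real.cos (4 * Real.pi * s) - Real.cos (4 * Real.pi * t)) -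
      amp (lenIndex m) * (Real.cos (2 * Real.pi * s) - Real.cos (2 * Real.pi * t)) := by
    simp only [shiftBump]; ring
  rw [e]
  refine (abs_sub _ _).trans ((add_le_add_left (abs_add_le _ _) _).trans ?_)
  rw [abs_neg, abs_mul, abs_mul, abs_mul, abs_of_pos hA]
  calc _ ≤ amp (lenIndex m) / 2 * (2 * Real.pi * |s - t|) +
        amp (lenIndex m) * (4 * Real.pi * |s - t|) +
        amp (lenIndex m) * (2 * Real.pi * |s - t|) := by
        gcongr
    _ = _ := by ring

theorem shiftBump_ge (m : ℤ) (s : ℝ) : -(3 / 8) ≤ shiftBump m s := by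
  have hA := amp_pos (lenIndex m)
  have hA' := amp_le (lenIndex m)
  have hR := abs_le.1 (abs_relChange_le m)
  have c1 := Real.cos_le_one (2 * Real.pi * s)
  have c2 := Real.neg_one_le_cos (2 * Real.pi * s)
  have c4 := Real.neg_one_le_cos (4 * Real.pi * s)
  unfold shiftBump
  nlinarith [mul_nonneg (sub_nonneg.2 c1)
    (by linarith [hR.1] : 0 ≤ relChange m + amp (lenIndex m) / 2)]

/-- In the middle quarter of each interval of positive index, `f` expands. -/
theorem shiftBump_ge_of_mem {m : ℤ} (hm : 1 ≤ m) {s : ℝ} (hs : s ∈ Icc (3 / 8 : ℝ) (5 / 8)) :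
    amp (lenIndex m) / 2 ≤ shiftBump m s := by
  have hA := amp_pos (lenIndex m)
  have hR := relChange_nonneg hm
  have hpi := Real.pi_pos
  have c1 := Real.cos_le_one (2 * Real.pi * s)
  set θ := 2 * Real.pi * (s - 1 / 2) with hθ
  have hθ1 : |θ| ≤ Real.pi / 4 := by
    rw [abs_le]; constructor <;> rw [hθ] <;> nlinarith [hs.1, hs.2]
  have e1 : Real.cos (2 * Real.pi * s) = -Real.cos θ := by
    rw [show 2 * Real.pi * s = θ + Real.pi by rw [hθ]; ring, Real.cos_add_pi]
  have e2 : Real.cos (4 * Real.pi * s) = Real.cos (2 * θ) := by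
    rw [show 4 * Real.pi * s = 2 * θ + 2 * Real.pi by rw [hθ]; ring, Real.cos_add_two_pi]
  have h1 : 0 ≤ Real.cos (2 * θ) := by
    rw [abs_le] at hθ1
    exact Real.cos_nonneg_of_neg_pi_div_two_le_of_le (by linarith) (by linarith)
  have h2 : 1 / 2 ≤ Real.cos θ := by
    rw [← Real.cos_pi_div_three, ← Real.cos_abs θ]
    exact Real.cos_le_cos_of_nonneg_of_le_pi (abs_nonneg _) (by linarith) (by linarith)
  unfold shiftBump
  rw [e1] at c1
  rw [e1, e2]
  have := mul_nonneg hR (by linarith : (0 : ℝ) ≤ 1 - -Real.cos θ)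
  nlinarith

theorem endpt_lt (m : ℤ) : endpt (m + 1) < endpt m := endpt_strictAnti (lt_add_one m)

theorem exists_shiftDensity_holder :
    ∃ K : ℝ, ∀ x y, |shiftDensity x - shiftDensity y| ≤ K * |x - y| ^ (5 / 8 : ℝ) := by
  obtain ⟨K, hK, hamp⟩ := exists_amp_eq
  refine ⟨2 * (7 * Real.pi * K), bumpSum_holder (by norm_num) (by norm_num) (by positivity)
    endpt_lt disjoint_endpt shiftBump_zero shiftBump_one fun m s t => ?_⟩
  rw [endpt_sub, mul_assoc (7 * Real.pi), ← hamp]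
  exact abs_shiftBump_sub_le m s t

theorem continuous_shiftDensity : Continuous shiftDensity := by
  obtain ⟨K, hK⟩ := exists_shiftDensity_holder
  exact continuous_of_holder (by norm_num) hK

theorem shiftDensity_ge (x : ℝ) : 5 / 8 ≤ 1 + shiftDensity x := by
  by_cases h : ∃ m, x ∈ Ioo (endpt (m + 1)) (endpt m)
  · obtain ⟨m, hm⟩ := h
    rw [shiftDensity, bumpSum_of_mem_Ioo disjoint_endpt hm]
    linarith [shiftBump_ge m ((x - endpt (m + 1)) / (endpt m - endpt (m + 1)))]
  · rw [shiftDensity, bumpSum_of_forall_notMem (by simpa using h)]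
    norm_num

theorem continuous_primitiveMap {ψ : ℝ → ℝ} (hψ : Continuous ψ) : Continuous (primitiveMap ψ) :=
  continuous_iff_continuousAt.2 fun x => (hasDerivAt_primitiveMap hψ x).continuousAt

theorem primitiveMap_zero (ψ : ℝ → ℝ) : primitiveMap ψ 0 = 0 := by simp [primitiveMap]

theorem shift_sub {m : ℤ} {x : ℝ} (hx : x ∈ Icc (endpt (m + 1)) (endpt m)) :
    primitiveMap shiftDensity x - primitiveMap shiftDensity (endpt (m + 1)) =
      (x - endpt (m + 1)) +
        len (lenIndex m) * shiftPrim m ((x - endpt (m + 1)) / len (lenIndex m)) := by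
  have := primitiveMap_bumpSum_sub endpt_lt disjoint_endpt shiftBump_zero shiftBump_one
    continuous_shiftDensity (hasDerivAt_shiftPrim m) hx
  rw [shiftPrim_zero, sub_zero, endpt_sub] at this
  exact this

theorem len_mul_relChange (m : ℤ) : len (lenIndex m) * relChange m =
    len (lenIndex (m - 1)) - len (lenIndex m) :=
  mul_div_cancel₀ _ (len_pos _).ne'

theorem endpt_sub' (m : ℤ) : endpt (m - 1) - endpt m = len (lenIndex (m - 1)) := by
  have := endpt_sub (m - 1)
  rwa [sub_add_cancel] at this

/-- `f` shifts the end points: its increments on the fundamental intervals are the right ones, and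
both sides tend to `0` at `+∞`. -/
theorem shift_endpt (m : ℤ) : primitiveMap shiftDensity (endpt m) = endpt (m - 1) := by
  set F := primitiveMap shiftDensity with hF
  have hc : Continuous F := continuous_primitiveMap continuous_shiftDensity
  have hstep : ∀ m : ℤ, F (endpt (m + 1)) - endpt (m + 1 - 1) = F (endpt m) - endpt (m - 1) := by
    intro m
    have h := shift_sub (right_mem_Icc.2 (endpt_lt m).le)
    rw [endpt_sub, div_self (len_pos _).ne', shiftPrim_one, len_mul_relChange] at h
    have := endpt_sub' m
    rw [add_sub_cancel_right]
    linarith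
  have hconst : ∀ n : ℕ, F (endpt (m + n)) - endpt (m + n - 1) = F (endpt m) - endpt (m - 1) := by
    intro n
    induction n with
    | zero => simp
    | succ n ih =>
      rw [← ih, ← hstep (m + n)]
      push_cast
      rw [add_assoc]
  have htop : Tendsto (fun n : ℕ => m + (n : ℤ)) atTop atTop :=
    tendsto_atTop_add_const_left _ _ tendsto_natCast_atTop_atTop
  have h1 : Tendsto (fun n : ℕ => F (endpt (m + n)) - endpt (m + n - 1)) atTop (𝓝 (F 0 - 0)) := by
    refine ((hc.tendsto 0).comp (tendsto_endpt_atTop.comp htop)).sub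
      (tendsto_endpt_atTop.comp ?_)
    exact tendsto_atTop_add_const_right _ (-1) htop
  have h2 := tendsto_nhds_unique (h1.congr hconst) tendsto_const_nhds
  have h0 : F 0 = 0 := primitiveMap_zero _
  rw [h0] at h2
  linarith

theorem shift_one : primitiveMap shiftDensity 1 = 1 := by
  have hc := continuous_primitiveMap continuous_shiftDensity
  have h1 := (hc.tendsto 1).comp tendsto_endpt_atBot
  have h2 : Tendsto (fun m : ℤ => endpt (m - 1)) atBot (𝓝 1) :=
    tendsto_endpt_atBot.comp (tendsto_atBot_add_const_right _ (-1) tendsto_id)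
  exact tendsto_nhds_unique (h1.congr shift_endpt) h2

/-- The midpoint of the `m`-th fundamental interval. -/
def midpt (m : ℤ) : ℝ := (endpt m + endpt (m + 1)) / 2

theorem midpt_eq (m : ℤ) : midpt m = endpt (m + 1) + len (lenIndex m) / 2 := by
  rw [midpt, ← endpt_sub]; ring

theorem midpt_eq' (m : ℤ) : midpt m = endpt m - len (lenIndex m) / 2 := by
  rw [midpt, ← endpt_sub]; ring

theorem shift_midpt (m : ℤ) : primitiveMap shiftDensity (midpt m) = midpt (m - 1) := by
  have hl := len_pos (lenIndex m)
  have h := shift_sub (m := m) (x := midpt m)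
    ⟨by rw [midpt_eq]; linarith, by rw [midpt_eq']; linarith⟩
  have e : (midpt m - endpt (m + 1)) / len (lenIndex m) = 1 / 2 := by
    rw [midpt_eq]; field_simp; ring
  rw [e, shiftPrim_half, shift_endpt, mul_div_assoc', len_mul_relChange, add_sub_cancel_right] at h
  have e1 := midpt_eq m
  have e2 := midpt_eq' (m - 1)
  have e3 := endpt_sub' m
  linarith

theorem shiftDensity_ge_of_mem {m : ℤ} (hm : 1 ≤ m) {x : ℝ}
    (hx : |x - midpt m| ≤ len (lenIndex m) / 8) :
    1 + amp (lenIndex m) / 2 ≤ 1 + shiftDensity x := by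
  have hl := len_pos (lenIndex m)
  rw [abs_le, midpt_eq] at hx
  have hmem : x ∈ Ioo (endpt (m + 1)) (endpt m) := by
    have := endpt_sub m
    constructor <;> linarith [hx.1, hx.2]
  rw [shiftDensity, bumpSum_of_mem_Ioo disjoint_endpt hmem, endpt_sub]
  have := shiftBump_ge_of_mem hm (s := (x - endpt (m + 1)) / len (lenIndex m))
    ⟨by rw [le_div_iff₀ hl]; linarith [hx.1], by rw [div_le_iff₀ hl]; linarith [hx.2]⟩
  linarith

theorem len_sub_one_le (m : ℤ) :
    len (lenIndex (m - 1)) ≤ (1 + amp (lenIndex m) / 2) * len (lenIndex m) := by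
  have := (abs_le.1 (abs_len_sub_le m)).2
  linarith

/-- Going one level down, the inverse of `f` brings points closer to the midpoint of the
fundamental interval. -/
theorem abs_sub_midpt_le {m : ℤ} (hm : 1 ≤ m) {x : ℝ}
    (hx : |primitiveMap shiftDensity x - midpt (m - 1)| ≤ len (lenIndex (m - 1)) / 8) :
    |x - midpt m| * (1 + amp (lenIndex m) / 2) ≤
      |primitiveMap shiftDensity x - midpt (m - 1)| := by
  set F := primitiveMap shiftDensity with hF
  have hlen := len_sub_one_le m
  set e := 1 + amp (lenIndex m) / 2 with he
  have he0 : 0 < e := by have := amp_pos (lenIndex m); positivity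
  have hl := len_pos (lenIndex m)
  set ρ := |F x - midpt (m - 1)| / e with hρ
  have hρ0 : 0 ≤ ρ := by positivity
  have hρe : ρ * e = |F x - midpt (m - 1)| := div_mul_cancel₀ _ he0.ne'
  have hρl : ρ ≤ len (lenIndex m) / 8 := by
    rw [hρ, div_le_iff₀ he0]
    linarith
  have hψ := continuous_shiftDensity
  have hmono : StrictMono F := fun a b hab => by
    have := le_primitiveMap_sub hψ hab.le fun z _ => shiftDensity_ge z
    have : 0 < b - a := sub_pos.2 hab
    rw [hF]; linarith
  have h1 : e * (midpt m + ρ - midpt m) ≤ F (midpt m + ρ) - F (midpt m) :=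
    le_primitiveMap_sub hψ (by linarith) fun z hz => shiftDensity_ge_of_mem hm
      (by rw [abs_le]; constructor <;> linarith [hz.1, hz.2])
  have h2 : e * (midpt m - (midpt m - ρ)) ≤ F (midpt m) - F (midpt m - ρ) :=
    le_primitiveMap_sub hψ (by linarith) fun z hz => shiftDensity_ge_of_mem hm
      (by rw [abs_le]; constructor <;> linarith [hz.1, hz.2])
  have h0 : F (midpt m) = midpt (m - 1) := shift_midpt m
  rw [h0] at h1 h2
  have h3 := le_abs_self (F x - midpt (m - 1))
  have h4 := neg_abs_le (F x - midpt (m - 1))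
  have hx1 : x ≤ midpt m + ρ := hmono.le_iff_le.1 (by linarith)
  have hx2 : midpt m - ρ ≤ x := hmono.le_iff_le.1 (by linarith)
  rw [← hρe]
  gcongr
  rw [abs_le]
  constructor <;> linarith

/-- Pulling a point close to the midpoint of the interval of index `2 ^ k` back to the interval
of index `2 ^ (k + 1)`. -/
theorem pullback_estimate (k : ℕ) {θ : ℝ} (hθ0 : 0 ≤ θ) (hθ : θ ≤ 1 / 8) {x : ℝ}
    (hx : |(primitiveMap shiftDensity)^[2 ^ k] x - midpt ((2 ^ k : ℕ) : ℤ)| ≤ θ * len (2 ^ k)) :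
    |x - midpt ((2 ^ (k + 1) : ℕ) : ℤ)| ≤ θ * len (2 ^ (k + 1)) ∧
      |x - midpt ((2 ^ (k + 1) : ℕ) : ℤ)| ≤ θ * len (2 ^ k) * contr k := by
  set F := primitiveMap shiftDensity
  set c := 1 + amp (2 ^ (k + 1)) / 2 with hc
  have hc0 : 0 < c := by have := amp_pos (2 ^ (k + 1)); positivity
  have key : ∀ j ≤ 2 ^ k, ∀ x, |F^[j] x - midpt ((2 ^ k : ℕ) : ℤ)| ≤ θ * len (2 ^ k) →
      |x - midpt ((2 ^ k + j : ℕ) : ℤ)| ≤ θ * len (2 ^ k + j) ∧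
      |x - midpt ((2 ^ k + j : ℕ) : ℤ)| * c ^ j ≤ θ * len (2 ^ k) := by
    intro j
    induction j with
    | zero =>
      intro _ x hx
      simpa using hx
    | succ j ih =>
      intro hj x hx
      rw [Function.iterate_succ_apply] at hx
      obtain ⟨h1, h2⟩ := ih (by omega) (F x) hx
      obtain ⟨m, hm⟩ : ∃ m : ℤ, m = ((2 ^ k + (j + 1) : ℕ) : ℤ) := ⟨_, rfl⟩
      have hm1 : ((2 ^ k + j : ℕ) : ℤ) = m - 1 := by rw [hm]; push_cast; ring
      have hmi : lenIndex m = 2 ^ k + (j + 1) := by rw [hm]; rfl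
      have hmi' : lenIndex (m - 1) = 2 ^ k + j := by rw [← hm1]; rfl
      have hm0 : 1 ≤ m := by rw [hm]; omega
      have hl := len_pos (2 ^ k + j)
      have hl' := len_pos (lenIndex m)
      rw [hm1] at h1 h2
      have h3 := abs_sub_midpt_le hm0 (x := x) (by rw [hmi']; nlinarith)
      have h4 := len_sub_one_le m
      rw [hmi'] at h4
      have he0 : 0 < 1 + amp (lenIndex m) / 2 := by have := amp_pos (lenIndex m); positivity
      have hce : c ≤ 1 + amp (lenIndex m) / 2 := by
        have : amp (2 ^ (k + 1)) ≤ amp (lenIndex m) :=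
          amp_antitone (by rw [hmi, pow_succ]; omega)
        rw [hc]; linarith
      rw [← hm, ← hmi]
      constructor
      · refine le_of_mul_le_mul_right ((h3.trans h1).trans ?_) he0
        rw [mul_assoc]
        gcongr
        linarith
      · calc |x - midpt m| * c ^ (j + 1) = |x - midpt m| * c * c ^ j := by ring
          _ ≤ |x - midpt m| * (1 + amp (lenIndex m) / 2) * c ^ j := by gcongr
          _ ≤ |F x - midpt (m - 1)| * c ^ j := by gcongr
          _ ≤ _ := h2
  have e : 2 ^ k + 2 ^ k = 2 ^ (k + 1) := by rw [pow_succ]; ring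
  obtain ⟨h1, h2⟩ := key (2 ^ k) le_rfl x hx
  rw [e] at h1 h2
  refine ⟨h1, ?_⟩
  rw [contr, ← div_eq_mul_inv, le_div_iff₀ (pow_pos hc0 _)]
  exact h2

/-! ### The map `g` -/

/-- The fraction of the fundamental interval of index `2 ^ k` occupied by one half of the support
of `g`. It increases geometrically up to `k = k₀`, which makes `[u_k, v_k]` a small part of
`[b_k, c_k]` for those `k` for which the contraction by `f` alone does not suffice. -/
def supportRatio (k₀ k : ℕ) : ℝ := (1 / 8) ^ (k₀ - k + 1)

theorem supportRatio_pos (k₀ k : ℕ) : 0 < supportRatio k₀ k := by unfold supportRatio; positivity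

theorem supportRatio_le (k₀ k : ℕ) : supportRatio k₀ k ≤ 1 / 8 := by
  have : (1 / 8 : ℝ) ^ (k₀ - k) ≤ 1 := pow_le_one₀ (by norm_num) (by norm_num)
  rw [supportRatio, pow_succ]; linarith

theorem supportRatio_mono (k₀ : ℕ) : Monotone (supportRatio k₀) := fun _ _ h =>
  pow_le_pow_of_le_one (by norm_num) (by norm_num) (by omega)

theorem supportRatio_of_lt {k₀ k : ℕ} (h : k < k₀) :
    supportRatio k₀ k = supportRatio k₀ (k + 1) / 8 := by
  have : k₀ - k + 1 = (k₀ - (k + 1) + 1) + 1 := by omega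
  rw [supportRatio, supportRatio, this, pow_succ]; ring

/-- The half length of the support of `g` in the fundamental interval of index `2 ^ k`. -/
def halfWidth (k₀ k : ℕ) : ℝ := supportRatio k₀ k * len (2 ^ k)

theorem halfWidth_pos (k₀ k : ℕ) : 0 < halfWidth k₀ k :=
  mul_pos (supportRatio_pos _ _) (len_pos _)

theorem halfWidth_le (k₀ k : ℕ) : halfWidth k₀ k ≤ len (2 ^ k) / 8 := by
  have := len_pos (2 ^ k)
  have := supportRatio_le k₀ k
  unfold halfWidth; nlinarith

/-- The position of the pulled back interval `[u_{k+1}, v_{k+1}]` inside the support of `g`. -/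
theorem exists_pullback_bound : ∃ (k₀ : ℕ) (C : ℝ), 0 < C ∧ ∀ (k : ℕ) (x : ℝ),
    |(primitiveMap shiftDensity)^[2 ^ k] x - midpt ((2 ^ k : ℕ) : ℤ)| ≤ halfWidth k₀ k →
    |x - midpt ((2 ^ (k + 1) : ℕ) : ℤ)| ≤ halfWidth k₀ (k + 1) / 8 ∧
      |x - midpt ((2 ^ (k + 1) : ℕ) : ℤ)| ≤ halfWidth k₀ (k + 1) * (C * amp (2 ^ (k + 1))) := by
  obtain ⟨C, hC0, hC⟩ := exists_contr_le
  obtain ⟨k₀, hk₀⟩ := eventually_atTop.1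
    (tendsto_contr.eventually_le_const (by norm_num : (0 : ℝ) < 1 / 32))
  refine ⟨k₀, 4 * C, by positivity, fun k x hx => ?_⟩
  obtain ⟨h1, h2⟩ := pullback_estimate k (supportRatio_pos k₀ k).le (supportRatio_le k₀ k) hx
  have hθ := supportRatio_pos k₀ k
  have hθ' := supportRatio_mono k₀ k.le_succ
  have hl := len_pos (2 ^ k)
  have hl' := len_pos (2 ^ (k + 1))
  have hl4 : len (2 ^ k) ≤ 4 * len (2 ^ (k + 1)) := by
    have := len_le_four_mul (2 ^ k)
    rwa [show 2 * 2 ^ k = 2 ^ (k + 1) by rw [pow_succ]; ring] at this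
  have h3 : |x - midpt ((2 ^ (k + 1) : ℕ) : ℤ)| ≤ halfWidth k₀ (k + 1) * (4 * contr k) := by
    have hc := contr_pos k
    have hθ1 := supportRatio_pos k₀ (k + 1)
    refine h2.trans ?_
    calc supportRatio k₀ k * len (2 ^ k) * contr k
        ≤ supportRatio k₀ (k + 1) * (4 * len (2 ^ (k + 1))) * contr k := by gcongr
      _ = _ := by unfold halfWidth; ring
  have hw := halfWidth_pos k₀ (k + 1)
  refine ⟨?_, h3.trans ?_⟩
  · rcases lt_or_ge k k₀ with hk | hk
    · refine h1.trans (le_of_eq ?_)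
      rw [supportRatio_of_lt hk, halfWidth]; ring
    · have := hk₀ k hk
      nlinarith
  · have := hC k
    rw [mul_assoc 4]
    gcongr

theorem hasDerivAt_sin_sq (A s : ℝ) :
    HasDerivAt (fun s => A * (Real.sin (Real.pi * s) ^ 2 / Real.pi))
      (A * Real.sin (2 * Real.pi * s)) s := by
  have h1 : HasDerivAt (fun s => Real.pi * s) Real.pi s := by
    simpa using (hasDerivAt_id s).const_mul Real.pi
  have h2 := ((h1.sin.pow 2).div_const Real.pi).const_mul A
  refine h2.congr_deriv ?_
  have := Real.pi_pos.ne'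
  rw [show 2 * Real.pi * s = 2 * (Real.pi * s) by ring, Real.sin_two_mul]
  field_simp
  norm_num
  ring

/-- A map supported in intervals `[p_j, q_j]` accumulating only at `0`, moving prescribed points
`x_j` of the middle part of these intervals by prescribed amounts `d_j`. The condition
`d_j ≤ C (q_j - p_j)^{1+α}` is what the class `C^{1+α}` requires. -/
theorem exists_diffeo_of_displacement {α C : ℝ} (hα0 : 0 < α) (hα1 : α ≤ 1) (hC : 0 ≤ C)
    {p q x d : ℕ → ℝ} (hpq : ∀ j, p j < q j) (hqp : ∀ j, q (j + 1) < p j)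
    (hq1 : q 0 < 1) (hp : Tendsto p atTop (𝓝 0)) (hd0 : ∀ j, 0 < d j)
    (hd : ∀ j, d j ≤ (q j - p j) / 8) (hdC : ∀ j, d j ≤ C * (q j - p j) ^ α * (q j - p j))
    (hx : ∀ j, |x j - (p j + q j) / 2| ≤ (q j - p j) / 4) :
    ∃ g : I ≃ₜ I, StrictMono g ∧ IsC1HolderDiffeo α g ∧
      (∀ y : I, (∀ j, (y : ℝ) ∉ Ioo (p j) (q j)) → g y = y) ∧
      (∀ (y : I) (j : ℕ), (y : ℝ) ∈ Ioo (p j) (q j) → g y ≠ y) ∧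
      ∀ (y : I) (j : ℕ), (y : ℝ) = x j → (g y : ℝ) = x j + d j := by
  have hpi := Real.pi_pos
  have hpanti : StrictAnti p := strictAnti_nat_of_succ_lt fun j => (hpq _).trans (hqp j)
  have hqanti : StrictAnti q := strictAnti_nat_of_succ_lt fun j => (hqp j).trans (hpq j)
  have hqple : ∀ i j, i < j → q j ≤ p i := fun i j hij =>
    (hqanti.antitone (Nat.succ_le_of_lt hij)).trans (hqp i).le
  have hdisj : Pairwise fun i j => Disjoint (Ioo (p i) (q i)) (Ioo (p j) (q j)) := by
    have key : ∀ i j, i < j → Disjoint (Ioo (p i) (q i)) (Ioo (p j) (q j)) := fun i j hij => by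
      rw [Set.disjoint_left]
      intro z hz hz'
      exact absurd (hz'.2.trans_le (hqple i j hij)) (not_lt.2 hz.1.le)
    intro i j hij
    rcases lt_or_gt_of_ne hij with h | h
    exacts [key i j h, (key j i h).symm]
  have hw : ∀ j, 0 < q j - p j := fun j => sub_pos.2 (hpq j)
  set S : ℕ → ℝ := fun j => Real.sin (Real.pi * ((x j - p j) / (q j - p j))) ^ 2 with hS
  have hS2 : ∀ j, 1 / 2 ≤ S j := by
    intro j
    have h := abs_le.1 (hx j)
    have hw := hw j
    have s1 : 1 / 4 ≤ (x j - p j) / (q j - p j) := by rw [le_div_iff₀ hw]; linarith [h.1]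
    have s2 : (x j - p j) / (q j - p j) ≤ 3 / 4 := by rw [div_le_iff₀ hw]; linarith [h.2]
    have hc : Real.cos (2 * (Real.pi * ((x j - p j) / (q j - p j)))) ≤ 0 :=
      Real.cos_nonpos_of_pi_div_two_le_of_le (by nlinarith) (by nlinarith)
    rw [hS]
    simp only [Real.sin_sq_eq_half_sub]
    linarith
  -- The amplitude for which `x j` is moved by exactly `d j`.
  set A : ℕ → ℝ := fun j => Real.pi * d j / ((q j - p j) * S j) with hA
  have hA0 : ∀ j, 0 < A j := fun j => by
    have := hS2 j; have := hw j; have := hd0 j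
    simp only [hA]; positivity
  have hAle : ∀ j, A j ≤ 2 * Real.pi * d j / (q j - p j) := fun j => by
    have h1 := hS2 j; have h2 := hw j; have h3 := hd0 j
    simp only [hA]
    rw [div_le_div_iff₀ (by positivity) h2]
    have : 0 ≤ Real.pi * d j * (q j - p j) := by positivity
    nlinarith
  have hA78 : ∀ j, A j ≤ 7 / 8 := fun j => by
    refine (hAle j).trans ?_
    rw [div_le_iff₀ (hw j)]
    have := hd j; have := hw j; have := Real.pi_lt_d2
    nlinarith [hd0 j]
  set P : ℕ → ℝ → ℝ := fun j s => A j * Real.sin (2 * Real.pi * s) with hP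
  have hP0 : ∀ j, P j 0 = 0 := by simp [hP]
  have hP1 : ∀ j, P j 1 = 0 := by simp [hP]
  have hPlip : ∀ j, ∀ s t, |P j s - P j t| ≤ (4 * Real.pi ^ 2 * C) * (q j - p j) ^ α * |s - t| := by
    intro j s t
    have h1 : |Real.sin (2 * Real.pi * s) - Real.sin (2 * Real.pi * t)| ≤
        2 * Real.pi * |s - t| := by
      have := Real.abs_sin_sub_sin_le (2 * Real.pi * s) (2 * Real.pi * t)
      rwa [← mul_sub, abs_mul, abs_of_nonneg (by positivity : 0 ≤ 2 * Real.pi)] at this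
    have h2 : A j ≤ 2 * Real.pi * (C * (q j - p j) ^ α) := by
      refine (hAle j).trans ?_
      rw [div_le_iff₀ (hw j)]
      have := hdC j
      nlinarith
    calc |P j s - P j t| = A j * |Real.sin (2 * Real.pi * s) - Real.sin (2 * Real.pi * t)| := by
          simp only [hP]; rw [← mul_sub, abs_mul, abs_of_pos (hA0 j)]
      _ ≤ 2 * Real.pi * (C * (q j - p j) ^ α) * (2 * Real.pi * |s - t|) := by
          have h3 := (hA0 j).le.trans h2
          gcongr
      _ = _ := by ring
  have hhol := bumpSum_holder hα0 hα1 (by positivity) hpq hdisj hP0 hP1 hPlip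
  have hcont := continuous_of_holder hα0 hhol
  have hlow : ∀ y, 1 / 8 ≤ 1 + bumpSum p q P y := by
    intro y
    by_cases h : ∃ j, y ∈ Ioo (p j) (q j)
    · obtain ⟨j, hj⟩ := h
      rw [bumpSum_of_mem_Ioo hdisj hj]
      have := hA0 j; have := hA78 j
      have := Real.neg_one_le_sin (2 * Real.pi * ((y - p j) / (q j - p j)))
      simp only [hP]; nlinarith
    · rw [bumpSum_of_forall_notMem (by simpa using h)]
      norm_num
  set G := primitiveMap (bumpSum p q P) with hG
  have hGin : ∀ j, ∀ y ∈ Icc (p j) (q j), G y - G (p j) = (y - p j) + (q j - p j) *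
      (A j * (Real.sin (Real.pi * ((y - p j) / (q j - p j))) ^ 2 / Real.pi)) := by
    intro j y hy
    have := primitiveMap_bumpSum_sub hpq hdisj hP0 hP1 hcont (hasDerivAt_sin_sq (A j)) hy
    simpa using this
  have hGpq : ∀ j, G (q j) - G (p j) = q j - p j := by
    intro j
    have := hGin j (q j) (right_mem_Icc.2 (hpq j).le)
    rwa [div_self (hw j).ne', mul_one, Real.sin_pi, zero_pow two_ne_zero, zero_div, mul_zero,
      mul_zero, add_zero] at this
  have hGout : ∀ j y, q j ≤ y → (∀ i < j, y ≤ p i) → G y - G (q j) = y - q j := by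
    intro j y hjy hy
    refine primitiveMap_bumpSum_of_disjoint hcont hjy fun z hz i hi => ?_
    rcases lt_or_ge i j with h | h
    · exact absurd hi.1 (not_lt.2 (hz.2.trans (hy i h)))
    · exact absurd hi.2 (not_lt.2 ((hqanti.antitone h).trans hz.1))
  -- The displacement of `p j` does not depend on `j`, and it tends to `0` with `p j`.
  have hGp : ∀ j, G (p j) = p j := by
    intro j
    have hconst : ∀ n, G (p (j + n)) - p (j + n) = G (p j) - p j := by
      intro n
      induction n with
      | zero => simp
      | succ n ih =>
        have h1 := hGpq (j + n + 1)
        have h2 := hGout (j + n + 1) (p (j + n)) (hqp _).le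
          fun i hi => hpanti.antitone (by omega)
        rw [← ih, ← add_assoc]
        linarith
    have htop : Tendsto (fun n => p (j + n)) atTop (𝓝 0) :=
      hp.comp (tendsto_atTop_mono (fun n => Nat.le_add_left n j) tendsto_id)
    have h1 := (((continuous_primitiveMap hcont).tendsto 0).comp htop).sub htop
    have h2 := tendsto_nhds_unique (h1.congr hconst) tendsto_const_nhds
    rw [primitiveMap_zero] at h2
    linarith
  have hGid : ∀ y, 0 ≤ y → (∀ j, y ∉ Ioo (p j) (q j)) → G y = y := by
    intro y hy0 hy
    rcases hy0.eq_or_lt with rfl | hy0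
    · exact primitiveMap_zero _
    have hex : ∃ j, p j ≤ y := ((hp.eventually_le_const hy0).exists)
    classical
    have hj := Nat.find_spec hex
    have hmin := fun i => Nat.find_min hex (m := i)
    set j := Nat.find hex
    rcases hj.eq_or_lt with h | h
    · rw [← h, hGp]
    · have hqy : q j ≤ y := not_lt.1 fun hlt => hy j ⟨h, hlt⟩
      have := hGout j y hqy fun i hi => (not_le.1 (hmin i hi)).le
      have := hGpq j
      have := hGp j
      linarith
  obtain ⟨g, hgm, hgd, hgG⟩ := exists_diffeo_of_holder hα0 (by norm_num : (0 : ℝ) < 1 / 8) hhol hlow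
    (hGid 1 zero_le_one fun j hj =>
      absurd hj.2 (not_lt.2 ((hqanti.antitone (Nat.zero_le j)).trans hq1.le)))
  have hGin' : ∀ j, ∀ y ∈ Icc (p j) (q j), G y = y + (q j - p j) *
      (A j * (Real.sin (Real.pi * ((y - p j) / (q j - p j))) ^ 2 / Real.pi)) := by
    intro j y hy
    have := hGin j y hy
    rw [hGp] at this
    linarith
  refine ⟨g, hgm, hgd, fun y hy => Subtype.ext ?_, fun y j hy heq => ?_, fun y j hy => ?_⟩
  · rw [hgG]; exact hGid y y.2.1 hy
  · have h1 := hGin' j y (Ioo_subset_Icc_self hy)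
    rw [hG, ← hgG, heq] at h1
    have hs : 0 < Real.sin (Real.pi * (((y : ℝ) - p j) / (q j - p j))) := by
      have s0 : 0 < ((y : ℝ) - p j) / (q j - p j) := div_pos (sub_pos.2 hy.1) (hw j)
      have s1 : ((y : ℝ) - p j) / (q j - p j) < 1 := by
        rw [div_lt_one (hw j)]; linarith [hy.2]
      exact Real.sin_pos_of_pos_of_lt_pi (by positivity) (by nlinarith)
    have := hw j
    have := hA0 j
    have : 0 < (q j - p j) *
      (A j * (Real.sin (Real.pi * (((y : ℝ) - p j) / (q j - p j))) ^ 2 / Real.pi)) := by positivity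
    linarith
  · have h := abs_le.1 (hx j)
    have hmem : (y : ℝ) ∈ Icc (p j) (q j) := by
      have := hw j
      rw [hy]; constructor <;> linarith [h.1, h.2]
    have h1 := hGin' j y hmem
    rw [hG, ← hgG, hy] at h1
    rw [h1]
    have e1 : Real.sin (Real.pi * ((x j - p j) / (q j - p j))) ^ 2 = S j := rfl
    rw [e1]
    have := (hw j).ne'
    have h2 : S j ≠ 0 := by have := hS2 j; positivity
    simp only [hA]
    field_simp

theorem midpt_sub_mem (k₀ k : ℕ) :
    endpt ((2 ^ k : ℕ) + 1) < midpt ((2 ^ k : ℕ) : ℤ) - halfWidth k₀ k := by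
  have h := midpt_eq ((2 ^ k : ℕ) : ℤ)
  rw [lenIndex_natCast] at h
  have := halfWidth_le k₀ k
  have := len_pos (2 ^ k)
  linarith

theorem midpt_add_mem (k₀ k : ℕ) :
    midpt ((2 ^ k : ℕ) : ℤ) + halfWidth k₀ k < endpt (2 ^ k : ℕ) := by
  have h := midpt_eq' ((2 ^ k : ℕ) : ℤ)
  rw [lenIndex_natCast] at h
  have := halfWidth_le k₀ k
  have := len_pos (2 ^ k)
  linarith

/-- The point of `[0,1]` with the given coordinate (the nearest end point outside `[0,1]`). -/
def toUnit (x : ℝ) : I := projIcc 0 1 zero_le_one x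

theorem coe_toUnit {x : ℝ} (hx : x ∈ Icc (0 : ℝ) 1) : (toUnit x : ℝ) = x := by
  rw [toUnit, projIcc_of_mem _ hx]

/-- The Hector-type construction with `n_k = 2^k` can be made of class `C^{1+5/8}`. -/
theorem exists_hectorConstruction :
    ∃ (a : ℤ → I) (b u v c : ℕ → I) (f g : I ≃ₜ I),
      IsHectorConstruction (fun k => 2 ^ k) a b u v c f g ∧ StrictMono f ∧ StrictMono g ∧
      IsC1HolderDiffeo (5 / 8) f ∧ IsC1HolderDiffeo (5 / 8) g := by
  obtain ⟨k₀, C, hC0, hpull⟩ := exists_pullback_bound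
  obtain ⟨Kf, hKf⟩ := exists_shiftDensity_holder
  obtain ⟨K, hK0, hamp⟩ := exists_amp_eq
  obtain ⟨f, hfm, hfd, hfF⟩ := exists_diffeo_of_holder (by norm_num) (by norm_num : (0 : ℝ) < 5 / 8)
    hKf shiftDensity_ge shift_one
  set F := primitiveMap shiftDensity with hF
  have hiter : ∀ (n : ℕ) (x : I), (((⇑f)^[n] x : I) : ℝ) = F^[n] x := by
    intro n
    induction n with
    | zero => intro x; rfl
    | succ n ih => intro x; rw [Function.iterate_succ_apply, ih, hfF, Function.iterate_succ_apply]
  set hw := halfWidth k₀ with hhw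
  have hw0 : ∀ k, 0 < hw k := halfWidth_pos k₀
  set mid : ℕ → ℝ := fun k => midpt ((2 ^ k : ℕ) : ℤ) with hmid
  have hlow : ∀ k, endpt ((2 ^ k : ℕ) + 1) < mid k - hw k := midpt_sub_mem k₀
  have hup : ∀ k, mid k + hw k < endpt (2 ^ k : ℕ) := midpt_add_mem k₀
  have ha : ∀ m, (toUnit (endpt m) : ℝ) = endpt m := fun m =>
    coe_toUnit ⟨(endpt_pos m).le, (endpt_lt_one m).le⟩
  have hb : ∀ k, (toUnit (mid k - hw k) : ℝ) = mid k - hw k := fun k => coe_toUnit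
    ⟨((endpt_pos _).trans (hlow k)).le, by linarith [hup k, endpt_lt_one (2 ^ k : ℕ), hw0 k]⟩
  have hc : ∀ k, (toUnit (mid k + hw k) : ℝ) = mid k + hw k := fun k => coe_toUnit
    ⟨by linarith [endpt_pos ((2 ^ k : ℕ) + 1), hlow k, hw0 k], ((hup k).trans (endpt_lt_one _)).le⟩
  set b : ℕ → I := fun k => toUnit (mid k - hw k) with hbdef
  set c : ℕ → I := fun k => toUnit (mid k + hw k) with hcdef
  -- The points `u_{k+1}` and `v_{k+1}` are determined by `b_k`, `c_k` and `f`.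
  set u : ℕ → I := fun k => (⇑f.symm)^[2 ^ (k - 1)] (b (k - 1)) with hu
  set v : ℕ → I := fun k => (⇑f.symm)^[2 ^ (k - 1)] (c (k - 1)) with hv
  have hfs : ∀ n (x : I), (⇑f)^[n] ((⇑f.symm)^[n] x) = x := fun n =>
    Function.LeftInverse.iterate f.apply_symm_apply n
  have hsm : StrictMono f.symm := fun x y hxy => by
    rw [← hfm.lt_iff_lt, f.apply_symm_apply, f.apply_symm_apply]; exact hxy
  have hfu : ∀ j, (⇑f)^[2 ^ j] (u (j + 1)) = b j := fun j => hfs _ _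
  have hfv : ∀ j, (⇑f)^[2 ^ j] (v (j + 1)) = c j := fun j => hfs _ _
  have huv : ∀ j, u (j + 1) < v (j + 1) := by
    intro j
    refine (hsm.iterate (2 ^ j)) ?_
    rw [← Subtype.coe_lt_coe, hb, hc]
    linarith [hw0 (j + 1 - 1)]
  have hU : ∀ j, |(u (j + 1) : ℝ) - mid (j + 1)| ≤ hw (j + 1) / 8 ∧
      |(u (j + 1) : ℝ) - mid (j + 1)| ≤ hw (j + 1) * (C * amp (2 ^ (j + 1))) := by
    intro j
    refine hpull j _ ?_
    have h1 : F^[2 ^ j] (u (j + 1)) - midpt ((2 ^ j : ℕ) : ℤ) = -hw j := by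
      rw [← hiter, hfu, hb]; ring
    rw [h1, abs_neg, abs_of_pos (hw0 j)]
  have hV : ∀ j, |(v (j + 1) : ℝ) - mid (j + 1)| ≤ hw (j + 1) / 8 ∧
      |(v (j + 1) : ℝ) - mid (j + 1)| ≤ hw (j + 1) * (C * amp (2 ^ (j + 1))) := by
    intro j
    refine hpull j _ ?_
    have h1 : F^[2 ^ j] (v (j + 1)) - midpt ((2 ^ j : ℕ) : ℤ) = hw j := by
      rw [← hiter, hfv, hc]; ring
    rw [h1, abs_of_pos (hw0 j)]
  have hwl : ∀ j, len (2 ^ (j + 1)) ≤ 2 * hw (j + 1) / (2 * supportRatio k₀ 0) := by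
    intro j
    have h0 := supportRatio_pos k₀ 0
    have h1 := supportRatio_mono k₀ (Nat.zero_le (j + 1))
    have := len_pos (2 ^ (j + 1))
    rw [le_div_iff₀ (by positivity), hhw, halfWidth]
    nlinarith
  have hanti : ∀ j, endpt (2 ^ (j + 2) : ℕ) ≤ endpt ((2 ^ (j + 1) : ℕ) + 1) := by
    intro j
    refine endpt_strictAnti.antitone ?_
    have : 2 ^ (j + 1) + 1 ≤ 2 ^ (j + 2) := by
      have : 1 ≤ 2 ^ (j + 1) := Nat.one_le_two_pow
      rw [pow_succ 2 (j + 1)]; omega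
    exact_mod_cast this
  obtain ⟨g, hgm, hgd, hgout, hgin, hgu⟩ := exists_diffeo_of_displacement
    (α := 5 / 8) (C := C * K / (2 * supportRatio k₀ 0) ^ (5 / 8 : ℝ))
    (p := fun j => mid (j + 1) - hw (j + 1)) (q := fun j => mid (j + 1) + hw (j + 1))
    (x := fun j => u (j + 1)) (d := fun j => (v (j + 1) : ℝ) - u (j + 1))
    (by norm_num) (by norm_num)
    (by have := supportRatio_pos k₀ 0; positivity)
    (fun j => by linarith [hw0 (j + 1)])
    (fun j => by
      have := hanti j; have := hlow (j + 1); have := hup (j + 2)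
      show mid (j + 2) + hw (j + 2) < _
      linarith)
    ((hup 1).trans (endpt_lt_one _))
    (by
      have h1 : Tendsto (fun k : ℕ => 2 ^ (k + 1)) atTop (atTop : Filter ℕ) :=
        (tendsto_pow_atTop_atTop_of_one_lt one_lt_two).comp (tendsto_add_atTop_nat 1)
      have h2 : Tendsto (fun j : ℕ => endpt (2 ^ (j + 1) : ℕ)) atTop (𝓝 0) :=
        tendsto_endpt_atTop.comp (tendsto_natCast_atTop_atTop.comp h1)
      refine squeeze_zero (fun j => ((endpt_pos _).trans (hlow (j + 1))).le) (fun j => ?_) h2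
      linarith [hup (j + 1), hw0 (j + 1)])
    (fun j => sub_pos.2 (huv j))
    (fun j => by
      have h1 := abs_le.1 (hU j).1; have h2 := abs_le.1 (hV j).1
      linarith [h1.1, h2.2])
    (fun j => by
      have h1 := abs_le.1 (hU j).2; have h2 := abs_le.1 (hV j).2
      have h0 := supportRatio_pos k₀ 0
      have hwj := hw0 (j + 1)
      have e : mid (j + 1) + hw (j + 1) - (mid (j + 1) - hw (j + 1)) = 2 * hw (j + 1) := by ring
      rw [e]
      have h3 : len (2 ^ (j + 1)) ^ (5 / 8 : ℝ) ≤
          (2 * hw (j + 1)) ^ (5 / 8 : ℝ) / (2 * supportRatio k₀ 0) ^ (5 / 8 : ℝ) := by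
        rw [← Real.div_rpow (by positivity) (by positivity)]
        exact Real.rpow_le_rpow (len_pos _).le (hwl j) (by norm_num)
      calc (v (j + 1) : ℝ) - u (j + 1) ≤ 2 * hw (j + 1) * (C * amp (2 ^ (j + 1))) := by
            linarith [h1.1, h2.2]
        _ ≤ 2 * hw (j + 1) * (C * (K * ((2 * hw (j + 1)) ^ (5 / 8 : ℝ) /
            (2 * supportRatio k₀ 0) ^ (5 / 8 : ℝ)))) := by
            rw [hamp]; gcongr
        _ = _ := by ring)
    (fun j => by
      have := (hU j).1
      have e : (mid (j + 1) - hw (j + 1) + (mid (j + 1) + hw (j + 1))) / 2 = mid (j + 1) := by ring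
      rw [e]
      linarith [hw0 (j + 1)])
  have hsucc : ∀ {p : ℕ → Prop}, (∀ j, p (j + 1)) → ∀ k, 1 ≤ k → p k := by
    intro p h k hk
    obtain ⟨j, rfl⟩ := Nat.exists_eq_add_of_le' hk
    exact h j
  -- The support of `g` misses the intervals and parts of intervals where `g` is the identity.
  have hnot : ∀ (m : ℤ) (x : I), x ∈ Icc (toUnit (endpt (m + 1))) (toUnit (endpt m)) → ∀ j,
      m ≠ ((2 ^ (j + 1) : ℕ) : ℤ) →
      (x : ℝ) ∉ Ioo (mid (j + 1) - hw (j + 1)) (mid (j + 1) + hw (j + 1)) := by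
    intro m x hx j hne hj
    have h1 : endpt (m + 1) ≤ x := by rw [← ha]; exact hx.1
    have h2 : (x : ℝ) ≤ endpt m := by rw [← ha]; exact hx.2
    have h3 := (hlow (j + 1)).trans hj.1
    have h4 := hj.2.trans (hup (j + 1))
    rcases lt_or_gt_of_ne hne with h | h
    · have := endpt_strictAnti.antitone (Int.add_one_le_iff.2 h)
      linarith
    · have := endpt_strictAnti.antitone (Int.add_one_le_iff.2 h)
      linarith
  refine ⟨fun m => toUnit (endpt m), b, u, v, c, f, g, ?_, hfm, hgm, hfd, hgd⟩
  refine
    { a_lt := fun m => ?_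
      a_tendsto_zero := ?_
      a_tendsto_one := ?_
      n_pos := fun k _ => by positivity
      n_lt := fun k _ => Nat.pow_lt_pow_right one_lt_two k.lt_succ_self
      f_shift := fun m => Subtype.ext ?_
      a_lt_b := fun k _ => ?_
      b_lt_u := hsucc fun j => ?_
      u_lt_v := hsucc huv
      v_lt_c := hsucc fun j => ?_
      c_lt_a := fun k _ => ?_
      g_eq_of_ne := fun m hm x hx => ?_
      g_eq_left := hsucc fun j x hx => ?_
      g_eq_right := hsucc fun j x hx => ?_
      g_u := hsucc fun j => Subtype.ext ?_
      g_ne := hsucc fun j x hx => ?_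
      iterate_u := fun k _ => ?_
      iterate_v := fun k _ => ?_ }
  · rw [← Subtype.coe_lt_coe, ha, ha]; exact endpt_lt m
  · rw [tendsto_subtype_rng]
    exact tendsto_endpt_atTop.congr fun m => (ha m).symm
  · rw [tendsto_subtype_rng]
    exact tendsto_endpt_atBot.congr fun m => (ha m).symm
  · rw [hfF, ha, ha, hF, shift_endpt, add_sub_cancel_right]
  · rw [← Subtype.coe_lt_coe, ha, hb]; exact hlow k
  · rw [← Subtype.coe_lt_coe, hb]
    linarith [(abs_le.1 (hU j).1).1, hw0 (j + 1)]
  · rw [← Subtype.coe_lt_coe, hc]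
    linarith [(abs_le.1 (hV j).1).2, hw0 (j + 1)]
  · rw [← Subtype.coe_lt_coe, ha, hc]; exact hup k
  · exact hgout x fun j => hnot m x hx j (hm (j + 1) (by omega))
  · refine hgout x fun i => ?_
    have h2 : (x : ℝ) ≤ mid (j + 1) - hw (j + 1) := by rw [← hb]; exact hx.2
    rcases eq_or_ne i j with rfl | hij
    · exact fun h => absurd h.1 (not_lt.2 h2)
    · refine hnot ((2 ^ (j + 1) : ℕ) : ℤ) x ⟨hx.1, ?_⟩ i ?_
      · rw [← Subtype.coe_le_coe, ha]
        linarith [hup (j + 1), hw0 (j + 1)]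
      · intro h
        have := Nat.pow_right_injective le_rfl (Int.ofNat_inj.1 h)
        omega
  · refine hgout x fun i => ?_
    have h2 : mid (j + 1) + hw (j + 1) ≤ x := by rw [← hc]; exact hx.1
    rcases eq_or_ne i j with rfl | hij
    · exact fun h => absurd h.2 (not_lt.2 h2)
    · refine hnot ((2 ^ (j + 1) : ℕ) : ℤ) x ⟨?_, hx.2⟩ i ?_
      · rw [← Subtype.coe_le_coe, ha]
        linarith [hlow (j + 1), hw0 (j + 1)]
      · intro h
        have := Nat.pow_right_injective le_rfl (Int.ofNat_inj.1 h)
        omega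
  · have := hgu (u (j + 1)) j rfl
    rw [this]; ring
  · refine hgin x j ⟨?_, ?_⟩
    · rw [← hb]; exact hx.1
    · rw [← hc]; exact hx.2
  · have : 2 ^ (k + 1) - 2 ^ k = 2 ^ k := by rw [pow_succ]; omega
    show (⇑f)^[2 ^ (k + 1) - 2 ^ k] (u (k + 1)) = b k
    rw [this]; exact hfu k
  · have : 2 ^ (k + 1) - 2 ^ k = 2 ^ k := by rw [pow_succ]; omega
    show (⇑f)^[2 ^ (k + 1) - 2 ^ k] (v (k + 1)) = c k
    rw [this]; exact hfv k

/-! ### Dynamics of the Hector-type construction -/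

/-- The group of increasing homeomorphisms of `[0,1]`. -/
def increasingSubgroup : Subgroup (I ≃ₜ I) where
  carrier := {h | StrictMono h}
  one_mem' := strictMono_id
  mul_mem' := fun {p q} (hp : StrictMono p) (hq : StrictMono q) => hp.comp hq
  inv_mem' := fun {h} hh x y hxy => by
    rw [← hh.lt_iff_lt]
    simpa using hxy

/-- The group of homeomorphisms of `[0,1]` fixing a given point. -/
def pointStabilizer (x : I) : Subgroup (I ≃ₜ I) where
  carrier := {h | h x = x}
  one_mem' := rfl
  mul_mem' := fun {p q} (hp : p x = x) (hq : q x = x) => by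
    show p (q x) = x
    rw [hq, hp]
  inv_mem' := fun {h} (hh : h x = x) => by
    show h.symm x = x
    rw [← hh, h.symm_apply_apply, hh]

theorem strictMono_zpow {h : I ≃ₜ I} (hh : StrictMono h) (j : ℤ) : StrictMono (h ^ j) :=
  increasingSubgroup.zpow_mem (x := h) hh j

theorem zpow_apply_of_fixed {h : I ≃ₜ I} {x : I} (hh : h x = x) (j : ℤ) : (h ^ j) x = x :=
  (pointStabilizer x).zpow_mem (x := h) hh j

theorem homeomorph_pow_apply (h : I ≃ₜ I) (j : ℕ) (x : I) : (h ^ j) x = (⇑h)^[j] x := by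
  induction j generalizing x with
  | zero => rfl
  | succ j ih => rw [pow_succ, Homeomorph.mul_apply, ih, Function.iterate_succ_apply]

theorem zpow_add_apply (h : I ≃ₜ I) (i j : ℤ) (x : I) : (h ^ (i + j)) x = (h ^ i) ((h ^ j) x) := by
  rw [zpow_add, Homeomorph.mul_apply]

theorem zpow_neg_apply_zpow (h : I ≃ₜ I) (j : ℤ) (x : I) : (h ^ (-j)) ((h ^ j) x) = x := by
  rw [← zpow_add_apply, neg_add_cancel, zpow_zero, Homeomorph.one_apply]

theorem zpow_apply_zpow_neg (h : I ≃ₜ I) (j : ℤ) (x : I) : (h ^ j) ((h ^ (-j)) x) = x := by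
  rw [← zpow_add_apply, add_neg_cancel, zpow_zero, Homeomorph.one_apply]

/-- An increasing homeomorphism `h` moves `(x, h x)` off its closure by all its nontrivial
powers. -/
theorem zpow_apply_notMem_Icc {h : I ≃ₜ I} (hh : StrictMono h) {x y z : I} (hxy : h x = y)
    (hlt : x < y) (hz : z ∈ Ioo x y) {j : ℤ} (hj : j ≠ 0) : (h ^ j) z ∉ Icc x y := by
  have hn : ∀ n : ℕ, y ≤ (h ^ n) y := by
    intro n
    induction n with
    | zero => exact le_rfl
    | succ n ih =>
      rw [pow_succ', Homeomorph.mul_apply]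
      calc y = h x := hxy.symm
        _ ≤ h y := hh.monotone hlt.le
        _ ≤ _ := hh.monotone ih
  have hn' : ∀ n : ℕ, y ≤ (h ^ (n + 1)) x := by
    intro n
    rw [pow_succ, Homeomorph.mul_apply, hxy]
    exact hn n
  have hm : ∀ n : ℕ, StrictMono (h ^ n) := fun n => by
    have := strictMono_zpow hh n
    rwa [zpow_natCast] at this
  rcases int_cases j with ⟨n, rfl⟩ | ⟨n, rfl⟩
  · obtain ⟨n, rfl⟩ := Nat.exists_eq_succ_of_ne_zero (by exact_mod_cast hj : n ≠ 0)
    intro hmem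
    rw [zpow_natCast] at hmem
    exact absurd hmem.2 (not_le.2 ((hn' n).trans_lt (hm (n + 1) hz.1)))
  · intro hmem
    have h1 : ((n : ℤ) + 1) = ((n + 1 : ℕ) : ℤ) := by push_cast; rfl
    have h2 := (strictMono_zpow hh (n + 1)).monotone hmem.1
    rw [zpow_apply_zpow_neg, h1, zpow_natCast] at h2
    exact absurd (hz.2.trans_le (hn' n)) (not_lt.2 h2)

/-- Invariance of a subset of `[0,1]` under the group generated by `f` and `g`. -/
def IsGroupInvariant (f g : I ≃ₜ I) (S : Set I) : Prop :=
  ∀ h ∈ Subgroup.closure {f, g}, ∀ x ∈ S, h x ∈ S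

namespace IsHectorConstruction

variable {n : ℕ → ℕ} {a : ℤ → I} {b u v c : ℕ → I} {f g : I ≃ₜ I}

/-- The conjugate `f^m g f^{-m}`. -/
def conj (f g : I ≃ₜ I) (m : ℤ) : I ≃ₜ I := f ^ m * g * f ^ (-m)

/-- The restriction of `g` to the interval of index `n_k`, transported to the fundamental interval
`[a_1, a_0]` by a power of `f`. -/
def level (n : ℕ → ℕ) (f g : I ≃ₜ I) (k : ℕ) : I ≃ₜ I := conj f g (n k)

/-- The support in `[a_1, a_0]` of the transported map. -/
def levelSupport (n : ℕ → ℕ) (b c : ℕ → I) (f : I ≃ₜ I) (k : ℕ) : Set I :=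
  Ioo ((f ^ (n k : ℤ)) (b k)) ((f ^ (n k : ℤ)) (c k))

theorem strictMono_conj (hf : StrictMono f) (hg : StrictMono g) (m : ℤ) :
    StrictMono (conj f g m) :=
  ((strictMono_zpow hf m).comp hg).comp (strictMono_zpow hf (-m))

theorem conj_apply (f g : I ≃ₜ I) (m : ℤ) (x : I) :
    conj f g m x = (f ^ m) (g ((f ^ (-m)) x)) := rfl

theorem conj_mem (f g : I ≃ₜ I) (m : ℤ) : conj f g m ∈ Subgroup.closure {f, g} :=
  have hf : f ∈ Subgroup.closure {f, g} := Subgroup.subset_closure (by simp)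
  have hg : g ∈ Subgroup.closure {f, g} := Subgroup.subset_closure (by simp)
  mul_mem (mul_mem (zpow_mem hf _) hg) (zpow_mem hf _)

theorem zpow_apply_a (H : IsHectorConstruction n a b u v c f g) (j m : ℤ) :
    (f ^ j) (a m) = a (m - j) := by
  have hnat : ∀ (j : ℕ) (m : ℤ), (f ^ j) (a m) = a (m - j) := by
    intro j
    induction j with
    | zero => intro m; simp
    | succ j ih =>
      intro m
      have : f (a m) = a (m - 1) := by
        have := H.f_shift (m - 1)
        rwa [sub_add_cancel] at this
      rw [pow_succ, Homeomorph.mul_apply, this, ih]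
      push_cast
      congr 1
      ring
  rcases int_cases j with ⟨k, rfl⟩ | ⟨k, rfl⟩
  · rw [zpow_natCast]; exact hnat k m
  · have h := hnat (k + 1) (m + (k + 1))
    have e : m + (k + 1 : ℤ) - ((k + 1 : ℕ) : ℤ) = m := by push_cast; ring
    rw [e, ← zpow_natCast] at h
    push_cast at h
    rw [← h, zpow_neg_apply_zpow, sub_neg_eq_add]

theorem zpow_apply_mem_Icc (H : IsHectorConstruction n a b u v c f g) (hf : StrictMono f) (m : ℤ)
    {x : I} (hx : x ∈ Icc (a 1) (a 0)) : (f ^ (-m)) x ∈ Icc (a (m + 1)) (a m) := by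
  have h1 := (strictMono_zpow hf (-m)).monotone hx.1
  have h2 := (strictMono_zpow hf (-m)).monotone hx.2
  rw [H.zpow_apply_a] at h1 h2
  rw [show (1 : ℤ) - -m = m + 1 by ring] at h1
  rw [show (0 : ℤ) - -m = m by ring] at h2
  exact ⟨h1, h2⟩

theorem conj_apply_of_ne (H : IsHectorConstruction n a b u v c f g) (hf : StrictMono f) {m : ℤ}
    (hm : ∀ k, 1 ≤ k → m ≠ (n k : ℤ)) {x : I} (hx : x ∈ Icc (a 1) (a 0)) :
    conj f g m x = x := by
  rw [conj_apply, H.g_eq_of_ne m hm _ (H.zpow_apply_mem_Icc hf m hx), zpow_apply_zpow_neg]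

theorem lt_level_left (H : IsHectorConstruction n a b u v c f g) (hf : StrictMono f) {k : ℕ}
    (hk : 1 ≤ k) : a 1 < (f ^ (n k : ℤ)) (b k) := by
  have := strictMono_zpow hf (n k) (H.a_lt_b k hk)
  rwa [H.zpow_apply_a, add_sub_cancel_left] at this

theorem level_right_lt (H : IsHectorConstruction n a b u v c f g) (hf : StrictMono f) {k : ℕ}
    (hk : 1 ≤ k) : (f ^ (n k : ℤ)) (c k) < a 0 := by
  have := strictMono_zpow hf (n k) (H.c_lt_a k hk)
  rwa [H.zpow_apply_a, sub_self] at this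

theorem level_left_lt_right (H : IsHectorConstruction n a b u v c f g) (hf : StrictMono f) {k : ℕ}
    (hk : 1 ≤ k) : (f ^ (n k : ℤ)) (b k) < (f ^ (n k : ℤ)) (c k) :=
  strictMono_zpow hf _ ((H.b_lt_u k hk).trans ((H.u_lt_v k hk).trans (H.v_lt_c k hk)))

theorem levelSupport_subset (H : IsHectorConstruction n a b u v c f g) (hf : StrictMono f) {k : ℕ}
    (hk : 1 ≤ k) : levelSupport n b c f k ⊆ Ioo (a 1) (a 0) := fun _ hx =>
  ⟨(H.lt_level_left hf hk).trans hx.1, hx.2.trans (H.level_right_lt hf hk)⟩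

theorem level_apply_of_notMem (H : IsHectorConstruction n a b u v c f g) (hf : StrictMono f) {k : ℕ}
    (hk : 1 ≤ k) {x : I} (hx : x ∈ Icc (a 1) (a 0)) (hxk : x ∉ levelSupport n b c f k) :
    level n f g k x = x := by
  have h1 := H.zpow_apply_mem_Icc hf (n k) hx
  have h2 : g ((f ^ (-(n k : ℤ))) x) = (f ^ (-(n k : ℤ))) x := by
    rw [levelSupport, mem_Ioo, not_and_or, not_lt, not_lt] at hxk
    rcases hxk with h | h
    · refine H.g_eq_left k hk _ ⟨h1.1, ?_⟩
      have := (strictMono_zpow hf (-(n k : ℤ))).monotone h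
      rwa [zpow_neg_apply_zpow] at this
    · refine H.g_eq_right k hk _ ⟨?_, h1.2⟩
      have := (strictMono_zpow hf (-(n k : ℤ))).monotone h
      rwa [zpow_neg_apply_zpow] at this
  rw [level, conj_apply, h2, zpow_apply_zpow_neg]

theorem level_apply_ne (H : IsHectorConstruction n a b u v c f g) (hf : StrictMono f) {k : ℕ}
    (hk : 1 ≤ k) {x : I} (hx : x ∈ levelSupport n b c f k) : level n f g k x ≠ x := by
  intro h
  have h1 := strictMono_zpow hf (-(n k : ℤ)) hx.1
  have h2 := strictMono_zpow hf (-(n k : ℤ)) hx.2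
  rw [zpow_neg_apply_zpow] at h1 h2
  refine H.g_ne k hk _ ⟨h1, h2⟩ ((f ^ (n k : ℤ)).injective ?_)
  rw [zpow_apply_zpow_neg]
  exact h

theorem level_zpow_mem (H : IsHectorConstruction n a b u v c f g) (hf : StrictMono f)
    (hg : StrictMono g) {k : ℕ} (hk : 1 ≤ k) (j : ℤ) {x : I} (hx : x ∈ levelSupport n b c f k) :
    (level n f g k ^ j) x ∈ levelSupport n b c f k := by
  have hm := strictMono_zpow (strictMono_conj hf hg (n k)) j
  have hb := H.lt_level_left hf hk
  have hc := H.level_right_lt hf hk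
  have hbc := H.level_left_lt_right hf hk
  have h1 := zpow_apply_of_fixed (H.level_apply_of_notMem hf hk ⟨hb.le, (hbc.trans hc).le⟩
    fun h => lt_irrefl _ h.1) j
  have h2 := zpow_apply_of_fixed (H.level_apply_of_notMem hf hk ⟨(hb.trans hbc).le, hc.le⟩
    fun h => lt_irrefl _ h.2) j
  have h3 := hm hx.1
  have h4 := hm hx.2
  change (level n f g k ^ j) _ < (level n f g k ^ j) _ at h3 h4
  rw [h1] at h3
  rw [h2] at h4
  exact ⟨h3, h4⟩

theorem zpow_succ_apply_u (H : IsHectorConstruction n a b u v c f g) {k : ℕ} (hk : 1 ≤ k) :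
    (f ^ (n (k + 1) : ℤ)) (u (k + 1)) = (f ^ (n k : ℤ)) (b k) ∧
      (f ^ (n (k + 1) : ℤ)) (v (k + 1)) = (f ^ (n k : ℤ)) (c k) := by
  have e : (n (k + 1) : ℤ) = n k + ((n (k + 1) - n k : ℕ) : ℤ) := by
    have := H.n_lt k hk
    omega
  rw [e, zpow_add_apply, zpow_add_apply, zpow_natCast f (n (k + 1) - n k), homeomorph_pow_apply,
    homeomorph_pow_apply, H.iterate_u k hk, H.iterate_v k hk]
  exact ⟨rfl, rfl⟩

/-- The transported map of level `k + 1` moves the left end point of the support of level `k` to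
the right one. -/
theorem level_succ_apply (H : IsHectorConstruction n a b u v c f g) {k : ℕ} (hk : 1 ≤ k) :
    level n f g (k + 1) ((f ^ (n k : ℤ)) (b k)) = (f ^ (n k : ℤ)) (c k) := by
  obtain ⟨h1, h2⟩ := H.zpow_succ_apply_u hk
  rw [← h1, ← h2, level, conj_apply, zpow_neg_apply_zpow, H.g_u (k + 1) (by omega)]

theorem levelSupport_succ_Icc (H : IsHectorConstruction n a b u v c f g) (hf : StrictMono f) {k : ℕ}
    (hk : 1 ≤ k) :
    Icc ((f ^ (n k : ℤ)) (b k)) ((f ^ (n k : ℤ)) (c k)) ⊆ levelSupport n b c f (k + 1) := by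
  obtain ⟨h1, h2⟩ := H.zpow_succ_apply_u hk
  have h3 := strictMono_zpow hf (n (k + 1)) (H.b_lt_u (k + 1) (by omega))
  have h4 := strictMono_zpow hf (n (k + 1)) (H.v_lt_c (k + 1) (by omega))
  rw [h1] at h3
  rw [h2] at h4
  exact fun x hx => ⟨h3.trans_le hx.1, hx.2.trans_lt h4⟩

theorem levelSupport_mono (H : IsHectorConstruction n a b u v c f g) (hf : StrictMono f) {k l : ℕ}
    (hk : 1 ≤ k) (hkl : k ≤ l) : levelSupport n b c f k ⊆ levelSupport n b c f l := by
  induction l, hkl using Nat.le_induction with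
  | base => exact subset_rfl
  | succ l hl ih =>
    exact (ih.trans Ioo_subset_Icc_self).trans (H.levelSupport_succ_Icc hf (hk.trans hl))

theorem level_zpow_mem_of_le (H : IsHectorConstruction n a b u v c f g) (hf : StrictMono f)
    (hg : StrictMono g) {k l : ℕ} (hk : 1 ≤ k) (hkl : k ≤ l) (j : ℤ) {x : I}
    (hx : x ∈ levelSupport n b c f l) : (level n f g k ^ j) x ∈ levelSupport n b c f l := by
  by_cases hxk : x ∈ levelSupport n b c f k
  · exact H.levelSupport_mono hf hk hkl (H.level_zpow_mem hf hg hk j hxk)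
  · rw [zpow_apply_of_fixed (H.level_apply_of_notMem hf hk
      (Ioo_subset_Icc_self (H.levelSupport_subset hf (hk.trans hkl) hx)) hxk)]
    exact hx

/-- The saturation of a subset of the fundamental interval under the powers of `f`. -/
def spread (f : I ≃ₜ I) (T : Set I) : Set I := {y | ∃ m : ℤ, (f ^ m) y ∈ T}

theorem isOpen_spread {T : Set I} (hT : IsOpen T) : IsOpen (spread f T) := by
  have : spread f T = ⋃ m : ℤ, (f ^ m) ⁻¹' T := by
    ext; simp [spread]
  rw [this]
  exact isOpen_iUnion fun m => hT.preimage (f ^ m).continuous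

theorem subset_spread (T : Set I) : T ⊆ spread f T := fun x hx => ⟨0, by simpa using hx⟩

theorem isInvariant_spread (H : IsHectorConstruction n a b u v c f g) (hf : StrictMono f)
    {T : Set I} (hT : T ⊆ Icc (a 1) (a 0))
    (hinv : ∀ k, 1 ≤ k → ∀ (j : ℤ), ∀ x ∈ T, (level n f g k ^ j) x ∈ T) :
    IsGroupInvariant f g (spread f T) := by
  have hfz : ∀ j : ℤ, ∀ y ∈ spread f T, (f ^ j) y ∈ spread f T := by
    rintro j y ⟨m, hm⟩
    exact ⟨m - j, by rwa [← zpow_add_apply, sub_add_cancel]⟩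
  have hgz : ∀ j : ℤ, ∀ y ∈ spread f T, (g ^ j) y ∈ spread f T := by
    rintro j y ⟨m, hm⟩
    have hc : (f ^ m) ((g ^ j) y) = (conj f g m ^ j) ((f ^ m) y) := by
      have : conj f g m ^ j = f ^ m * g ^ j * f ^ (-m) := by
        rw [conj, zpow_neg, conj_zpow]
      rw [this, Homeomorph.mul_apply, Homeomorph.mul_apply, zpow_neg_apply_zpow]
    refine ⟨m, ?_⟩
    rw [hc]
    by_cases h : ∃ k, 1 ≤ k ∧ m = n k
    · obtain ⟨k, hk, rfl⟩ := h
      exact hinv k hk j _ hm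
    · push Not at h
      rwa [zpow_apply_of_fixed (H.conj_apply_of_ne hf h (hT hm))]
  intro h hh
  have key : ∀ x ∈ spread f T, h x ∈ spread f T ∧ h⁻¹ x ∈ spread f T := by
    induction hh using Subgroup.closure_induction with
    | mem x hx =>
      intro y hy
      rcases hx with rfl | rfl
      · exact ⟨by simpa using hfz 1 y hy, by simpa using hfz (-1) y hy⟩
      · exact ⟨by simpa using hgz 1 y hy, by simpa using hgz (-1) y hy⟩
    | one => intro y hy; exact ⟨hy, by simpa using hy⟩
    | mul p q _ _ hp hq =>
      intro y hy
      refine ⟨(hp _ (hq y hy).1).1, ?_⟩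
      rw [mul_inv_rev]
      exact (hq _ (hp y hy).2).2
    | inv p _ hp => intro y hy; exact ⟨(hp y hy).2, by simpa using (hp y hy).1⟩
  exact fun x hx => (key x hx).1

/-- The images of the support of level `l` under the transported maps of levels at most
`l + i`, applied in increasing order of the levels. -/
def levelOrbit (n : ℕ → ℕ) (b c : ℕ → I) (f g : I ≃ₜ I) (l : ℕ) : ℕ → Set I
  | 0 => levelSupport n b c f l
  | i + 1 => ⋃ j : ℤ, (level n f g (l + i + 1) ^ j) '' levelOrbit n b c f g l i

theorem isOpen_levelOrbit (l i : ℕ) : IsOpen (levelOrbit n b c f g l i) := by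
  induction i with
  | zero => exact isOpen_Ioo
  | succ i ih => exact isOpen_iUnion fun j => (Homeomorph.isOpenMap _) _ ih

theorem levelOrbit_subset_succ (l i : ℕ) :
    levelOrbit n b c f g l i ⊆ levelOrbit n b c f g l (i + 1) := fun x hx =>
  mem_iUnion.2 ⟨0, x, hx, by simp⟩

theorem levelOrbit_subset (H : IsHectorConstruction n a b u v c f g) (hf : StrictMono f)
    (hg : StrictMono g) {l : ℕ} (hl : 1 ≤ l) (i : ℕ) :
    levelOrbit n b c f g l i ⊆ levelSupport n b c f (l + i) := by
  induction i with
  | zero => exact subset_rfl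
  | succ i ih =>
    refine iUnion_subset fun j => ?_
    rintro _ ⟨x, hx, rfl⟩
    exact H.level_zpow_mem (k := l + i + 1) hf hg (by omega) j
      (H.levelSupport_mono hf (by omega) (Nat.le_succ _) (ih hx))

/-- The orbit set is invariant under the lower levels: a translate of the support of level
`l + i` by a nontrivial power of the next level is disjoint from the supports of the lower
levels. -/
theorem level_zpow_mem_levelOrbit (H : IsHectorConstruction n a b u v c f g) (hf : StrictMono f)
    (hg : StrictMono g) {l : ℕ} (hl : 1 ≤ l) (i : ℕ) {k : ℕ} (hk : 1 ≤ k) (hki : k ≤ l + i) (j : ℤ)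
    {x : I} (hx : x ∈ levelOrbit n b c f g l i) :
    (level n f g k ^ j) x ∈ levelOrbit n b c f g l i := by
  induction i generalizing x with
  | zero => exact H.level_zpow_mem_of_le hf hg hk hki j hx
  | succ i ih =>
    obtain ⟨r, y, hy, rfl⟩ := mem_iUnion.1 hx
    rcases hki.eq_or_lt with rfl | hlt
    · exact mem_iUnion.2 ⟨j + r, y, hy, zpow_add_apply _ _ _ _⟩
    · have hki' : k ≤ l + i := by omega
      by_cases hr : r = 0
      · subst hr
        exact levelOrbit_subset_succ l i (by simpa using ih hki' hy)
      · have hyl := H.levelOrbit_subset hf hg hl i hy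
        have hout := zpow_apply_notMem_Icc (strictMono_conj hf hg (n (l + i + 1)))
          (H.level_succ_apply (by omega)) (H.level_left_lt_right hf (by omega)) hyl hr
        have hin := H.levelOrbit_subset hf hg hl (i + 1) hx
        rw [zpow_apply_of_fixed (H.level_apply_of_notMem hf hk (Ioo_subset_Icc_self
          (H.levelSupport_subset hf (by omega) hin)) fun h => hout (Ioo_subset_Icc_self
            (H.levelSupport_mono hf hk hki' h)))]
        exact hx

theorem left_mem_Icc_of_le (H : IsHectorConstruction n a b u v c f g) (hf : StrictMono f) {k l : ℕ}
    (hk : 1 ≤ k) (hkl : k ≤ l) :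
    (f ^ (n k : ℤ)) (b k) ∈ Icc ((f ^ (n l : ℤ)) (b l)) ((f ^ (n l : ℤ)) (c l)) := by
  rcases hkl.eq_or_lt with rfl | h
  · exact left_mem_Icc.2 (H.level_left_lt_right hf hk).le
  · exact Ioo_subset_Icc_self (H.levelSupport_mono hf (by omega) h
      (H.levelSupport_succ_Icc hf hk (left_mem_Icc.2 (H.level_left_lt_right hf hk).le)))

/-- The left end point of the support of level `l` is not in the orbit of this support: it lies in
the supports of all higher levels, whose maps move it together with its neighbourhood. -/
theorem left_notMem_levelOrbit (H : IsHectorConstruction n a b u v c f g) (hf : StrictMono f)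
    (hg : StrictMono g) {l : ℕ} (hl : 1 ≤ l) (i : ℕ) :
    (f ^ (n l : ℤ)) (b l) ∉ levelOrbit n b c f g l i := by
  induction i with
  | zero => exact fun h => lt_irrefl _ h.1
  | succ i ih =>
    intro h
    obtain ⟨r, y, hy, hyb⟩ := mem_iUnion.1 h
    by_cases hr : r = 0
    · subst hr
      rw [zpow_zero, Homeomorph.one_apply] at hyb
      exact ih (hyb ▸ hy)
    · refine zpow_apply_notMem_Icc (strictMono_conj hf hg (n (l + i + 1)))
        (H.level_succ_apply (by omega)) (H.level_left_lt_right hf (by omega))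
        (H.levelOrbit_subset hf hg hl i hy) hr ?_
      have := H.left_mem_Icc_of_le hf hl (Nat.le_add_right l i)
      rwa [← hyb] at this

/-- The power of `f` in the definition of `spread` would have to be trivial, because nontrivial
powers of `f` map the open interval `(a_1, a_0)` off itself. -/
theorem left_notMem_spread (H : IsHectorConstruction n a b u v c f g) (hf : StrictMono f)
    (hg : StrictMono g) {l : ℕ} (hl : 1 ≤ l) :
    (f ^ (n l : ℤ)) (b l) ∉ spread f (⋃ i, levelOrbit n b c f g l i) := by
  rintro ⟨m, hm⟩
  obtain ⟨i, hi⟩ := mem_iUnion.1 hm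
  have hanti : StrictAnti a := strictAnti_int_of_succ_lt H.a_lt
  have h1 := H.levelSupport_subset hf (by omega) (H.levelOrbit_subset hf hg hl i hi)
  have h2 : (f ^ (n l : ℤ)) (b l) ∈ Ioo (a 1) (a 0) :=
    ⟨H.lt_level_left hf hl, (H.level_left_lt_right hf hl).trans (H.level_right_lt hf hl)⟩
  have h3 := strictMono_zpow hf m h2.1
  have h4 := strictMono_zpow hf m h2.2
  rw [H.zpow_apply_a] at h3 h4
  have h5 := hanti.lt_iff_gt.1 (h3.trans h1.2)
  have h6 := hanti.lt_iff_gt.1 (h1.1.trans h4)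
  obtain rfl : m = 0 := by omega
  rw [zpow_zero, Homeomorph.one_apply] at hi
  exact H.left_notMem_levelOrbit hf hg hl i hi

/-- The open invariant set spread by the union of the supports of all levels has no minimal
set: a relatively closed invariant set contains the left end points of the supports of all
sufficiently large levels, and removing the orbit of such a support leaves a smaller invariant
set. -/
theorem exists_open_without_minimal (H : IsHectorConstruction n a b u v c f g) (hf : StrictMono f)
    (hg : StrictMono g) :
    ∃ W : Set I, IsOpen W ∧ W.Nonempty ∧ IsGroupInvariant f g W ∧
      ∀ K ⊆ W, K.Nonempty → IsGroupInvariant f g K → closure K ∩ W ⊆ K →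
        ∃ K' ⊆ K, K'.Nonempty ∧ IsGroupInvariant f g K' ∧ closure K' ∩ W ⊆ K' ∧ K' ≠ K := by
  set T : Set I := ⋃ k : ℕ, levelSupport n b c f (k + 1) with hT
  have hTk : ∀ k, 1 ≤ k → levelSupport n b c f k ⊆ T := fun k hk x hx =>
    mem_iUnion.2 ⟨k - 1, by rwa [Nat.sub_add_cancel hk]⟩
  have hlne : ∀ k, 1 ≤ k → Icc ((f ^ (n k : ℤ)) (b k)) ((f ^ (n k : ℤ)) (c k)) ⊆ spread f T :=
    fun k hk => ((H.levelSupport_succ_Icc hf hk).trans (hTk _ (by omega))).trans (subset_spread T)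
  refine ⟨spread f T, isOpen_spread (isOpen_iUnion fun k => isOpen_Ioo),
    ⟨_, hlne 1 le_rfl (left_mem_Icc.2 (H.level_left_lt_right hf le_rfl).le)⟩, ?_, ?_⟩
  · refine H.isInvariant_spread hf (iUnion_subset fun k => (H.levelSupport_subset hf
      (by omega)).trans Ioo_subset_Icc_self) fun k hk j x hx => ?_
    obtain ⟨l, hl⟩ := mem_iUnion.1 hx
    refine hTk (max k (l + 1)) (by omega) (H.level_zpow_mem_of_le hf hg hk (le_max_left _ _) j ?_)
    exact H.levelSupport_mono hf (by omega) (le_max_right _ _) hl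
  · intro K hKW hKne hKinv hKcl
    have hleft : ∀ k, 1 ≤ k → (K ∩ levelSupport n b c f k).Nonempty →
        (f ^ (n k : ℤ)) (b k) ∈ K := by
      rintro k hk ⟨p, hpK, hp⟩
      have hcpt : IsCompact (closure K ∩ Icc ((f ^ (n k : ℤ)) (b k)) ((f ^ (n k : ℤ)) (c k))) :=
        (isClosed_closure.inter isClosed_Icc).isCompact
      obtain ⟨q, ⟨hqK, hq⟩, hmin⟩ := hcpt.exists_isLeast
        ⟨p, subset_closure hpK, Ioo_subset_Icc_self hp⟩
      have hqK' : q ∈ K := hKcl ⟨hqK, hlne k hk hq⟩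
      rcases hq.1.eq_or_lt with h | h
      · rwa [h]
      -- Otherwise the map of level `k` or its inverse moves the least point further down.
      exfalso
      have hqs : q ∈ levelSupport n b c f k :=
        ⟨h, (hmin ⟨subset_closure hpK, Ioo_subset_Icc_self hp⟩).trans_lt hp.2⟩
      have hle : ∀ j : ℤ, q ≤ (level n f g k ^ j) q := fun j =>
        hmin ⟨subset_closure (hKinv _ (zpow_mem (conj_mem f g _) j) q hqK'),
          Ioo_subset_Icc_self (H.level_zpow_mem hf hg hk j hqs)⟩
      have h1 := hle 1
      have h2 := (strictMono_conj hf hg (n k)).monotone (hle (-1))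
      change level n f g k q ≤ level n f g k _ at h2
      rw [zpow_one] at h1
      rw [zpow_neg_one, ← Homeomorph.mul_apply, mul_inv_cancel, Homeomorph.one_apply] at h2
      exact H.level_apply_ne hf hk hqs (le_antisymm h2 h1)
    obtain ⟨p, hp⟩ := hKne
    obtain ⟨m, hm⟩ := hKW hp
    obtain ⟨k, hk⟩ := mem_iUnion.1 hm
    have hpm : (f ^ m) p ∈ K :=
      hKinv _ (zpow_mem (Subgroup.subset_closure (by simp)) m) p hp
    have hB1 := hleft (k + 1) (by omega) ⟨_, hpm, hk⟩
    have hB1' := H.levelSupport_succ_Icc hf (k := k + 1) (by omega)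
      (left_mem_Icc.2 (H.level_left_lt_right hf (by omega)).le)
    have hB2 := hleft (k + 1 + 1) (by omega) ⟨_, hB1, hB1'⟩
    set O := spread f (⋃ i, levelOrbit n b c f g (k + 1 + 1) i) with hO
    have hOopen : IsOpen O := isOpen_spread (isOpen_iUnion fun i => isOpen_levelOrbit _ i)
    have hOinv : IsGroupInvariant f g O := by
      refine H.isInvariant_spread hf (iUnion_subset fun i => (H.levelOrbit_subset hf hg
        (by omega) i).trans ((H.levelSupport_subset hf (by omega)).trans Ioo_subset_Icc_self))
        fun r hr j x hx => ?_
      obtain ⟨i, hi⟩ := mem_iUnion.1 hx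
      have hmono : Monotone (levelOrbit n b c f g (k + 1 + 1)) :=
        monotone_nat_of_le_succ fun i => levelOrbit_subset_succ _ i
      exact mem_iUnion.2 ⟨i + r, H.level_zpow_mem_levelOrbit hf hg (by omega) (i + r) hr
        (by omega) j (hmono (Nat.le_add_right i r) hi)⟩
    refine ⟨K \ O, sdiff_subset, ⟨_, hB2, H.left_notMem_spread hf hg (by omega)⟩,
      fun h hh x hx => ⟨hKinv h hh x hx.1, fun hxO => hx.2 ?_⟩, ?_, fun heq => ?_⟩
    · have := hOinv _ (inv_mem hh) _ hxO
      rwa [← Homeomorph.mul_apply, inv_mul_cancel, Homeomorph.one_apply] at this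
    · rintro x ⟨hx, hxW⟩
      refine ⟨hKcl ⟨closure_mono sdiff_subset hx, hxW⟩, fun hxO => ?_⟩
      obtain ⟨y, hyO, hy⟩ := mem_closure_iff.1 hx O hOopen hxO
      exact hy.2 hyO
    · have h1 : (f ^ (n (k + 1) : ℤ)) (b (k + 1)) ∈ K \ O := heq.symm ▸ hB1
      exact h1.2 (subset_spread _ (mem_iUnion.2 ⟨0, hB1'⟩))

end IsHectorConstruction

/-! ### Topology of the suspension -/

/-- The projection `X × [0,1] → (X × [0,1]) / Γ`. -/
abbrev suspensionMk {X : Type*} {Γ : Type*} [Group Γ] [MulAction Γ X] (ρ : Γ →* (I ≃ₜ I))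
    (p : X × I) : Suspension X ρ :=
  Quotient.mk (suspensionSetoid X ρ) p

section

variable {X : Type*} {Γ : Type*} [Group Γ] [MulAction Γ X] {ρ : Γ →* (I ≃ₜ I)}

theorem suspensionMk_eq_iff {p q : X × I} :
    suspensionMk ρ p = suspensionMk ρ q ↔ ∃ γ : Γ, q = (γ • p.1, ρ γ p.2) :=
  Quotient.eq (r := suspensionSetoid X ρ)

theorem continuous_suspensionMk [TopologicalSpace X] : Continuous (suspensionMk (X := X) ρ) :=
  continuous_quotient_mk'

theorem isOpenMap_suspensionMk [TopologicalSpace X]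
    (hc : ∀ γ : Γ, Continuous fun x : X => γ • x) : IsOpenMap (suspensionMk (X := X) ρ) := by
  intro U hU
  have h : suspensionMk ρ ⁻¹' (suspensionMk ρ '' U) =
      ⋃ γ : Γ, (fun p : X × I => (γ • p.1, ρ γ p.2)) ⁻¹' U := by
    ext p
    simp only [mem_preimage, mem_image, mem_iUnion]
    constructor
    · rintro ⟨q, hq, hqp⟩
      obtain ⟨γ, rfl⟩ := suspensionMk_eq_iff.1 hqp.symm
      exact ⟨γ, hq⟩
    · rintro ⟨γ, hγ⟩
      exact ⟨_, hγ, (suspensionMk_eq_iff.2 ⟨γ, rfl⟩).symm⟩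
  have : IsOpen (suspensionMk ρ ⁻¹' (suspensionMk ρ '' U)) := by
    rw [h]
    exact isOpen_iUnion fun γ => hU.preimage
      (((hc γ).comp continuous_fst).prodMk ((ρ γ).continuous.comp continuous_snd))
  exact isOpen_coinduced.2 this

/-- The projection is injective above a set that is disjoint from its translates. -/
theorem injOn_suspensionMk {U : Set X}
    (hU : ∀ γ : Γ, γ ≠ 1 → Disjoint ((fun x => γ • x) '' U) U) :
    InjOn (suspensionMk ρ) (U ×ˢ univ) := by
  rintro ⟨x, t⟩ ⟨hx, -⟩ ⟨y, s⟩ ⟨hy, -⟩ h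
  obtain ⟨γ, hγ⟩ := suspensionMk_eq_iff.1 h
  obtain ⟨rfl, rfl⟩ := Prod.mk.inj hγ
  have : γ = 1 := by
    by_contra hne
    exact Set.disjoint_left.1 (hU γ hne) ⟨x, hx, rfl⟩ hy
  subst this
  simp

/-- For `S ⊆ [0,1]` invariant under the action, `X × S` is the full preimage of its image. -/
theorem suspensionMk_mem_image_iff {S : Set I} (hS : ∀ γ : Γ, ∀ t ∈ S, ρ γ t ∈ S) {x : X} {t : I} :
    suspensionMk ρ (x, t) ∈ suspensionMk (X := X) ρ '' (univ ×ˢ S) ↔ t ∈ S := by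
  constructor
  · rintro ⟨⟨y, s⟩, ⟨-, hs⟩, h⟩
    obtain ⟨γ, hγ⟩ := suspensionMk_eq_iff.1 h
    obtain ⟨-, rfl⟩ := Prod.mk.inj hγ
    exact hS γ s hs
  · exact fun ht => ⟨(x, t), ⟨mem_univ _, ht⟩, rfl⟩

end

section

variable {d : ℕ} {X : Type*} [TopologicalSpace X] {Γ : Type*} [Group Γ] [MulAction Γ X]
  {ρ : Γ →* (I ≃ₜ I)}

theorem chart_symm_apply {e : OpenPartialHomeomorph (Suspension X ρ) (EuclideanSpace ℝ (Fin d) × I)}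
    {φ : OpenPartialHomeomorph X (EuclideanSpace ℝ (Fin d))} {U : Set X}
    (hes : e.source = suspensionMk ρ '' (U ×ˢ univ))
    (hev : ∀ y ∈ U, ∀ t, e (suspensionMk ρ (y, t)) = (φ y, t))
    {y : EuclideanSpace ℝ (Fin d)} (hy : y ∈ φ.target)
    (hyU : φ.symm y ∈ U) (t : I) :
    (y, t) ∈ e.target ∧ e.symm (y, t) = suspensionMk ρ (φ.symm y, t) := by
  have hs : suspensionMk ρ (φ.symm y, t) ∈ e.source := by
    rw [hes]; exact ⟨_, ⟨hyU, trivial⟩, rfl⟩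
  have h : e (suspensionMk ρ (φ.symm y, t)) = (y, t) := by
    rw [hev _ hyU, φ.right_inv hy]
  rw [← h]
  exact ⟨e.map_source hs, e.left_inv hs⟩

theorem mem_of_mem_chart_target
    {e : OpenPartialHomeomorph (Suspension X ρ) (EuclideanSpace ℝ (Fin d) × I)}
    {φ : OpenPartialHomeomorph X (EuclideanSpace ℝ (Fin d))} {U : Set X} (hUφ : U ⊆ φ.source)
    (hes : e.source = suspensionMk ρ '' (U ×ˢ univ))
    (hev : ∀ y ∈ U, ∀ t, e (suspensionMk ρ (y, t)) = (φ y, t))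
    {y : EuclideanSpace ℝ (Fin d)} {t : I}
    (h : (y, t) ∈ e.target) : y ∈ φ.target ∧ φ.symm y ∈ U := by
  have h1 := e.map_target h
  rw [hes] at h1
  obtain ⟨⟨x, s⟩, ⟨hx, -⟩, hxs⟩ := h1
  have h2 := e.right_inv h
  rw [← hxs, hev x hx] at h2
  obtain ⟨rfl, rfl⟩ := Prod.mk.inj h2
  exact ⟨φ.map_source (hUφ hx), by rwa [φ.left_inv (hUφ hx)]⟩

end

section

variable {d : ℕ} {X : Type*} [TopologicalSpace X] [ChartedSpace (EuclideanSpace ℝ (Fin d)) X]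
  {Γ : Type*} [Group Γ] [MulAction Γ X] {ρ : Γ →* (I ≃ₜ I)}

theorem IsDeckAction.continuous_smul (hX : IsDeckAction d X Γ) (γ : Γ) :
    Continuous fun x : X => γ • x :=
  (hX.smooth γ).continuous

theorem IsDeckAction.t2Space_suspension (hX : IsDeckAction d X Γ) (ρ : Γ →* (I ≃ₜ I)) :
    T2Space (Suspension X ρ) := by
  have := hX.t2
  have := hX.properlyDiscontinuous
  have : LocallyCompactSpace X := ChartedSpace.locallyCompactSpace (EuclideanSpace ℝ (Fin d)) X
  let act : MulAction Γ (X × I) :=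
    { smul := fun γ p => (γ • p.1, ρ γ p.2)
      one_smul := fun p => by
        show ((1 : Γ) • p.1, ρ 1 p.2) = p
        simp
      mul_smul := fun γ δ p => by
        show ((γ * δ) • p.1, ρ (γ * δ) p.2) = (γ • δ • p.1, ρ γ (ρ δ p.2))
        rw [mul_smul, map_mul, Homeomorph.mul_apply] }
  have hsmul : ∀ (γ : Γ) (p : X × I), act.toSMul.smul γ p = (γ • p.1, ρ γ p.2) := fun _ _ => rfl
  have : @ContinuousConstSMul Γ (X × I) _ act.toSMul :=
    ⟨fun γ => ((hX.continuous_smul γ).comp continuous_fst).prodMk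
      ((ρ γ).continuous.comp continuous_snd)⟩
  have : @ProperlyDiscontinuousSMul Γ (X × I) _ act.toSMul := by
    refine ⟨fun {K L} hK hL => ?_⟩
    refine (finite_disjoint_inter_image (Γ := Γ) (hK.image continuous_fst)
      (hL.image continuous_fst)).subset ?_
    rintro γ ⟨_, ⟨p, hp, rfl⟩, hL⟩
    exact ⟨γ • p.1, ⟨p.1, ⟨p, hp, rfl⟩, rfl⟩, ⟨_, hL, rfl⟩⟩
  have hs : suspensionSetoid X ρ = MulAction.orbitRel Γ (X × I) := by
    refine Setoid.ext fun p q => ?_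
    rw [MulAction.orbitRel_apply]
    constructor
    · intro h
      obtain ⟨γ, h⟩ := (suspensionSetoid X ρ).symm h
      exact ⟨γ, h.symm⟩
    · rintro ⟨γ, h⟩
      exact (suspensionSetoid X ρ).symm ⟨γ, h.symm⟩
  show T2Space (Quotient (suspensionSetoid X ρ))
  rw [hs]
  infer_instance

theorem IsDeckAction.secondCountable_suspension (hX : IsDeckAction d X Γ) (ρ : Γ →* (I ≃ₜ I)) :
    SecondCountableTopology (Suspension X ρ) := by
  have := hX.secondCountable
  exact TopologicalSpace.Quotient.secondCountableTopology
    (isOpenMap_suspensionMk hX.continuous_smul)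

/-! ### The foliated atlas of the suspension -/

/-- Every point of `X` has a neighbourhood in a given open set that is disjoint from its
translates. -/
theorem IsDeckAction.exists_open_disjoint (hX : IsDeckAction d X Γ) {V : Set X} (hV : IsOpen V)
    {x : X} (hx : x ∈ V) :
    ∃ U ⊆ V, IsOpen U ∧ x ∈ U ∧ ∀ γ : Γ, γ ≠ 1 → Disjoint ((fun x => γ • x) '' U) U := by
  have := hX.t2
  have := hX.properlyDiscontinuous
  have : LocallyCompactSpace X := ChartedSpace.locallyCompactSpace (EuclideanSpace ℝ (Fin d)) X
  have : ContinuousConstSMul Γ X := ⟨hX.continuous_smul⟩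
  obtain ⟨N, hN, hdis⟩ := ProperlyDiscontinuousSMul.exists_nhds_disjoint_image Γ x
  refine ⟨V ∩ interior N, inter_subset_left, hV.inter isOpen_interior,
    ⟨hx, mem_interior_iff_mem_nhds.2 hN⟩, fun γ hγ => ?_⟩
  have h := hdis γ fun hfix => hγ (hX.free γ x hfix)
  have hsub : V ∩ interior N ⊆ N := inter_subset_right.trans interior_subset
  exact h.mono (image_mono hsub) hsub

theorem IsDeckAction.exists_chart (hX : IsDeckAction d X Γ) (ρ : Γ →* (I ≃ₜ I)) (x : X) :
    ∃ e ∈ suspensionAtlas (EuclideanSpace ℝ (Fin d)) (X := X) ρ, ∃ U : Set X, IsOpen U ∧ x ∈ U ∧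
      U ⊆ (chartAt (EuclideanSpace ℝ (Fin d)) x).source ∧
      e.source = suspensionMk ρ '' (U ×ˢ univ) ∧
      ∀ y ∈ U, ∀ t, e (suspensionMk ρ (y, t)) = (chartAt (EuclideanSpace ℝ (Fin d)) x y, t) := by
  set φ := chartAt (EuclideanSpace ℝ (Fin d)) x with hφ
  obtain ⟨U, hUφ, hUo, hxU, hU⟩ := hX.exists_open_disjoint φ.open_source
    (mem_chart_source (EuclideanSpace ℝ (Fin d)) x)
  have : Nonempty (X × I) := ⟨(x, 0)⟩
  have hinj := injOn_suspensionMk (ρ := ρ) hU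
  let P : OpenPartialHomeomorph (X × I) (Suspension X ρ) :=
    OpenPartialHomeomorph.ofContinuousOpen (hinj.toPartialEquiv (suspensionMk ρ) (U ×ˢ univ))
      continuous_suspensionMk.continuousOn (isOpenMap_suspensionMk hX.continuous_smul)
      (hUo.prod isOpen_univ)
  have hPs : P.source = U ×ˢ univ := rfl
  have hPt : P.target = suspensionMk ρ '' (U ×ˢ univ) := rfl
  have hP : ∀ p, P p = suspensionMk ρ p := fun _ => rfl
  let e := P.symm.trans (φ.prod (OpenPartialHomeomorph.refl I))
  have hes : e.source = suspensionMk ρ '' (U ×ˢ univ) := by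
    ext p
    simp only [e, OpenPartialHomeomorph.trans_source, OpenPartialHomeomorph.symm_source, hPt,
      mem_inter_iff, and_iff_left_iff_imp]
    intro hp
    have : P.symm p ∈ P.source := P.map_target (by rwa [hPt])
    rw [hPs] at this
    exact ⟨hUφ this.1, trivial⟩
  have hev : ∀ y ∈ U, ∀ t, e (suspensionMk ρ (y, t)) = (φ y, t) := by
    intro y hy t
    have h : P.symm (suspensionMk ρ (y, t)) = (y, t) :=
      P.left_inv (x := (y, t)) (by rw [hPs]; exact ⟨hy, trivial⟩)
    show φ.prod (OpenPartialHomeomorph.refl I) (P.symm (suspensionMk ρ (y, t))) = _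
    rw [h]
    rfl
  exact ⟨e, ⟨φ, chart_mem_atlas _ x, U, hUo, hUφ, hU, hes, hev⟩, U, hUo, hxU, hUφ, hes, hev⟩

/-- Locally, a change of charts of the suspension is the product of a smooth map between open
sets of `ℝ^d` and of an element of the image of `ρ`. -/
theorem IsDeckAction.isFoliatedTransition (hX : IsDeckAction d X Γ) {α : ℝ} (hα : 0 < α)
    (hρ : ∀ γ, IsC1HolderDiffeo α (ρ γ))
    {e e' : OpenPartialHomeomorph (Suspension X ρ) (EuclideanSpace ℝ (Fin d) × I)}
    (he : e ∈ suspensionAtlas (EuclideanSpace ℝ (Fin d)) (X := X) ρ)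
    (he' : e' ∈ suspensionAtlas (EuclideanSpace ℝ (Fin d)) (X := X) ρ) :
    IsFoliatedTransition α (e.symm.trans e') := by
  have := hX.isManifold
  obtain ⟨φ, hφ, U, hUo, hUφ, -, hes, hev⟩ := he
  obtain ⟨φ', hφ', U', hUo', hUφ', -, hes', hev'⟩ := he'
  -- The local form of the change of charts.
  have key : ∀ (y : EuclideanSpace ℝ (Fin d)) (t : I), (y, t) ∈ (e.symm.trans e').source →
      ∃ (γ : Γ) (V : Set (EuclideanSpace ℝ (Fin d))), IsOpen V ∧ y ∈ V ∧
        ContDiffOn ℝ 1 (fun z => φ' (γ • φ.symm z)) V ∧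
        ∀ z ∈ V, ∀ s : I, e.symm.trans e' (z, s) = (φ' (γ • φ.symm z), ρ γ s) := by
    rintro y t ⟨hy, hy'⟩
    change (y, t) ∈ e.target at hy
    change e.symm (y, t) ∈ e'.source at hy'
    obtain ⟨h1, h2⟩ := mem_of_mem_chart_target hUφ hes hev hy
    obtain ⟨-, h3⟩ := chart_symm_apply hes hev h1 h2 t
    rw [h3, hes'] at hy'
    obtain ⟨⟨x', t'⟩, ⟨hx', -⟩, hxt⟩ := hy'
    obtain ⟨γ, hγ⟩ := suspensionMk_eq_iff.1 hxt.symm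
    obtain ⟨rfl, rfl⟩ := Prod.mk.inj hγ
    have hV1 : IsOpen (φ.target ∩ φ.symm ⁻¹' (U ∩ (fun x => γ • x) ⁻¹' U')) :=
      φ.symm.isOpen_inter_preimage (hUo.inter (hUo'.preimage (hX.continuous_smul γ)))
    refine ⟨γ, _, hV1, ⟨h1, h2, hx'⟩, ?_, ?_⟩
    · have hm1 : ContMDiffOn (𝓡 d) (𝓡 d) ∞ φ.symm φ.target :=
        contMDiffOn_symm_of_mem_maximalAtlas (IsManifold.subset_maximalAtlas hφ)
      have hm2 : ContMDiffOn (𝓡 d) (𝓡 d) ∞ φ' φ'.source :=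
        contMDiffOn_of_mem_maximalAtlas (IsManifold.subset_maximalAtlas hφ')
      have hm3 := (hX.smooth γ).contMDiffOn (s := univ)
      have hsub : φ.target ∩ φ.symm ⁻¹' (U ∩ (fun x => γ • x) ⁻¹' U') ⊆ φ.target :=
        inter_subset_left
      have hcomp := hm2.comp ((hm3.comp hm1 fun _ _ => trivial).mono hsub)
        fun z hz => hUφ' hz.2.2
      exact (contMDiffOn_iff_contDiffOn.1 hcomp).of_le (by norm_num)
    · rintro z ⟨hz, hzU, hzU'⟩ s
      obtain ⟨-, h4⟩ := chart_symm_apply hes hev hz hzU s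
      show e' (e.symm (z, s)) = _
      rw [h4, ← hev' _ hzU']
      congr 1
      exact suspensionMk_eq_iff.2 ⟨γ, rfl⟩
  refine ⟨?_, ?_⟩
  · rintro ⟨y, t⟩ ⟨ht, hy⟩
    obtain ⟨γ, V, hVo, hyV, hsm, hform⟩ := key _ _ hy
    have hprod : ContDiffOn ℝ 1 (fun p : EuclideanSpace ℝ (Fin d) × ℝ =>
        (φ' (γ • φ.symm p.1), toRealMap (ρ γ) p.2)) (V ×ˢ Icc 0 1) :=
      (hsm.comp contDiff_fst.contDiffOn fun p hp => hp.1).prodMk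
        (((hρ γ).1.contDiffOn hα).comp contDiff_snd.contDiffOn fun p hp => hp.2)
    have h5 := hprod (y, t) ⟨hyV, ht⟩
    have hV : Prod.fst ⁻¹' V ∈ 𝓝 ((y, t) : EuclideanSpace ℝ (Fin d) × ℝ) :=
      (hVo.preimage continuous_fst).mem_nhds hyV
    have hval : ∀ p : EuclideanSpace ℝ (Fin d) × ℝ, p.1 ∈ V →
        (((e.symm.trans e') (p.1, projIcc 0 1 zero_le_one p.2)).1,
          (((e.symm.trans e') (p.1, projIcc 0 1 zero_le_one p.2)).2 : ℝ)) =
        (φ' (γ • φ.symm p.1), toRealMap (ρ γ) p.2) := by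
      intro p hp
      rw [hform _ hp]
      rfl
    refine ContDiffWithinAt.congr_of_eventuallyEq ?_
      (f := fun p : EuclideanSpace ℝ (Fin d) × ℝ => (φ' (γ • φ.symm p.1), toRealMap (ρ γ) p.2)) ?_
      (hval (y, t) hyV)
    · refine h5.mono_of_mem_nhdsWithin ?_
      filter_upwards [self_mem_nhdsWithin, mem_nhdsWithin_of_mem_nhds hV] with p hp hpV
      exact ⟨hpV, hp.1⟩
    · filter_upwards [mem_nhdsWithin_of_mem_nhds hV] with p hpV
      exact hval p hpV
  · rintro ⟨y, t⟩ hy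
    obtain ⟨γ, V, hVo, hyV, -, hform⟩ := key _ _ hy
    refine ⟨1, one_pos, toRealMap (ρ γ), (hρ γ).1.subset inter_subset_left, ?_⟩
    filter_upwards [(hVo.preimage continuous_fst).mem_nhds hyV] with q hq
    rw [show q = (q.1, q.2) from rfl, hform _ hq, toRealMap_coe]

theorem IsDeckAction.isC1HolderFoliation (hX : IsDeckAction d X Γ) {α : ℝ} (hα : 0 < α)
    (hρ : ∀ γ, IsC1HolderDiffeo α (ρ γ)) :
    IsC1HolderFoliation α (suspensionAtlas (EuclideanSpace ℝ (Fin d)) (X := X) ρ) where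
  t2 := hX.t2Space_suspension ρ
  secondCountable := hX.secondCountable_suspension ρ
  covers := by
    rintro ⟨x, t⟩
    obtain ⟨e, he, U, -, hxU, -, hes, -⟩ := hX.exists_chart ρ x
    refine ⟨e, he, ?_⟩
    rw [hes]
    exact ⟨(x, t), ⟨hxU, trivial⟩, rfl⟩
  compatible := fun _ he _ he' => hX.isFoliatedTransition hα hρ he he'

/-! ### Leaves and saturated sets of the suspension -/

theorem SamePlaque.exists_suspensionMk {p q : Suspension X ρ}
    (h : SamePlaque (suspensionAtlas (EuclideanSpace ℝ (Fin d)) (X := X) ρ) p q) :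
    ∃ (x y : X) (t : I), p = suspensionMk ρ (x, t) ∧ q = suspensionMk ρ (y, t) := by
  obtain ⟨e, ⟨φ, -, U, -, hUφ, -, hes, hev⟩, S, t, -, hS, ⟨⟨y, s⟩, ⟨hy, hs⟩, rfl⟩,
    ⟨⟨y', s'⟩, ⟨hy', hs'⟩, rfl⟩⟩ := h
  obtain rfl : s = t := hs
  obtain rfl : s' = s := hs'
  obtain ⟨h1, h2⟩ := mem_of_mem_chart_target hUφ hes hev (hS ⟨hy, rfl⟩)
  obtain ⟨h3, h4⟩ := mem_of_mem_chart_target hUφ hes hev (hS ⟨hy', rfl⟩)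
  exact ⟨_, _, s', (chart_symm_apply hes hev h1 h2 s').2, (chart_symm_apply hes hev h3 h4 s').2⟩

/-- The image of `X × {t}` is contained in one leaf, by connectedness of `X`. -/
theorem IsDeckAction.mem_leaf (hX : IsDeckAction d X Γ) (x y : X) (t : I) :
    suspensionMk ρ (y, t) ∈
      leaf (suspensionAtlas (EuclideanSpace ℝ (Fin d)) (X := X) ρ) (suspensionMk ρ (x, t)) := by
  have := hX.connected
  let P : X → X → Prop := fun x y => suspensionMk ρ (y, t) ∈
    leaf (suspensionAtlas (EuclideanSpace ℝ (Fin d)) (X := X) ρ) (suspensionMk ρ (x, t))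
  have : Std.Symm P := ⟨fun x y hxy => Relation.EqvGen.symm _ _ hxy⟩
  refine PreconnectedSpace.induction₂ P (fun x => ?_)
    ⟨fun x y z hxy hyz => Relation.EqvGen.trans _ _ _ hxy hyz⟩ x y
  obtain ⟨e, he, U, hUo, hxU, hUφ, hes, hev⟩ := hX.exists_chart ρ x
  set φ := chartAt (EuclideanSpace ℝ (Fin d)) x
  have hVo : IsOpen (φ.target ∩ φ.symm ⁻¹' U) := φ.symm.isOpen_inter_preimage hUo
  obtain ⟨r, hr, hball⟩ := Metric.isOpen_iff.1 hVo (φ x)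
    ⟨φ.map_source (hUφ hxU), by rw [mem_preimage, φ.left_inv (hUφ hxU)]; exact hxU⟩
  have hN : U ∩ φ ⁻¹' Metric.ball (φ x) r ∈ 𝓝 x :=
    inter_mem (hUo.mem_nhds hxU) ((φ.continuousAt (hUφ hxU)).preimage_mem_nhds
      (Metric.ball_mem_nhds _ hr))
  have hmem : ∀ z ∈ U, φ z ∈ Metric.ball (φ x) r →
      suspensionMk ρ (z, t) ∈ e.symm '' (Metric.ball (φ x) r ×ˢ {t}) := by
    intro z hz hzb
    refine ⟨(φ z, t), ⟨hzb, rfl⟩, ?_⟩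
    rw [← hev z hz, e.left_inv]
    rw [hes]
    exact ⟨_, ⟨hz, trivial⟩, rfl⟩
  filter_upwards [hN] with z hz
  refine Relation.EqvGen.rel _ _ ⟨e, he, Metric.ball (φ x) r, t,
    (convex_ball _ _).isPreconnected, ?_, hmem x hxU (Metric.mem_ball_self hr), hmem z hz.1 hz.2⟩
  rintro ⟨y, s⟩ ⟨hy, rfl⟩
  exact (chart_symm_apply hes hev (hball hy).1 (hball hy).2 s).1

/-- Invariant subsets of `[0,1]` give saturated subsets of the suspension. -/
theorem isSaturated_image {S : Set I} (hS : ∀ γ : Γ, ∀ t ∈ S, ρ γ t ∈ S) :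
    IsSaturated (suspensionAtlas (EuclideanSpace ℝ (Fin d)) (X := X) ρ)
      (suspensionMk ρ '' (univ ×ˢ S)) := by
  intro p hp q hq
  have key : ∀ p q, Relation.EqvGen (SamePlaque
      (suspensionAtlas (EuclideanSpace ℝ (Fin d)) (X := X) ρ)) p q →
      (p ∈ suspensionMk ρ '' (univ ×ˢ S) ↔ q ∈ suspensionMk ρ '' (univ ×ˢ S)) := by
    intro p q h
    induction h with
    | rel p q h =>
      obtain ⟨x, y, t, rfl, rfl⟩ := h.exists_suspensionMk
      rw [suspensionMk_mem_image_iff hS, suspensionMk_mem_image_iff hS]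
    | refl p => exact Iff.rfl
    | symm p q _ ih => exact ih.symm
    | trans p q r _ _ ih1 ih2 => exact ih1.trans ih2
  exact (key p q hq).1 hp

/-- If an open invariant set of the action on `[0,1]` contains no minimal set, the foliation of
the suspension does not have the LMS property. -/
theorem IsDeckAction.not_hasLMS (hX : IsDeckAction d X Γ) {f g : I ≃ₜ I}
    (hρ : ρ.range = Subgroup.closure {f, g}) {W : Set I} (hWo : IsOpen W) (hWne : W.Nonempty)
    (hWinv : IsGroupInvariant f g W)
    (hW : ∀ K ⊆ W, K.Nonempty → IsGroupInvariant f g K → closure K ∩ W ⊆ K →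
      ∃ K' ⊆ K, K'.Nonempty ∧ IsGroupInvariant f g K' ∧ closure K' ∩ W ⊆ K' ∧ K' ≠ K) :
    ¬ HasLMS (suspensionAtlas (EuclideanSpace ℝ (Fin d)) (X := X) ρ) := by
  intro hLMS
  have hrange : ∀ γ, ρ γ ∈ Subgroup.closure {f, g} := fun γ => hρ ▸ ⟨γ, rfl⟩
  have hinv : ∀ {S : Set I}, IsGroupInvariant f g S → ∀ γ : Γ, ∀ t ∈ S, ρ γ t ∈ S :=
    fun hS γ => hS _ (hrange γ)
  have := hX.connected
  obtain ⟨x₀⟩ : Nonempty X := inferInstance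
  obtain ⟨t₀, ht₀⟩ := hWne
  have hopen := isOpenMap_suspensionMk (ρ := ρ) hX.continuous_smul
  have hWsat := isSaturated_image (d := d) (X := X) (hinv hWinv)
  have hcont : Continuous fun t : I => suspensionMk ρ (x₀, t) :=
    continuous_suspensionMk.comp (continuous_const.prodMk continuous_id)
  obtain ⟨K, ⟨hK, hKmin⟩, -⟩ := hLMS (suspensionMk ρ '' (univ ×ˢ W))
    (hopen _ (isOpen_univ.prod hWo)) hWsat (suspensionMk ρ (x₀, t₀))
    (hWsat _ ⟨_, ⟨trivial, ht₀⟩, rfl⟩)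
  set S : Set I := {t | suspensionMk ρ (x₀, t) ∈ K} with hS
  have hmemS : ∀ (x : X) (t : I), suspensionMk ρ (x, t) ∈ K → t ∈ S := fun x t h =>
    hK.saturated _ h (hX.mem_leaf x x₀ t)
  have hSW : S ⊆ W := fun t ht => (suspensionMk_mem_image_iff (hinv hWinv)).1 (hK.subset ht)
  have hSne : S.Nonempty := by
    obtain ⟨⟨x, t⟩, h⟩ := hK.nonempty
    exact ⟨t, hmemS x t h⟩
  have hSinv : IsGroupInvariant f g S := by
    intro h hh t ht
    rw [← hρ] at hh
    obtain ⟨γ, rfl⟩ := hh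
    refine hmemS (γ • x₀) _ ?_
    have : suspensionMk ρ (γ • x₀, ρ γ t) = suspensionMk ρ (x₀, t) :=
      (suspensionMk_eq_iff (p := (x₀, t)).2 ⟨γ, rfl⟩).symm
    rw [this]
    exact ht
  have hScl : closure S ∩ W ⊆ S := by
    rintro t ⟨ht, htW⟩
    refine hK.closed ⟨?_, ⟨_, ⟨trivial, htW⟩, rfl⟩⟩
    exact closure_mono (image_subset_iff.2 fun s hs => hs)
      (image_closure_subset_closure_image hcont ⟨t, ht, rfl⟩)
  obtain ⟨S', hS'S, hS'ne, hS'inv, hS'cl, hne⟩ := hW S hSW hSne hSinv hScl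
  have hK'K : suspensionMk ρ '' (univ ×ˢ S') ⊆ K := by
    rintro _ ⟨⟨x, t⟩, ⟨-, ht⟩, rfl⟩
    exact hK.saturated _ (hS'S ht) (hX.mem_leaf x₀ x t)
  have hK' : IsRelClosedSaturated (suspensionAtlas (EuclideanSpace ℝ (Fin d)) (X := X) ρ)
      (suspensionMk ρ '' (univ ×ˢ W)) (suspensionMk ρ '' (univ ×ˢ S')) := by
    refine ⟨hK'K.trans hK.subset, ?_, isSaturated_image (hinv hS'inv), ?_⟩
    · obtain ⟨t, ht⟩ := hS'ne
      exact ⟨_, (x₀, t), ⟨trivial, ht⟩, rfl⟩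
    · rintro _ ⟨hcl, ⟨⟨x, t⟩, ⟨-, ht⟩, rfl⟩⟩
      rw [suspensionMk_mem_image_iff (hinv hS'inv)]
      refine hS'cl ⟨?_, ht⟩
      by_contra hnot
      have hO : IsOpen (suspensionMk (X := X) ρ '' (univ ×ˢ (closure S')ᶜ)) :=
        hopen _ (isOpen_univ.prod isClosed_closure.isOpen_compl)
      obtain ⟨p, ⟨⟨y, s⟩, ⟨-, hs⟩, rfl⟩, hp⟩ := mem_closure_iff.1 hcl _ hO
        ⟨(x, t), ⟨trivial, hnot⟩, rfl⟩
      exact hs (subset_closure ((suspensionMk_mem_image_iff (hinv hS'inv)).1 hp))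
  have heq := hKmin _ hK'K hK'
  refine hne (Subset.antisymm hS'S fun t ht => ?_)
  have h1 : suspensionMk ρ (x₀, t) ∈ K := ht
  rw [← heq] at h1
  exact (suspensionMk_mem_image_iff (hinv hS'inv)).1 h1

end

/-! ### Schottky groups -/

/-- The letter inverse to a letter of the free group. -/
abbrev invLetter {ι : Type*} (s : ι × Bool) : ι × Bool := (s.1, !s.2)

theorem invLetter_ne {ι : Type*} (s : ι × Bool) : invLetter s ≠ s := fun h =>
  Bool.not_ne_self s.2 (congrArg Prod.snd h)

/-- A Schottky system: to each letter `s` of the free group on `ι` corresponds a map `T s`, which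
exchanges the complement of the open region `O s⁻¹` and the closed region `P s ⊇ O s`. The maps
are allowed to be singular on the closed set `C s⁻¹ ⊆ O s⁻¹`, which has to be mapped to
`C s` (for an inversion, it consists of the centre, at which the true value is infinite). -/
structure IsSchottkySystem {ι E : Type*} [NormedAddCommGroup E] [NormedSpace ℝ E]
    (T : ι × Bool → E → E) (P O C : ι × Bool → Set E) : Prop where
  inv_apply : ∀ s x, T (invLetter s) (T s x) = x
  isClosed : ∀ s, IsClosed (P s)
  isOpen : ∀ s, IsOpen (O s)
  subset : ∀ s, O s ⊆ P s
  disjoint : ∀ s t, s ≠ t → Disjoint (P s) (P t)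
  attract : ∀ s, ∀ x ∉ O (invLetter s), T s x ∈ P s
  repel : ∀ s, ∀ x ∈ O (invLetter s), x ∉ C (invLetter s) → T s x ∉ O s
  isClosed_singular : ∀ s, IsClosed (C s)
  singular_subset : ∀ s, C s ⊆ O s
  map_singular : ∀ s, ∀ x ∈ C (invLetter s), T s x ∈ C s
  contDiffAt : ∀ s, ∀ x ∉ C (invLetter s), ContDiffAt ℝ ∞ (T s) x

/-- The standard fundamental domain of a Schottky group. -/
def schottkyDomain {ι E : Type*} (O : ι × Bool → Set E) : Set E := (⋃ s, O s)ᶜ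

theorem mem_schottkyDomain {ι E : Type*} {O : ι × Bool → Set E} {x : E} :
    x ∈ schottkyDomain O ↔ ∀ s, x ∉ O s := by
  simp [schottkyDomain]

section

variable {ι E : Type*} [NormedAddCommGroup E] [NormedSpace ℝ E]

variable {T : ι × Bool → E → E} {P O C : ι × Bool → Set E}

namespace IsSchottkySystem

/-- The action of the free group that is defined by a Schottky system. -/
def hom (h : IsSchottkySystem T P O C) : FreeGroup ι →* Equiv.Perm E :=
  FreeGroup.lift fun i =>
    { toFun := T (i, true)
      invFun := T (i, false)
      left_inv := h.inv_apply (i, true)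
      right_inv := h.inv_apply (i, false) }

theorem hom_mk_cons (h : IsSchottkySystem T P O C) (s : ι × Bool) (w : List (ι × Bool)) (x : E) :
    h.hom (FreeGroup.mk (s :: w)) x = T s (h.hom (FreeGroup.mk w) x) := by
  obtain ⟨i, _ | _⟩ := s <;>
  simp only [hom, FreeGroup.lift_mk, List.map_cons, List.prod_cons, Equiv.Perm.mul_apply] <;> rfl

theorem hom_mk_nil (h : IsSchottkySystem T P O C) (x : E) :
    h.hom (FreeGroup.mk []) x = x := rfl

theorem hom_mk_singleton (h : IsSchottkySystem T P O C) (s : ι × Bool) (x : E) :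
    h.hom (FreeGroup.mk [s]) x = T s x := by
  rw [hom_mk_cons, hom_mk_nil]

theorem hom_mul_apply (h : IsSchottkySystem T P O C) (γ δ : FreeGroup ι) (x : E) :
    h.hom (γ * δ) x = h.hom γ (h.hom δ x) := by
  rw [map_mul, Equiv.Perm.mul_apply]

theorem hom_inv_hom (h : IsSchottkySystem T P O C) (γ : FreeGroup ι) (x : E) :
    h.hom γ⁻¹ (h.hom γ x) = x := by
  rw [← hom_mul_apply, inv_mul_cancel, map_one, Equiv.Perm.one_apply]

theorem eq_of_mem (h : IsSchottkySystem T P O C) {s t : ι × Bool} {x : E} (hs : x ∈ P s)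
    (ht : x ∈ P t) : s = t := by
  by_contra hne
  exact Set.disjoint_left.1 (h.disjoint s t hne) hs ht

/-- Ping-pong: a reduced word maps the fundamental domain to the region of its first letter. -/
theorem hom_mk_mem (h : IsSchottkySystem T P O C) {x : E} (hx : x ∈ schottkyDomain O) :
    ∀ (w : List (ι × Bool)) (s : ι × Bool), FreeGroup.IsReduced (s :: w) →
      h.hom (FreeGroup.mk (s :: w)) x ∈ P s := by
  intro w
  induction w with
  | nil =>
    intro s _
    rw [hom_mk_singleton]
    exact h.attract s x (mem_schottkyDomain.1 hx _)
  | cons t w ih =>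
    intro s hs
    rw [FreeGroup.isReduced_cons_cons] at hs
    rw [hom_mk_cons]
    refine h.attract s _ fun hO => ?_
    have heq := h.eq_of_mem (ih t hs.2) (h.subset _ hO)
    have h2 := hs.1 (by rw [heq])
    rw [heq] at h2
    exact Bool.not_ne_self s.2 h2.symm

/-- Only letters map a point of the fundamental domain to the fundamental domain. -/
theorem eq_one_or_letter (h : IsSchottkySystem T P O C) {γ : FreeGroup ι} {x : E}
    (hx : x ∈ schottkyDomain O) (hγ : h.hom γ x ∈ schottkyDomain O) :
    γ = 1 ∨ ∃ s, γ = FreeGroup.mk [s] := by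
  classical
  have hred := FreeGroup.isReduced_toWord (x := γ)
  rw [← FreeGroup.mk_toWord (x := γ)] at hγ ⊢
  generalize γ.toWord = w at hγ hred
  match w with
  | [] => exact Or.inl rfl
  | [s] => exact Or.inr ⟨s, rfl⟩
  | s :: t :: w =>
    exfalso
    rw [FreeGroup.isReduced_cons_cons] at hred
    have hy := h.hom_mk_mem hx w t hred.2
    rw [hom_mk_cons] at hγ
    set y := h.hom (FreeGroup.mk (t :: w)) x
    have h1 := h.attract (invLetter s) (T s y) (mem_schottkyDomain.1 hγ _)
    rw [h.inv_apply] at h1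
    have heq := h.eq_of_mem hy h1
    have h2 := hred.1 (by rw [heq])
    rw [heq] at h2
    exact Bool.not_ne_self s.2 h2.symm

/-- The domain of discontinuity: the union of all translates of the fundamental domain. -/
def ordinarySet (h : IsSchottkySystem T P O C) : Set E :=
  {x | ∃ γ : FreeGroup ι, h.hom γ x ∈ schottkyDomain O}

theorem domain_subset (h : IsSchottkySystem T P O C) : schottkyDomain O ⊆ h.ordinarySet :=
  fun x hx => ⟨1, by simpa using hx⟩

theorem hom_mem (h : IsSchottkySystem T P O C) (γ : FreeGroup ι) {x : E}
    (hx : x ∈ h.ordinarySet) : h.hom γ x ∈ h.ordinarySet := by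
  obtain ⟨δ, hδ⟩ := hx
  refine ⟨δ * γ⁻¹, ?_⟩
  rwa [hom_mul_apply, hom_inv_hom]

/-- The action is free: a fixed point may be moved to the fundamental domain, and there a letter
and its inverse have disjoint images. -/
theorem eq_one_of_fixed (h : IsSchottkySystem T P O C) {γ : FreeGroup ι} {x : E}
    (hx : x ∈ h.ordinarySet) (hγ : h.hom γ x = x) : γ = 1 := by
  obtain ⟨δ, hδ⟩ := hx
  have hfix : h.hom (δ * γ * δ⁻¹) (h.hom δ x) = h.hom δ x := by
    rw [hom_mul_apply, hom_inv_hom, hom_mul_apply, hγ]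
  generalize h.hom δ x = y at hδ hfix
  have hone : δ * γ * δ⁻¹ = 1 := by
    rcases h.eq_one_or_letter hδ (hfix.symm ▸ hδ) with h1 | ⟨s, hs⟩
    · exact h1
    · exfalso
      rw [hs, hom_mk_singleton] at hfix
      have h1 := h.attract s y (mem_schottkyDomain.1 hδ _)
      have h2 := h.attract (invLetter s) y (mem_schottkyDomain.1 hδ _)
      have h3 : T (invLetter s) y = y := by
        conv_lhs => rw [← hfix]
        exact h.inv_apply s y
      rw [hfix] at h1
      rw [h3] at h2
      exact invLetter_ne s (h.eq_of_mem h2 h1)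
  simpa using hone

/-- The singularities lie outside the domain of discontinuity: by ping-pong, the reduced word that
leads from the fundamental domain to a singularity in `C s` begins with `s`, but removing this
letter leads to `C s⁻¹`, so that the next letter would be `s⁻¹`. -/
theorem notMem_singular (h : IsSchottkySystem T P O C) {x : E} (hx : x ∈ h.ordinarySet)
    (s : ι × Bool) : x ∉ C s := by
  classical
  intro hxs
  obtain ⟨δ, hδ⟩ := hx
  obtain ⟨γ, y, hy, rfl⟩ : ∃ (γ : FreeGroup ι) (y : E), y ∈ schottkyDomain O ∧ h.hom γ y = x :=
    ⟨δ⁻¹, _, hδ, h.hom_inv_hom δ x⟩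
  have hred := FreeGroup.isReduced_toWord (x := γ)
  rw [← FreeGroup.mk_toWord (x := γ)] at hxs
  generalize γ.toWord = w at hxs hred
  have hnot : ∀ t, y ∉ C t := fun t ht => mem_schottkyDomain.1 hy t (h.singular_subset t ht)
  have hP : ∀ t, C t ⊆ P t := fun t => (h.singular_subset t).trans (h.subset t)
  match w with
  | [] => exact hnot s hxs
  | t :: w =>
    obtain rfl := h.eq_of_mem (h.hom_mk_mem hy w t hred) (hP s hxs)
    have h1 : h.hom (FreeGroup.mk w) y ∈ C (invLetter t) := by
      have := h.map_singular (invLetter t) _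
        (by rwa [show invLetter (invLetter t) = t by simp [invLetter]])
      rwa [hom_mk_cons, h.inv_apply] at this
    match w with
    | [] => exact hnot _ h1
    | u :: w =>
      rw [FreeGroup.isReduced_cons_cons] at hred
      have heq := h.eq_of_mem (h.hom_mk_mem hy w u hred.2) (hP _ h1)
      have h2 := hred.1 (by rw [heq])
      rw [heq] at h2
      exact Bool.not_ne_self t.2 h2.symm

theorem contDiffAt_hom (h : IsSchottkySystem T P O C) (γ : FreeGroup ι) :
    ∀ x ∈ h.ordinarySet, ContDiffAt ℝ ∞ (h.hom γ) x := by
  have hT : ∀ s, ∀ x ∈ h.ordinarySet, ContDiffAt ℝ ∞ (T s) x := fun s x hx =>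
    h.contDiffAt s x (h.notMem_singular hx _)
  have hlist : ∀ w : List (ι × Bool), ∀ x ∈ h.ordinarySet,
      ContDiffAt ℝ ∞ (h.hom (FreeGroup.mk w)) x := by
    intro w
    induction w with
    | nil => exact fun x _ => contDiffAt_id
    | cons s w ih =>
      intro x hx
      have : (h.hom (FreeGroup.mk (s :: w)) : E → E) = T s ∘ h.hom (FreeGroup.mk w) :=
        funext (h.hom_mk_cons s w)
      rw [this]
      exact (hT s _ (h.hom_mem _ hx)).comp x (ih x hx)
  classical
  rw [← FreeGroup.mk_toWord (x := γ)]
  exact hlist _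

theorem continuousAt_hom (h : IsSchottkySystem T P O C) (γ : FreeGroup ι) {x : E}
    (hx : x ∈ h.ordinarySet) : ContinuousAt (h.hom γ) x :=
  (h.contDiffAt_hom γ x hx).continuousAt

/-- The fundamental domain and its neighbours. -/
def neighbours (h : IsSchottkySystem T P O C) : Set E :=
  {y | y ∈ schottkyDomain O ∨ ∃ s : ι × Bool, h.hom (FreeGroup.mk [s]) y ∈ schottkyDomain O}

/-- The neighbours of the fundamental domain fill up a neighbourhood of it. -/
theorem neighbours_mem_nhds [Finite ι] (h : IsSchottkySystem T P O C) {x : E}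
    (hx : x ∈ schottkyDomain O) : h.neighbours ∈ 𝓝 x := by
  have hxO := mem_schottkyDomain.1 hx
  have key : ∀ s, ∀ᶠ y in 𝓝 x, y ∈ O s →
      h.hom (FreeGroup.mk [invLetter s]) y ∈ schottkyDomain O := by
    intro s
    by_cases hs : x ∈ P s
    · have hxs : T (invLetter s) x ∈ P (invLetter s) := by
        refine h.attract _ _ ?_
        rw [show invLetter (invLetter s) = s by simp [invLetter]]
        exact hxO s
      have hcont : ContinuousAt (T (invLetter s)) x :=
        (h.contDiffAt _ _ (h.notMem_singular (h.domain_subset hx) _)).continuousAt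
      have h1 : ∀ᶠ y in 𝓝 x, ∀ t, t ≠ invLetter s → T (invLetter s) y ∉ P t := by
        refine eventually_all.2 fun t => ?_
        by_cases ht : t = invLetter s
        · simp [ht]
        · have : T (invLetter s) x ∈ (P t)ᶜ := fun hm => ht (h.eq_of_mem hm hxs)
          filter_upwards [hcont.preimage_mem_nhds ((h.isClosed t).isOpen_compl.mem_nhds this)]
            with y hy _
          exact hy
      have h2 : ∀ᶠ y in 𝓝 x, y ∉ C s :=
        (h.isClosed_singular s).isOpen_compl.mem_nhds (h.notMem_singular (h.domain_subset hx) s)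
      filter_upwards [h1, h2] with y hy1 hy2 hys
      rw [hom_mk_singleton, mem_schottkyDomain]
      intro t ht
      by_cases hts : t = invLetter s
      · subst hts
        refine h.repel (invLetter s) y ?_ ?_ ht <;>
          rwa [show invLetter (invLetter s) = s by simp [invLetter]]
      · exact hy1 t hts (h.subset t ht)
    · filter_upwards [(h.isClosed s).isOpen_compl.mem_nhds hs] with y hy hys
      exact absurd (h.subset s hys) hy
  filter_upwards [eventually_all.2 key] with y hy
  by_cases hyD : y ∈ schottkyDomain O
  · exact Or.inl hyD
  · rw [mem_schottkyDomain] at hyD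
    push Not at hyD
    obtain ⟨s, hs⟩ := hyD
    exact Or.inr ⟨_, hy s hs⟩

theorem preimage_neighbours_mem_nhds [Finite ι] (h : IsSchottkySystem T P O C) {γ : FreeGroup ι}
    {x : E} (hx : h.hom γ x ∈ schottkyDomain O) : h.hom γ ⁻¹' h.neighbours ∈ 𝓝 x :=
  (h.continuousAt_hom γ ⟨γ, hx⟩).preimage_mem_nhds (h.neighbours_mem_nhds hx)

theorem neighbours_eq_iUnion (h : IsSchottkySystem T P O C) : h.neighbours =
    ⋃ o : Option (ι × Bool), h.hom (FreeGroup.mk o.toList) ⁻¹' schottkyDomain O := by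
  ext y
  rw [iUnion_option]
  simp [neighbours, Option.toList, hom_mk_nil]

theorem isOpen_ordinarySet [Finite ι] (h : IsSchottkySystem T P O C) : IsOpen h.ordinarySet := by
  rw [isOpen_iff_mem_nhds]
  rintro x ⟨γ, hγ⟩
  filter_upwards [h.preimage_neighbours_mem_nhds hγ] with y hy
  rcases hy with hy | ⟨s, hs⟩
  · exact ⟨γ, hy⟩
  · refine ⟨FreeGroup.mk [s] * γ, ?_⟩
    rwa [hom_mul_apply]

/-- A compact subset of the domain of discontinuity is covered by finitely many translates of the
fundamental domain. -/
theorem exists_finite_cover [Finite ι] (h : IsSchottkySystem T P O C) {K : Set E}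
    (hK : IsCompact K) (hKX : K ⊆ h.ordinarySet) :
    ∃ F : Set (FreeGroup ι), F.Finite ∧ ∀ x ∈ K, ∃ γ ∈ F, h.hom γ x ∈ schottkyDomain O := by
  choose! γ hγ using fun x (hx : x ∈ K) => hKX hx
  obtain ⟨t, htK, ht⟩ := hK.elim_nhds_subcover (fun x => h.hom (γ x) ⁻¹' h.neighbours)
    fun x hx => h.preimage_neighbours_mem_nhds (hγ x hx)
  refine ⟨image2 (fun (o : Option (ι × Bool)) x => FreeGroup.mk o.toList * γ x) univ t,
    finite_univ.image2 _ t.finite_toSet, fun x hx => ?_⟩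
  obtain ⟨y, hy, hxy⟩ := mem_iUnion₂.1 (ht hx)
  rw [mem_preimage, neighbours_eq_iUnion] at hxy
  obtain ⟨o, ho⟩ := mem_iUnion.1 hxy
  refine ⟨_, ⟨o, trivial, y, hy, rfl⟩, ?_⟩
  rwa [hom_mul_apply]

/-- The action is properly discontinuous: by finite covers, this reduces to the finiteness of the
set of words that map a point of the fundamental domain to the fundamental domain. -/
theorem finite_return [Finite ι] (h : IsSchottkySystem T P O C) {K L : Set E}
    (hK : IsCompact K) (hKX : K ⊆ h.ordinarySet) (hL : IsCompact L) (hLX : L ⊆ h.ordinarySet) :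
    {γ : FreeGroup ι | ∃ x ∈ K, h.hom γ x ∈ L}.Finite := by
  obtain ⟨F, hF, hFK⟩ := h.exists_finite_cover hK hKX
  obtain ⟨G, hG, hGL⟩ := h.exists_finite_cover hL hLX
  have hfin : (range fun o : Option (ι × Bool) => FreeGroup.mk o.toList).Finite :=
    finite_range _
  refine (((hG.image2 (fun ε η => ε⁻¹ * η) hfin).image2 (fun η δ => η * δ) hF)).subset ?_
  rintro γ ⟨x, hx, hγx⟩
  obtain ⟨δ, hδ, hδx⟩ := hFK x hx
  obtain ⟨ε, hε, hεx⟩ := hGL _ hγx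
  have h1 : h.hom (ε * γ * δ⁻¹) (h.hom δ x) ∈ schottkyDomain O := by
    rwa [hom_mul_apply, hom_inv_hom, hom_mul_apply]
  have h2 : ε * γ * δ⁻¹ ∈ range fun o : Option (ι × Bool) => FreeGroup.mk o.toList := by
    rcases h.eq_one_or_letter hδx h1 with h | ⟨s, hs⟩
    · exact ⟨none, h.symm⟩
    · exact ⟨some s, hs.symm⟩
  refine ⟨_, ⟨ε, hε, _, h2, rfl⟩, δ, hδ, ?_⟩
  show ε⁻¹ * (ε * γ * δ⁻¹) * δ = γ
  group

/-- If the fundamental domain is connected and meets its neighbours, the domain of discontinuity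
is connected. -/
theorem isPreconnected_ordinarySet (h : IsSchottkySystem T P O C)
    (hD : IsPreconnected (schottkyDomain O))
    (hmeet : ∀ i, ∃ x ∈ schottkyDomain O, T (i, true) x ∈ schottkyDomain O) :
    IsPreconnected h.ordinarySet := by
  rcases (schottkyDomain O).eq_empty_or_nonempty with hempty | ⟨x₀, hx₀⟩
  · have : h.ordinarySet = ∅ := by
      refine eq_empty_of_forall_notMem fun x hx => ?_
      obtain ⟨γ, hγ⟩ := hx
      simp [hempty] at hγ
    rw [this]
    exact isPreconnected_empty
  have himage : ∀ (γ : FreeGroup ι) {S : Set E}, S ⊆ h.ordinarySet → IsPreconnected S →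
      h.hom γ '' S ⊆ h.ordinarySet ∧ IsPreconnected (h.hom γ '' S) := by
    intro γ S hS hSc
    refine ⟨?_, hSc.image _ fun x hx => (h.continuousAt_hom γ (hS hx)).continuousWithinAt⟩
    rintro _ ⟨x, hx, rfl⟩
    exact h.hom_mem γ (hS hx)
  have key : ∀ γ : FreeGroup ι, ∃ S ⊆ h.ordinarySet, IsPreconnected S ∧ schottkyDomain O ⊆ S ∧
      h.hom γ '' schottkyDomain O ⊆ S := by
    intro γ
    induction γ using FreeGroup.induction_on with
    | C1 => exact ⟨_, h.domain_subset, hD, Subset.rfl, by simp⟩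
    | of i =>
      obtain ⟨x, hx, hTx⟩ := hmeet i
      obtain ⟨h1, h2⟩ := himage (FreeGroup.of i) h.domain_subset hD
      refine ⟨_, union_subset h.domain_subset h1, IsPreconnected.union' ?_ hD h2,
        subset_union_left, subset_union_right⟩
      exact ⟨_, hTx, x, hx, h.hom_mk_singleton (i, true) x⟩
    | inv_of i ih =>
      obtain ⟨S, hS, hSc, h1, h2⟩ := ih
      obtain ⟨h3, h4⟩ := himage (FreeGroup.of i)⁻¹ hS hSc
      refine ⟨_, h3, h4, fun x hx => ?_, image_mono h1⟩
      exact ⟨_, h2 ⟨x, hx, rfl⟩, h.hom_inv_hom _ x⟩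
    | mul γ δ ih1 ih2 =>
      obtain ⟨S, hS, hSc, h1, h2⟩ := ih1
      obtain ⟨S', hS', hSc', h1', h2'⟩ := ih2
      obtain ⟨h3, h4⟩ := himage γ hS' hSc'
      refine ⟨_, union_subset hS h3, IsPreconnected.union' ?_ hSc h4,
        h1.trans subset_union_left, ?_⟩
      · exact ⟨h.hom γ x₀, h2 ⟨x₀, hx₀, rfl⟩, x₀, h1' hx₀, rfl⟩
      · rintro _ ⟨x, hx, rfl⟩
        exact Or.inr ⟨_, h2' ⟨x, hx, rfl⟩, (h.hom_mul_apply γ δ x).symm⟩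
  refine isPreconnected_of_forall x₀ fun y hy => ?_
  obtain ⟨γ, hγ⟩ := hy
  obtain ⟨S, hS, hSc, h1, h2⟩ := key γ⁻¹
  exact ⟨S, hS, h1 hx₀, h2 ⟨_, hγ, h.hom_inv_hom γ y⟩, hSc⟩

/-- The action of the free group on the domain of discontinuity. -/
instance instMulActionOrdinarySet (h : IsSchottkySystem T P O C) :
    MulAction (FreeGroup ι) h.ordinarySet where
  smul γ x := ⟨h.hom γ x, h.hom_mem γ x.2⟩
  one_smul x := Subtype.ext (by
    show h.hom 1 (x : E) = x
    rw [map_one, Equiv.Perm.one_apply])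
  mul_smul γ δ x := Subtype.ext (h.hom_mul_apply γ δ x)

end IsSchottkySystem

end

namespace IsSchottkySystem

variable {ι : Type*} {d : ℕ} {T : ι × Bool → EuclideanSpace ℝ (Fin d) → EuclideanSpace ℝ (Fin d)}
  {P O C : ι × Bool → Set (EuclideanSpace ℝ (Fin d))}

/-- A Schottky system in `ℝ^d` with a connected fundamental domain that meets its neighbours
defines a regular covering. -/
theorem exists_isDeckAction [Finite ι] (h : IsSchottkySystem T P O C)
    (hD : IsConnected (schottkyDomain O))
    (hmeet : ∀ i, ∃ x ∈ schottkyDomain O, T (i, true) x ∈ schottkyDomain O) :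
    ∃ _ : ChartedSpace (EuclideanSpace ℝ (Fin d)) h.ordinarySet,
      IsDeckAction d h.ordinarySet (FreeGroup ι) := by
  have hconn : IsConnected h.ordinarySet := ⟨hD.nonempty.mono h.domain_subset,
    h.isPreconnected_ordinarySet hD.isPreconnected hmeet⟩
  have : ConnectedSpace h.ordinarySet := isConnected_iff_connectedSpace.1 hconn
  have hemb : IsOpenEmbedding ((↑) : h.ordinarySet → EuclideanSpace ℝ (Fin d)) :=
    h.isOpen_ordinarySet.isOpenEmbedding_subtypeVal
  let cs := hemb.singletonChartedSpace
  refine ⟨cs, hemb.isManifold_singleton, inferInstance, inferInstance, this, ?_, ?_, ?_⟩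
  · intro γ
    refine ContMDiff.of_comp_isOpenEmbedding hemb ?_
    intro x
    have h1 : ContMDiffAt (𝓡 d) (𝓡 d) ∞ (h.hom γ) (x : EuclideanSpace ℝ (Fin d)) :=
      (h.contDiffAt_hom γ x x.2).contMDiffAt
    exact h1.comp x (contMDiff_isOpenEmbedding hemb x)
  · exact fun γ x hx => h.eq_one_of_fixed x.2 (congrArg Subtype.val hx)
  · refine ⟨fun {K L} hK hL => ?_⟩
    refine (h.finite_return (hK.image continuous_subtype_val) (by rintro _ ⟨x, -, rfl⟩; exact x.2)
      (hL.image continuous_subtype_val) (by rintro _ ⟨x, -, rfl⟩; exact x.2)).subset ?_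
    rintro γ ⟨_, ⟨x, hx, rfl⟩, hL⟩
    exact ⟨x, ⟨x, hx, rfl⟩, _, hL, rfl⟩

theorem compactSpace_suspension (h : IsSchottkySystem T P O C)
    (hD : IsCompact (schottkyDomain O)) (ρ : FreeGroup ι →* (I ≃ₜ I)) :
    CompactSpace (Suspension h.ordinarySet ρ) := by
  have h1 : IsCompact ((↑) ⁻¹' schottkyDomain O : Set h.ordinarySet) := by
    rw [Subtype.isCompact_iff, Subtype.image_preimage_coe,
      inter_eq_self_of_subset_right h.domain_subset]
    exact hD
  refine ⟨?_⟩
  convert (h1.prod (isCompact_univ (X := I))).image (continuous_suspensionMk (ρ := ρ))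
  refine (eq_univ_of_forall ?_).symm
  rintro ⟨⟨x, γ, hγ⟩, t⟩
  exact ⟨(γ • ⟨x, γ, hγ⟩, ρ γ t), ⟨hγ, trivial⟩,
    (suspensionMk_eq_iff (p := ((⟨x, γ, hγ⟩ : h.ordinarySet), t)).2 ⟨γ, rfl⟩).symm⟩

end IsSchottkySystem

/-! ### A planar Schottky group of rank two with compact fundamental domain -/

/-- The Euclidean plane. -/
abbrev Plane : Type := EuclideanSpace ℝ (Fin 2)

/-- The centres `(±3, 0)` of the two discs that are paired by the second generator. -/
def discCenter (ε : Bool) : Plane := EuclideanSpace.single 0 (if ε then 3 else -3)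

/-- The maps of the Schottky system: the first generator is the homothety of ratio `5`, the
second one is the inversion in the unit circle around `(-3, 0)`, followed by the translation to the
unit circle around `(3, 0)`. -/
def planeMap (s : Bool × Bool) (x : Plane) : Plane :=
  match s with
  | (false, true) => (5 : ℝ) • x
  | (false, false) => (5 : ℝ)⁻¹ • x
  | (true, ε) => EuclideanGeometry.inversion (discCenter !ε) 1 x - discCenter (!ε) + discCenter ε

/-- The closed regions of the Schottky system. -/
def planeClosed (s : Bool × Bool) : Set Plane :=
  match s with
  | (false, true) => {x | 5 ≤ ‖x‖}
  | (false, false) => {x | ‖x‖ ≤ 1}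
  | (true, ε) => Metric.closedBall (discCenter ε) 1

/-- The open regions of the Schottky system. -/
def planeOpen (s : Bool × Bool) : Set Plane :=
  match s with
  | (false, true) => {x | 5 < ‖x‖}
  | (false, false) => {x | ‖x‖ < 1}
  | (true, ε) => Metric.ball (discCenter ε) 1

/-- The singularities of the Schottky system: the centres of the inversions. -/
def planeSingular (s : Bool × Bool) : Set Plane :=
  match s with
  | (false, _) => ∅
  | (true, ε) => {discCenter ε}

theorem norm_discCenter (ε : Bool) : ‖discCenter ε‖ = 3 := by
  cases ε <;> simp [discCenter]

theorem dist_discCenter (ε : Bool) : dist (discCenter ε) (discCenter !ε) = 6 := by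
  cases ε <;> simp [discCenter, Real.dist_eq] <;> norm_num

theorem dist_planeMap (ε : Bool) (x : Plane) :
    dist (planeMap (true, ε) x) (discCenter ε) = 1 / dist x (discCenter !ε) := by
  have : dist (planeMap (true, ε) x) (discCenter ε) =
      dist (EuclideanGeometry.inversion (discCenter !ε) 1 x) (discCenter !ε) := by
    rw [planeMap, dist_eq_norm, dist_eq_norm, add_sub_cancel_right]
  rw [this, EuclideanGeometry.dist_inversion_center, one_pow]

theorem two_le_norm_of_mem {ε : Bool} {x : Plane} (hx : x ∈ Metric.closedBall (discCenter ε) 1) :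
    2 ≤ ‖x‖ ∧ ‖x‖ ≤ 4 := by
  rw [Metric.mem_closedBall, dist_eq_norm] at hx
  have h1 := norm_sub_norm_le x (discCenter ε)
  have h2 := norm_sub_norm_le (discCenter ε) x
  rw [norm_sub_rev] at h2
  rw [norm_discCenter] at h1 h2
  constructor <;> linarith

theorem disjoint_planeClosed (s t : Bool × Bool) (h : s ≠ t) :
    Disjoint (planeClosed s) (planeClosed t) := by
  rw [Set.disjoint_left]
  intro x hs ht
  obtain ⟨i, ε⟩ := s
  obtain ⟨j, η⟩ := t
  cases i <;> cases j
  · cases ε <;> cases η <;> simp_all [planeClosed] <;> linarith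
  · have := two_le_norm_of_mem (ε := η) ht
    cases ε <;> simp only [planeClosed, mem_ofPred_eq] at hs <;> linarith
  · have := two_le_norm_of_mem (ε := ε) hs
    cases η <;> simp only [planeClosed, mem_ofPred_eq] at ht <;> linarith
  · obtain rfl : η = !ε := by cases ε <;> cases η <;> simp_all
    have h1 : dist x (discCenter ε) ≤ 1 := hs
    have h2 : dist x (discCenter !ε) ≤ 1 := ht
    have h3 := dist_triangle_left (discCenter ε) (discCenter !ε) x
    rw [dist_discCenter] at h3
    linarith

theorem isSchottkySystem_plane :
    IsSchottkySystem planeMap planeClosed planeOpen planeSingular where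
  inv_apply := by
    rintro ⟨_ | _, ε⟩ x
    · cases ε <;> simp [planeMap, invLetter]
    · have h : EuclideanGeometry.inversion (discCenter ε) 1
          (EuclideanGeometry.inversion (discCenter !ε) 1 x - discCenter (!ε) + discCenter ε) =
          x - discCenter (!ε) + discCenter ε := by
        have := EuclideanGeometry.inversion_inversion (discCenter !ε) (one_ne_zero (α := ℝ)) x
        simp only [EuclideanGeometry.inversion, vsub_eq_sub, vadd_eq_add, dist_eq_norm,
          add_sub_cancel_right] at this ⊢
        rw [← eq_sub_iff_add_eq] at this
        rw [this]
      simp only [planeMap, Bool.not_not]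
      rw [h]
      abel
  isClosed := by
    rintro ⟨_ | _, ε⟩
    · cases ε
      · exact isClosed_le continuous_norm continuous_const
      · exact isClosed_le continuous_const continuous_norm
    · exact Metric.isClosed_closedBall
  isOpen := by
    rintro ⟨_ | _, ε⟩
    · cases ε
      · exact isOpen_lt continuous_norm continuous_const
      · exact isOpen_lt continuous_const continuous_norm
    · exact Metric.isOpen_ball
  subset := by
    rintro ⟨_ | _, ε⟩
    · cases ε
      · exact fun x (hx : ‖x‖ < 1) => hx.le
      · exact fun x (hx : 5 < ‖x‖) => hx.le
    · exact Metric.ball_subset_closedBall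
  disjoint := disjoint_planeClosed
  attract := by
    rintro ⟨_ | _, ε⟩ x hx
    · cases ε <;>
        simp only [planeOpen, planeClosed, planeMap, invLetter, Bool.not_true, Bool.not_false,
          mem_ofPred_eq, not_lt, norm_smul] at hx ⊢ <;> norm_num <;> linarith
    · have hx : 1 ≤ dist x (discCenter !ε) := not_lt.1 hx
      show dist _ _ ≤ 1
      rw [dist_planeMap]
      exact (div_le_one (by linarith)).2 hx
  repel := by
    rintro ⟨_ | _, ε⟩ x hx hxC
    · cases ε <;>
        simp only [planeOpen, planeMap, invLetter, Bool.not_true, Bool.not_false,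
          mem_ofPred_eq, not_lt, norm_smul] at hx ⊢ <;> norm_num <;> linarith
    · have hx : dist x (discCenter !ε) < 1 := hx
      have hne : x ≠ discCenter !ε := hxC
      show ¬ dist _ _ < 1
      rw [dist_planeMap, not_lt]
      exact (one_le_div (dist_pos.2 hne)).2 hx.le
  isClosed_singular := by
    rintro ⟨_ | _, ε⟩
    · exact isClosed_empty
    · exact isClosed_singleton
  singular_subset := by
    rintro ⟨_ | _, ε⟩
    · exact empty_subset _
    · exact singleton_subset_iff.2 (Metric.mem_ball_self one_pos)
  map_singular := by
    rintro ⟨_ | _, ε⟩ x hx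
    · exact hx.elim
    · obtain rfl : x = discCenter !ε := hx
      simp [planeMap, planeSingular]
  contDiffAt := by
    rintro ⟨_ | _, ε⟩ x hx
    · cases ε <;> exact contDiffAt_id.const_smul _
    · have hne : x ≠ discCenter !ε := hx
      exact ((contDiffAt_const.inversion contDiffAt_const contDiffAt_id hne).sub
        contDiffAt_const).add contDiffAt_const

theorem mem_planeDomain {x : Plane} : x ∈ schottkyDomain planeOpen ↔
    1 ≤ ‖x‖ ∧ ‖x‖ ≤ 5 ∧ ∀ ε, 1 ≤ dist x (discCenter ε) := by
  rw [mem_schottkyDomain]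
  constructor
  · intro h
    exact ⟨not_lt.1 (h (false, false)), not_lt.1 (h (false, true)),
      fun ε => not_lt.1 (h (true, ε))⟩
  · rintro ⟨h1, h2, h3⟩ ⟨_ | _, ε⟩
    · cases ε
      · exact not_lt.2 h1
      · exact not_lt.2 h2
    · exact not_lt.2 (h3 ε)

theorem isCompact_planeDomain : IsCompact (schottkyDomain planeOpen) := by
  refine Metric.isCompact_of_isClosed_isBounded
    (isOpen_iUnion isSchottkySystem_plane.isOpen).isClosed_compl ?_
  refine Metric.isBounded_closedBall (x := (0 : Plane)) (r := 5) |>.subset fun x hx => ?_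
  rw [mem_closedBall_zero_iff]
  exact (mem_planeDomain.1 hx).2.1

theorem sphere_subset_planeDomain {r : ℝ} (hr : r = 1 ∨ r = 5) :
    Metric.sphere (0 : Plane) r ⊆ schottkyDomain planeOpen := by
  intro x hx
  rw [mem_sphere_zero_iff_norm] at hx
  refine mem_planeDomain.2 ⟨by rcases hr with rfl | rfl <;> linarith,
    by rcases hr with rfl | rfl <;> linarith, fun ε => ?_⟩
  by_contra! hlt
  have := two_le_norm_of_mem (ε := ε) (Metric.mem_closedBall.2 hlt.le)
  rcases hr with rfl | rfl <;> linarith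

/-- The ray through a point of the fundamental domain cannot meet the two discs both before and
behind this point. Hence one of the two radial segments to the boundary circles of the annulus
stays in the fundamental domain. -/
theorem exists_radial_segment {x : Plane} (hx : x ∈ schottkyDomain planeOpen) :
    (∀ t ∈ Icc ‖x‖⁻¹ 1, t • x ∈ schottkyDomain planeOpen) ∨
      ∀ t ∈ Icc 1 (5 / ‖x‖), t • x ∈ schottkyDomain planeOpen := by
  obtain ⟨h1, h5, hc⟩ := mem_planeDomain.1 hx
  have hpos : 0 < ‖x‖ := by linarith
  have hnorm : ∀ t, 0 ≤ t → ‖t • x‖ = t * ‖x‖ := fun t ht => by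
    rw [norm_smul, Real.norm_of_nonneg ht]
  have hinner : ∀ (t : ℝ) ε, 0 < t → dist (t • x) (discCenter ε) < 1 →
      0 < inner ℝ x (discCenter ε) := by
    intro t ε ht hlt
    have h2 : ‖t • x - discCenter ε‖ ^ 2 < 1 := by
      rw [← dist_eq_norm]
      have := dist_nonneg (x := t • x) (y := discCenter ε)
      nlinarith
    rw [norm_sub_sq_real, norm_discCenter, inner_smul_left] at h2
    have h3 : 0 < t * inner ℝ x (discCenter ε) := by
      have := sq_nonneg ‖t • x‖
      simp only [conj_trivial] at h2
      linarith
    exact pos_of_mul_pos_right h3 ht.le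
  by_contra! hcon
  obtain ⟨⟨s, hs, hsx⟩, t, ht, htx⟩ := hcon
  have hs0 : 0 < s := (inv_pos.2 hpos).trans_le hs.1
  have ht0 : 0 < t := by linarith [ht.1]
  have hs1 : ‖s • x‖ = s * ‖x‖ := hnorm s hs0.le
  have ht1 : ‖t • x‖ = t * ‖x‖ := hnorm t ht0.le
  have hsn : 1 ≤ s * ‖x‖ := (inv_le_iff_one_le_mul₀ hpos).1 hs.1
  have htn : t * ‖x‖ ≤ 5 := (le_div_iff₀ hpos).1 ht.2
  rw [mem_planeDomain, hs1] at hsx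
  rw [mem_planeDomain, ht1] at htx
  push Not at hsx htx
  obtain ⟨ε, hε⟩ := hsx hsn (by nlinarith [hs.2])
  obtain ⟨η, hη⟩ := htx (by nlinarith [ht.1]) htn
  have hε1 := hinner s ε hs0 hε
  have hη1 := hinner t η ht0 hη
  obtain rfl : ε = η := by
    by_contra hne
    obtain rfl : η = !ε := by cases ε <;> cases η <;> simp_all
    have : discCenter (!ε) = - discCenter ε := by
      cases ε <;> ext i <;> simp only [discCenter] <;> simp <;> split_ifs <;> norm_num
    rw [this, inner_neg_right] at hη1
    linarith
  -- By convexity of the disc, it contains the point `x` between `s x` and `t x`.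
  have hconv := (convex_ball (discCenter ε) 1).segment_subset (Metric.mem_ball.2 hε)
    (Metric.mem_ball.2 hη)
  have hxm : x ∈ segment ℝ (s • x) (t • x) := by
    have h : (1 : ℝ) ∈ segment ℝ s t := by
      rw [segment_eq_Icc (hs.2.trans ht.1)]
      exact ⟨hs.2, ht.1⟩
    obtain ⟨a, b, ha, hb, hab, h⟩ := h
    refine ⟨a, b, ha, hb, hab, ?_⟩
    rw [smul_smul, smul_smul, ← add_smul]
    rw [smul_eq_mul, smul_eq_mul] at h
    rw [h, one_smul]
  exact absurd (Metric.mem_ball.1 (hconv hxm)) (not_lt.2 (hc ε))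

theorem isConnected_planeDomain : IsConnected (schottkyDomain planeOpen) := by
  have hrank : 1 < Module.rank ℝ Plane := by
    rw [← Module.finrank_eq_rank, finrank_euclideanSpace_fin]
    norm_num
  -- Two circles, joined by a segment on the second axis.
  let e : Plane := EuclideanSpace.single 1 1
  have he : ‖e‖ = 1 := by simp [e]
  let B : Set Plane := (fun t : ℝ => t • e) '' Icc 1 5
  have hB : IsPreconnected B :=
    isPreconnected_Icc.image _ (continuous_id.smul continuous_const).continuousOn
  have hBD : B ⊆ schottkyDomain planeOpen := by
    rintro _ ⟨t, ht, rfl⟩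
    have ht0 : 0 ≤ t := by linarith [ht.1]
    have hn : ‖t • e‖ = t := by rw [norm_smul, he, mul_one, Real.norm_of_nonneg ht0]
    refine mem_planeDomain.2 ⟨hn.symm ▸ ht.1, hn.symm ▸ ht.2, fun ε => ?_⟩
    have horth : inner ℝ (t • e) (discCenter ε) = 0 := by
      simp [e, discCenter, inner_smul_left, EuclideanSpace.inner_single_left]
    have h2 : ‖t • e - discCenter ε‖ ^ 2 = t ^ 2 + 9 := by
      rw [norm_sub_sq_real, norm_discCenter, horth, hn]
      ring
    rw [dist_eq_norm]
    nlinarith [norm_nonneg (t • e - discCenter ε), sq_nonneg t]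
  let A : Set Plane := Metric.sphere 0 1 ∪ B ∪ Metric.sphere 0 5
  have hA : IsPreconnected A := by
    refine IsPreconnected.union' ?_ (IsPreconnected.union' ?_ ?_ hB) ?_
    · refine ⟨(5 : ℝ) • e, Or.inr ⟨5, by norm_num, rfl⟩, ?_⟩
      rw [mem_sphere_zero_iff_norm, norm_smul, he]
      norm_num
    · exact ⟨e, by simp [he], 1, by norm_num, one_smul _ _⟩
    · exact (isConnected_sphere hrank 0 zero_le_one).isPreconnected
    · exact (isConnected_sphere hrank 0 (by norm_num)).isPreconnected
  have hAD : A ⊆ schottkyDomain planeOpen :=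
    union_subset (union_subset (sphere_subset_planeDomain (Or.inl rfl)) hBD)
      (sphere_subset_planeDomain (Or.inr rfl))
  have heA : e ∈ A := Or.inl (Or.inl (by simp [he]))
  refine ⟨⟨e, hAD heA⟩, isPreconnected_of_forall e fun x hx => ?_⟩
  have hpos : 0 < ‖x‖ := by linarith [(mem_planeDomain.1 hx).1]
  have hcont : Continuous fun t : ℝ => t • x := continuous_id.smul continuous_const
  obtain ⟨S, hS, hSD, hxS, y, hyS, hyA⟩ : ∃ S : Set Plane, IsPreconnected S ∧
      S ⊆ schottkyDomain planeOpen ∧ x ∈ S ∧ ∃ y ∈ S, y ∈ A := by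
    rcases exists_radial_segment hx with h | h
    · have hle : ‖x‖⁻¹ ≤ 1 := inv_le_one_of_one_le₀ (mem_planeDomain.1 hx).1
      refine ⟨(fun t : ℝ => t • x) '' Icc ‖x‖⁻¹ 1, isPreconnected_Icc.image _ hcont.continuousOn,
        by rintro _ ⟨t, ht, rfl⟩; exact h t ht, ⟨1, ⟨hle, le_rfl⟩, one_smul _ _⟩,
        _, ⟨‖x‖⁻¹, ⟨le_rfl, hle⟩, rfl⟩, Or.inl (Or.inl ?_)⟩
      rw [mem_sphere_zero_iff_norm, norm_smul, norm_inv, norm_norm, inv_mul_cancel₀ hpos.ne']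
    · have hle : 1 ≤ 5 / ‖x‖ := (one_le_div hpos).2 (mem_planeDomain.1 hx).2.1
      refine ⟨(fun t : ℝ => t • x) '' Icc 1 (5 / ‖x‖), isPreconnected_Icc.image _
        hcont.continuousOn, by rintro _ ⟨t, ht, rfl⟩; exact h t ht,
        ⟨1, ⟨le_rfl, hle⟩, one_smul _ _⟩, _, ⟨5 / ‖x‖, ⟨hle, le_rfl⟩, rfl⟩, Or.inr ?_⟩
      rw [mem_sphere_zero_iff_norm, norm_smul, norm_div, norm_norm,
        Real.norm_of_nonneg (by norm_num), div_mul_cancel₀ _ hpos.ne']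
  exact ⟨A ∪ S, union_subset hAD hSD, Or.inl heA, Or.inr hxS,
    IsPreconnected.union' ⟨y, hyA, hyS⟩ hA hS⟩

theorem exists_planeMap_mem (i : Bool) :
    ∃ x ∈ schottkyDomain planeOpen, planeMap (i, true) x ∈ schottkyDomain planeOpen := by
  cases i
  · have he : ‖(EuclideanSpace.single 1 1 : Plane)‖ = 1 := by simp
    refine ⟨EuclideanSpace.single 1 1, sphere_subset_planeDomain (Or.inl rfl) (by simp),
      sphere_subset_planeDomain (Or.inr rfl) ?_⟩
    rw [mem_sphere_zero_iff_norm, planeMap, norm_smul, he]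
    norm_num
  · -- The boundary point `(-2, 0)` of one disc is mapped to the boundary point `(4, 0)` of the
    -- other one.
    have h : planeMap (true, true) (EuclideanSpace.single 0 (-2)) = EuclideanSpace.single 0 4 := by
      have hd : dist (EuclideanSpace.single 0 (-2) : Plane) (discCenter false) = 1 := by
        simp [discCenter, Real.dist_eq]
        norm_num
      have hinv : EuclideanGeometry.inversion (discCenter false) 1
          (EuclideanSpace.single 0 (-2) : Plane) = EuclideanSpace.single 0 (-2) :=
        EuclideanGeometry.inversion_of_mem_sphere hd
      rw [planeMap, Bool.not_true, hinv]
      ext j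
      fin_cases j <;> simp [discCenter]
      norm_num
    refine ⟨EuclideanSpace.single 0 (-2), ?_, ?_⟩
    · refine mem_planeDomain.2 ⟨by simp, by simp; norm_num, fun ε => ?_⟩
      cases ε <;> simp [discCenter, Real.dist_eq] <;> norm_num
    · rw [h]
      refine mem_planeDomain.2 ⟨by simp, by simp; norm_num, fun ε => ?_⟩
      cases ε <;> simp [discCenter, Real.dist_eq] <;> norm_num

/-- Every group that is generated by two homeomorphisms of the interval has a suspension with a
compact total space. -/
theorem exists_compact_suspension (f g : I ≃ₜ I) :
    ∃ (d : ℕ) (X : Type) (_ : TopologicalSpace X)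
      (_ : ChartedSpace (EuclideanSpace ℝ (Fin d)) X)
      (Γ : Type) (_ : Group Γ) (_ : MulAction Γ X) (ρ : Γ →* (I ≃ₜ I)),
      IsDeckAction d X Γ ∧ ρ.range = Subgroup.closure {f, g} ∧
      CompactSpace (Suspension X ρ) := by
  obtain ⟨cs, hX⟩ := isSchottkySystem_plane.exists_isDeckAction isConnected_planeDomain
    exists_planeMap_mem
  let ρ : FreeGroup Bool →* (I ≃ₜ I) := FreeGroup.lift fun i => if i then f else g
  refine ⟨2, isSchottkySystem_plane.ordinarySet, inferInstance, cs, FreeGroup Bool, inferInstance,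
    inferInstance, ρ, hX, ?_, isSchottkySystem_plane.compactSpace_suspension
      isCompact_planeDomain ρ⟩
  rw [FreeGroup.range_lift_eq_closure]
  congr 1
  ext h
  simp [eq_comm, or_comm]

theorem mainTheorem1 (α : ℝ) (hα₀ : 0 < α) (hα₁ : α < (Real.sqrt 5 - 1) / 2) :
    ∃ (a : ℤ → I) (b u v c : ℕ → I) (f g : I ≃ₜ I),
      IsHectorConstruction (fun k => 2 ^ k) a b u v c f g ∧
      IsC1HolderDiffeo α f ∧ IsC1HolderDiffeo α g ∧
      -- every suspension of the group generated by `f` and `g`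
      (∀ (d : ℕ) (X : Type*) [TopologicalSpace X] [ChartedSpace (EuclideanSpace ℝ (Fin d)) X]
        (Γ : Type*) [Group Γ] [MulAction Γ X], IsDeckAction d X Γ →
        ∀ ρ : Γ →* (I ≃ₜ I), ρ.range = Subgroup.closure {f, g} →
          IsC1HolderFoliation α (suspensionAtlas (EuclideanSpace ℝ (Fin d)) (X := X) ρ) ∧
          ¬ HasLMS (suspensionAtlas (EuclideanSpace ℝ (Fin d)) (X := X) ρ)) ∧
      -- there are such suspensions whose total space is compact
      (∃ (d : ℕ) (X : Type) (_ : TopologicalSpace X)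
        (_ : ChartedSpace (EuclideanSpace ℝ (Fin d)) X)
        (Γ : Type) (_ : Group Γ) (_ : MulAction Γ X) (ρ : Γ →* (I ≃ₜ I)),
        IsDeckAction d X Γ ∧ ρ.range = Subgroup.closure {f, g} ∧
        CompactSpace (Suspension X ρ)) := by
  obtain ⟨a, b, u, v, c, f, g, H, hfm, hgm, hf, hg⟩ := exists_hectorConstruction
  have hα : α ≤ 5 / 8 := by
    have h5 : Real.sqrt 5 ≤ 9 / 4 := by
      rw [Real.sqrt_le_left (by norm_num)]
      norm_num
    linarith
  have hf' := hf.of_exponent_le hα₀ hα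
  have hg' := hg.of_exponent_le hα₀ hα
  obtain ⟨W, hWo, hWne, hWinv, hW⟩ := H.exists_open_without_minimal hfm hgm
  refine ⟨a, b, u, v, c, f, g, H, hf', hg', fun d X _ _ Γ _ _ hX ρ hρ => ⟨?_, ?_⟩,
    exists_compact_suspension f g⟩
  · exact hX.isC1HolderFoliation hα₀ fun γ =>
      IsC1HolderDiffeo.of_mem_closure hα₀ hf' hg' (hρ ▸ ⟨γ, rfl⟩)
  · exact hX.not_hasLMS hρ hWo hWne hWinv hW

end
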